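/- **Setting.** Fix integers $n,r,a\ge 0$, $g\ge 1$, a real $\beta\ge 0$, and put $\kappa=2^a$. Let $H$ be an $n$-qubit Hamiltonian with $0\le H\le \kappa(1-2^{-r})$ and let $\rho_\beta=e^{-\beta H}/\mathrm{tr}\,e^{-\beta H}$. Let $\{C_j\}$ be a finite set of $n$-qubit unitaries, closed under adjoint, generating the algebra of all $n$-qubit operators, with a probability distribution $\mu$ on it such that $\mu(C)=\mu(C^\dagger)>0$. Write $\|M\|_1=\mathrm{tr}\sqrt{M^\dagger M}$, and for a linear map $R$ let $\|R\|=\max\{\|R(M)\|_1: M=M^\dagger,\ \|M\|_1=1\}$. Let $\log=\log_2$, with $\log 0=-\infty$ in $r_{\beta H}:=1+\log\kappa+\log\beta$. **Algorithm.** Register 1 has $n$ qubits, registers 2 and 3 have $g$ blocks of $r$ qubits each, register 4 is one qubit. Standard phase estimation on register 1 and one block is: Hadamards on the block, then $\sum_k U^k\otimes|k\rangle\langle k|$ with $U=e^{2\pi i H/\kappa}$, then the inverse quantum Fourier transform; the flipped version is: Hadamards, the adjoint of the controlled powers, the quantum Fourier transform. The boosted version $Q$ (standard or flipped) runs this once on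 each of the $g$ blocks of a register. If $E$ is a basis state of an estimate register, $\overline E$ is $\kappa 2^{-r}$ times the (lower) median of its $g$ integers, and $f_{EE'}=\min\{1,e^{\beta\overline E-\beta\overline{E'}}\}$. For $\tau\in(0,1]$, $$W=\sum_{E,E'}|EE'\rangle\langle EE'|\otimes\begin{pmatrix}\sqrt{1-\tau^2f_{EE'}}&\tau\sqrt{f_{EE'}}\\ \tau\sqrt{f_{EE'}}&-\sqrt{1-\tau^2f_{EE'}}\end{pmatrix}.$$ One iteration: choose standard or flipped estimation with probability $\frac12$ each and $C\sim\mu$; append registers 2, 3, 4 in the state $|0\rangle$; apply $U_{\mathcal C}=Q_{1,3}\,C\,Q_{1,2}$ and then $W$; measure register 4. On outcome 0 apply $W^\dagger$ and measure register 4 again; if the second outcome is also 0, apply $U_{\mathcal C}^\dagger$. Finally trace out registers 2, 3, 4. Let $\mathcal E$ be the resulting channel on $n$-qubit operators. **Generator.** Let $W^{(10)}=\sum_{E,E'}\sqrt{f_{EE'}}\,|EE'\rangle\langle EE'|\otimes|1\rangle\langle 0|$. For each choice $\mathcal C$ of $C$ and of the kind of estimation let $\mathcal L_{\mathcal C}(\rho)=2\,\mathrm{tr}_{2,3,4}\big(W^{(10)}U_{\mathcal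 C}(\rho\otimes|0\rangle\langle0|)U_{\mathcal C}^\dagger W^{(10)\dagger}\big)-X_{\mathcal C}\rho-\rho X_{\mathcal C}$ with $X_{\mathcal C}=\langle 0|U_{\mathcal C}^\dagger W^{(10)\dagger}W^{(10)}U_{\mathcal C}|0\rangle$, where $|0\rangle$ is the all-zero state of registers 2, 3, 4, and let $\mathcal L=\sum_{\mathcal C}\frac12\mu(C)\mathcal L_{\mathcal C}$. When there is a unique quantum state $\rho_{\mathcal L}$ with $\mathcal L(\rho_{\mathcal L})=0$, put $t_{mix}(\mathcal L,\epsilon)=\inf\{t\ge0:\|e^{t\mathcal L}(\rho)-\rho_{\mathcal L}\|_1\le\epsilon\text{ for every state }\rho\}$. Let $$b=16\cdot 2^{2n}\left(\tfrac45\right)^{g/2}+40\,\beta\,\kappa\,2^{-r}.$$ **Theorem.** (1) Assume $r\ge r_{\beta H}$. There is exactly one quantum state $\rho_{\mathcal L}$ with $\mathcal L(\rho_{\mathcal L})=0$. For every $\epsilon>0$ the set defining $t_{mix}=t_{mix}(\mathcal L,\epsilon)$ is nonempty, and $$\|\rho_{\mathcal L}-\rho_\beta\|_1\le\epsilon+\|\mathcal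 L(\rho_\beta)\|_1\,t_{mix}.$$ For every $\tau\in(0,1]$ and every integer $K\ge 0$, $\|\mathcal E^K-e^{K\tau^2\mathcal L}\|\le 2e^4K\tau^4$. If moreover $K=t_{mix}/\tau^2$, then for every state $\rho$ $$\|\mathcal E^K(\rho)-\rho_\beta\|_1\le 2\epsilon+(b+2e^4\tau^2)\,t_{mix}.$$ (2) Count $1$ for a two-qubit gate, a measurement, the preparation of a fresh qubit and a random choice, $h$ for a use of controlled $e^{\pm 2\pi iH/\kappa}$, $c$ for a jump operator, and $w$ for $W$ or $W^\dagger$. There are an absolute constant $A$ and polynomials $P,Q$ with nonnegative integer coefficients such that for all $n$, $a$ (with $\kappa=2^a$), $\beta\ge0$, $0<\epsilon\le1$, $T\ge1$ there are integers $g\ge1$, $r\ge\max(r_{\beta H},\log\kappa)$, $K$ and $\tau\in(0,1]$, depending on these data only, with $$K=T/\tau^2\le A\,T^2/\epsilon,\qquad \tau^2\le A\,\epsilon/T,\qquad g\le A(1+n+\log T+\log\tfrac1\epsilon),$$ $$r\le A(1+\log(1+\beta)+\log\kappa+\log T+\log\tfrac1\epsilon),\qquad K\cdot4g\cdot Q(2^r,n)\le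 P(T,\beta,\kappa,\tfrac1\epsilon,n),$$ such that for all $H$ and $(\{C_j\},\mu)$ as above: if $t_{mix}(\mathcal L,\epsilon)\le T$, then $\|\mathcal E^K(\rho)-\rho_\beta\|_1\le3\epsilon$ for every state $\rho$; and for every random choice $\mathcal C$ there are circuits of two-qubit gates, controlled $e^{\pm 2\pi iH/\kappa}$ and jump operators that implement $U_{\mathcal C}$ and $U_{\mathcal C}^\dagger$ exactly and with which $K$ iterations cost at most $K\cdot4g\cdot Q(2^r,n)\,(1+h+c+w)$. In particular the running time is polynomial in $n$ and $1/\epsilon$ (up to the unit costs $h,c,w$) if the mixing time bound $T$, $\beta$ and $\kappa$ are polynomial in $n$. -/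

import Mathlib

open scoped Matrix Kronecker ComplexOrder

noncomputable section

namespace QMetropolis

/-! ### Registers, states, norms -/

/-- Computational basis of the `n`-qubit system (register 1). -/
abbrev Sys (n : ℕ) := Fin n → Bool

/-- Bit strings of length `r`, the basis of the ancilla of one run of phase estimation. -/
abbrev Bits (r : ℕ) := Fin r → Bool

/-- Basis of an estimate register: `g` blocks of `r` qubits. -/
abbrev Est (g r : ℕ) := Fin g → Bits r

/-- Basis of registers 2, 3 (two estimate registers) and 4 (one qubit). -/
abbrev Anc (g r : ℕ) := Est g r × Est g r × Bool

/-- Operators on `n` qubits. -/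
abbrev Op (n : ℕ) := Matrix (Sys n) (Sys n) ℂ

/-- Operators on registers 1, 2, 3, 4. -/
abbrev FullOp (n g r : ℕ) := Matrix (Sys n × Anc g r) (Sys n × Anc g r) ℂ

/-- Trace norm `tr √(M†M)`, i.e. the sum of the singular values of `M`. -/
def traceNorm {n : ℕ} (M : Op n) : ℝ :=
  ∑ i, Real.sqrt ((Matrix.isHermitian_conjTranspose_mul_self M).eigenvalues i)

/-- Density matrices. -/
def IsState {n : ℕ} (ρ : Op n) : Prop := ρ.PosSemidef ∧ ρ.trace = 1

/-- `max { ‖R(M)‖₁ : M Hermitian, ‖M‖₁ = 1 } ≤ c`. -/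
def InducedNormLE {n : ℕ} (R : Op n → Op n) (c : ℝ) : Prop :=
  ∀ M : Op n, M.IsHermitian → traceNorm M = 1 → traceNorm (R M) ≤ c

/-- The Gibbs state `exp(-βH) / tr exp(-βH)`. -/
def gibbs {n : ℕ} (β : ℝ) (H : Op n) : Op n :=
  (NormedSpace.exp ((-β : ℂ) • H)).trace⁻¹ • NormedSpace.exp ((-β : ℂ) • H)

/-- `0 ≤ H ≤ c`: `H` is Hermitian with all its eigenvalues in `[0, c]`. -/
def SpectrumLE {n : ℕ} (H : Op n) (c : ℝ) : Prop :=
  H.PosSemidef ∧ ((c : ℂ) • (1 : Op n) - H).PosSemidef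

/-- A finite set of unitaries, closed under adjoint, that generates the full operator algebra,
and a probability distribution on it that gives `C` and `C†` the same positive weight. -/
structure JumpEnsemble (n : ℕ) where
  ops : Finset (Op n)
  prob : Op n → ℝ
  unitary : ∀ C ∈ ops, C ∈ Matrix.unitaryGroup (Sys n) ℂ
  adjoint_mem : ∀ C ∈ ops, Cᴴ ∈ ops
  prob_pos : ∀ C ∈ ops, 0 < prob C
  prob_sum : ∑ C ∈ ops, prob C = 1
  prob_adjoint : ∀ C ∈ ops, prob Cᴴ = prob C
  generates : Algebra.adjoin ℂ (ops : Set (Op n)) = ⊤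

/-! ### Quantum phase estimation -/

/-- The integer encoded by a bit string (bit `j` has weight `2 ^ j`). -/
def Bits.val {r : ℕ} (b : Bits r) : ℕ := ∑ j : Fin r, if b j then 2 ^ (j : ℕ) else 0

/-- `U = exp(i H t)` with `t = 2π / κ`. -/
def evolution {n : ℕ} (κ : ℝ) (H : Op n) : Op n :=
  NormedSpace.exp ((2 * Real.pi * Complex.I / κ : ℂ) • H)

/-- Hadamard gate on each of `r` qubits. -/
def hadamardLayer (r : ℕ) : Matrix (Bits r) (Bits r) ℂ :=
  fun b k => ∏ j : Fin r, (if b j && k j then (-1 : ℂ) else 1) / (Real.sqrt 2 : ℂ)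

/-- Quantum Fourier transform on `r` qubits. -/
def qft (r : ℕ) : Matrix (Bits r) (Bits r) ℂ :=
  fun b k => Complex.exp (2 * Real.pi * Complex.I * (b.val * k.val : ℕ) / (2 ^ r : ℂ)) /
    (Real.sqrt (2 ^ r) : ℂ)

/-- The controlled powers `∑ₖ Uᵏ ⊗ |k⟩⟨k|`. -/
def ctrlPowers {n : ℕ} (r : ℕ) (U : Op n) : Matrix (Sys n × Bits r) (Sys n × Bits r) ℂ :=
  fun x y => if x.2 = y.2 then (U ^ x.2.val) x.1 y.1 else 0

/-- One run of phase estimation on system and `r` ancilla qubits. `flip = false` is the standard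
one: Hadamards, controlled powers of `U`, inverse Fourier transform. `flip = true` is the flipped
one: Hadamards, adjoint of the controlled powers, Fourier transform. -/
def qpe {n : ℕ} (κ : ℝ) (H : Op n) (r : ℕ) (flip : Bool) :
    Matrix (Sys n × Bits r) (Sys n × Bits r) ℂ :=
  if flip then
    ((1 : Op n) ⊗ₖ qft r) * (ctrlPowers r (evolution κ H))ᴴ * ((1 : Op n) ⊗ₖ hadamardLayer r)
  else
    ((1 : Op n) ⊗ₖ (qft r)ᴴ) * ctrlPowers r (evolution κ H) * ((1 : Op n) ⊗ₖ hadamardLayer r)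

/-- An operator on system and one block, acting on the system and block `i` of `g` blocks. -/
def onBlock {n g r : ℕ} (i : Fin g) (Q : Matrix (Sys n × Bits r) (Sys n × Bits r) ℂ) :
    Matrix (Sys n × Est g r) (Sys n × Est g r) ℂ :=
  fun x y => if ∀ j, j ≠ i → x.2 j = y.2 j then Q (x.1, x.2 i) (y.1, y.2 i) else 0

/-- Boosted phase estimation: `g` sequential runs, one for each block. -/
def boostedQPE {n : ℕ} (κ : ℝ) (H : Op n) (g r : ℕ) (flip : Bool) :
    Matrix (Sys n × Est g r) (Sys n × Est g r) ℂ :=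
  (List.ofFn fun i : Fin g => onBlock i (qpe κ H r flip)).prod

/-- Let an operator on system and estimate register act on registers 1 and 2. -/
def onReg2 {n g r : ℕ} (Q : Matrix (Sys n × Est g r) (Sys n × Est g r) ℂ) : FullOp n g r :=
  fun x y => if x.2.2 = y.2.2 then Q (x.1, x.2.1) (y.1, y.2.1) else 0

/-- Let an operator on system and estimate register act on registers 1 and 3. -/
def onReg3 {n g r : ℕ} (Q : Matrix (Sys n × Est g r) (Sys n × Est g r) ℂ) : FullOp n g r :=
  fun x y => if x.2.1 = y.2.1 ∧ x.2.2.2 = y.2.2.2 then Q (x.1, x.2.2.1) (y.1, y.2.2.1) else 0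

/-! ### One iteration of the algorithm -/

/-- The median of the `g` integers stored in an estimate register: the least integer `v` such that
at least half of them are `≤ v` (the usual median for odd `g`, the lower one for even `g`). -/
def median {g r : ℕ} (E : Est g r) : ℕ :=
  sInf {v : ℕ | g ≤ 2 * (Finset.univ.filter fun i : Fin g => (E i).val ≤ v).card}

/-- The energy represented by an estimate register. -/
def energy {g r : ℕ} (κ : ℝ) (E : Est g r) : ℝ := κ * median E / 2 ^ r

/-- Metropolis acceptance rate. -/
def acceptRate {g r : ℕ} (κ β : ℝ) (E E' : Est g r) : ℝ :=
  min 1 (Real.exp (β * energy κ E - β * energy κ E'))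

/-- The rotation of the last qubit, for `f` an acceptance rate. -/
def rotation (τ f : ℝ) : Bool → Bool → ℝ
  | false, false => Real.sqrt (1 - τ ^ 2 * f)
  | false, true => τ * Real.sqrt f
  | true, false => τ * Real.sqrt f
  | true, true => -Real.sqrt (1 - τ ^ 2 * f)

/-- The acceptance operator `W` on registers 2, 3, 4. -/
def accW (n g r : ℕ) (κ β τ : ℝ) : FullOp n g r :=
  (1 : Op n) ⊗ₖ (fun x y : Anc g r =>
    if x.1 = y.1 ∧ x.2.1 = y.2.1 then
      ((rotation τ (acceptRate κ β x.1 x.2.1) x.2.2 y.2.2 : ℝ) : ℂ) else 0)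

/-- `W⁽¹⁰⁾ = ∑ √f_{EE'} |EE'⟩⟨EE'| ⊗ |1⟩⟨0|`. -/
def accW10 (n g r : ℕ) (κ β : ℝ) : FullOp n g r :=
  (1 : Op n) ⊗ₖ (fun x y : Anc g r =>
    if x.1 = y.1 ∧ x.2.1 = y.2.1 ∧ x.2.2 = true ∧ y.2.2 = false then
      ((Real.sqrt (acceptRate κ β x.1 x.2.1) : ℝ) : ℂ) else 0)

/-- The projection `Δ_b` onto outcome `b` of the measurement of register 4. -/
def proj (n g r : ℕ) (b : Bool) : FullOp n g r :=
  Matrix.diagonal fun x => if x.2.2.2 = b then 1 else 0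

/-- The all-zero basis vector of registers 2, 3, 4. -/
def anc0 (g r : ℕ) : Anc g r := (fun _ _ => false, fun _ _ => false, false)

/-- `U = QPE_{1,3} ∘ C ∘ QPE_{1,2}`. -/
def unitaryU {n : ℕ} (κ : ℝ) (H : Op n) (g r : ℕ) (flip : Bool) (C : Op n) : FullOp n g r :=
  onReg3 (boostedQPE κ H g r flip) * (C ⊗ₖ (1 : Matrix (Anc g r) (Anc g r) ℂ)) *
    onReg2 (boostedQPE κ H g r flip)

/-- Trace out registers 2, 3, 4. -/
def traceAnc {n g r : ℕ} (X : FullOp n g r) : Op n := fun i j => ∑ a, X (i, a) (j, a)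

/-- The block `⟨0| X |0⟩` for the all-zero state of registers 2, 3, 4. -/
def zeroBlock {n g r : ℕ} (X : FullOp n g r) : Op n := fun i j => X (i, anc0 g r) (j, anc0 g r)

/-- `ρ ⊗ |0⟩⟨0|`. -/
def withAnc {n : ℕ} (g r : ℕ) (ρ : Op n) : FullOp n g r :=
  ρ ⊗ₖ Matrix.single (anc0 g r) (anc0 g r) (1 : ℂ)

/-- `ρ ↦ tr_{2,3,4} (O (ρ ⊗ |0⟩⟨0|) O†)`. -/
def conjChannel {n g r : ℕ} (O : FullOp n g r) (ρ : Op n) : Op n :=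
  traceAnc (O * withAnc g r ρ * Oᴴ)

/-- Operation performed in the case "accept". -/
def opAccept {n : ℕ} (κ β τ : ℝ) (g r : ℕ) (U : FullOp n g r) : FullOp n g r :=
  proj n g r true * accW n g r κ β τ * proj n g r false * U

/-- Operation performed in the case "alternate accept". -/
def opAltAccept {n : ℕ} (κ β τ : ℝ) (g r : ℕ) (U : FullOp n g r) : FullOp n g r :=
  proj n g r true * (accW n g r κ β τ)ᴴ * proj n g r false *
    (proj n g r false * accW n g r κ β τ * proj n g r false) * U

/-- Operation performed in the case "reject". -/
def opReject {n : ℕ} (κ β τ : ℝ) (g r : ℕ) (U : FullOp n g r) : FullOp n g r :=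
  Uᴴ * (proj n g r false * (accW n g r κ β τ)ᴴ * proj n g r false) *
    (proj n g r false * accW n g r κ β τ * proj n g r false) * U

/-- One iteration with fixed random choices. -/
def stepFixed {n : ℕ} (κ β τ : ℝ) (g r : ℕ) (U : FullOp n g r) (ρ : Op n) : Op n :=
  conjChannel (opAccept κ β τ g r U) ρ + conjChannel (opAltAccept κ β τ g r U) ρ +
    conjChannel (opReject κ β τ g r U) ρ

/-- The channel of one iteration: average over the phase estimation (standard or flipped, with
probability `1/2` each) and the jump operator. -/
def step {n : ℕ} (κ β : ℝ) (H : Op n) (J : JumpEnsemble n) (g r : ℕ) (τ : ℝ) (ρ : Op n) : Op n :=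
  ∑ C ∈ J.ops, ∑ flip : Bool,
    ((1 / 2 * J.prob C : ℝ) : ℂ) • stepFixed κ β τ g r (unitaryU κ H g r flip C) ρ

/-! ### The effective generator and its mixing time -/

/-- `2 M⁽ᵃ⁾ - M⁽ʳ⁾` with fixed random choices, where
`M⁽ᵃ⁾(ρ) = tr_{2,3,4} (W⁽¹⁰⁾ U (ρ ⊗ |0⟩⟨0|) U† W⁽¹⁰⁾†)` and `M⁽ʳ⁾(ρ) = X ρ + ρ X` with
`X = ⟨0| U† W⁽¹⁰⁾† W⁽¹⁰⁾ U |0⟩`. -/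
def generatorFixed {n : ℕ} (κ β : ℝ) (g r : ℕ) (U : FullOp n g r) (ρ : Op n) : Op n :=
  (2 : ℂ) • conjChannel (accW10 n g r κ β * U) ρ -
    (zeroBlock (Uᴴ * (accW10 n g r κ β)ᴴ * accW10 n g r κ β * U) * ρ +
      ρ * zeroBlock (Uᴴ * (accW10 n g r κ β)ᴴ * accW10 n g r κ β * U))

/-- The effective generator `𝓛`. -/
def generator {n : ℕ} (κ β : ℝ) (H : Op n) (J : JumpEnsemble n) (g r : ℕ) (ρ : Op n) : Op n :=
  ∑ C ∈ J.ops, ∑ flip : Bool,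
    ((1 / 2 * J.prob C : ℝ) : ℂ) • generatorFixed κ β g r (unitaryU κ H g r flip C) ρ

/-- `e^{tL}(ρ) = ∑ₖ tᵏ Lᵏ(ρ) / k!`. -/
def expFlow {n : ℕ} (L : Op n → Op n) (t : ℝ) (ρ : Op n) : Op n :=
  ∑' k : ℕ, ((t : ℂ) ^ k / (k.factorial : ℂ)) • L^[k] ρ

/-- `σ` is a quantum state with `L(σ) = 0`. -/
def IsFixedState {n : ℕ} (L : Op n → Op n) (σ : Op n) : Prop := IsState σ ∧ L σ = 0

/-- The times at which every initial state is `ε`-close to `σ`. -/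
def mixingTimes {n : ℕ} (L : Op n → Op n) (σ : Op n) (ε : ℝ) : Set ℝ :=
  {t | 0 ≤ t ∧ ∀ ρ : Op n, IsState ρ → traceNorm (expFlow L t ρ - σ) ≤ ε}

/-- The mixing time of `L` with fixed state `σ`. -/
def mixingTime {n : ℕ} (L : Op n → Op n) (σ : Op n) (ε : ℝ) : ℝ := sInf (mixingTimes L σ ε)

/-- The bound on `‖𝓛(ρ_β)‖₁`. The term `(4/5)^g` is the Chernoff bound for the probability that
at least half of `g` independent runs, each with success probability at least `4/5`, fail. -/
def fixedPointError (n g r : ℕ) (κ β : ℝ) : ℝ :=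
  16 * 2 ^ (2 * n) * Real.sqrt ((4 / 5 : ℝ) ^ g) + 40 * β * κ / 2 ^ r

/-- `r ≥ r_{βH} = 1 + log κ + log β`, where `log 0 = -∞`. -/
def PrecisionOK (r : ℕ) (κ β : ℝ) : Prop :=
  β = 0 ∨ 1 + Real.logb 2 κ + Real.logb 2 β ≤ r

/-! ### Circuits and their cost -/

/-- Names of the qubits: system, block `i` and bit `k` of register 2 (`reg = false`) or
register 3 (`reg = true`), and register 4. -/
inductive Qubit (n g r : ℕ)
  | sys (i : Fin n)
  | est (reg : Bool) (i : Fin g) (k : Fin r)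
  | flag

/-- The value of a qubit in a basis state. -/
def readBit {n g r : ℕ} (x : Sys n × Anc g r) : Qubit n g r → Bool
  | .sys i => x.1 i
  | .est reg i k => if reg then x.2.2.1 i k else x.2.1 i k
  | .flag => x.2.2.2

/-- Elementary operations: an arbitrary two-qubit gate, one use of controlled `U` or `U†`
(`inverse = true`) with a control in an estimate register and `U = exp(2πiH/κ)` acting on the
system, and a jump operator on the system. -/
inductive Gate {n : ℕ} (J : JumpEnsemble n) (g r : ℕ)
  | two (p q : Qubit n g r) (hpq : p ≠ q) (u : Matrix.unitaryGroup (Bool × Bool) ℂ)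
  | evolve (reg : Bool) (i : Fin g) (k : Fin r) (inverse : Bool)
  | jump (C : Op n) (hC : C ∈ J.ops)

open Classical in
/-- The unitary of an elementary operation. -/
def Gate.eval {n : ℕ} {J : JumpEnsemble n} {g r : ℕ} (κ : ℝ) (H : Op n) :
    Gate J g r → FullOp n g r
  | .two p q _ u => fun x y =>
      if ∀ c, c ≠ p → c ≠ q → readBit x c = readBit y c then
        (u : Matrix (Bool × Bool) (Bool × Bool) ℂ)
          (readBit x p, readBit x q) (readBit y p, readBit y q)
      else 0
  | .evolve reg i k inverse => fun x y =>
      if x.2 = y.2 then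
        (if readBit x (.est reg i k) then
          (if inverse then (evolution κ H)ᴴ else evolution κ H) else 1) x.1 y.1
      else 0
  | .jump C _ => C ⊗ₖ (1 : Matrix (Anc g r) (Anc g r) ℂ)

/-- Cost of an elementary operation: `1` for a two-qubit gate, `h` for a controlled evolution,
`c` for a jump operator. -/
def Gate.cost {n : ℕ} {J : JumpEnsemble n} {g r : ℕ} (h c : ℕ) : Gate J g r → ℕ
  | .two .. => 1
  | .evolve .. => h
  | .jump .. => c

/-- The unitary of a circuit, whose first gate acts first. -/
def circuitEval {n : ℕ} {J : JumpEnsemble n} {g r : ℕ} (κ : ℝ) (H : Op n)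
    (l : List (Gate J g r)) : FullOp n g r :=
  (l.map (Gate.eval κ H)).reverse.prod

/-- The cost of a circuit. -/
def circuitCost {n : ℕ} {J : JumpEnsemble n} {g r : ℕ} (h c : ℕ) (l : List (Gate J g r)) : ℕ :=
  (l.map (Gate.cost h c)).sum

/-- Cost of one iteration on its longest branch, if `l` implements `U` and `l'` implements `U†`:
preparation of `2gr + 1` fresh qubits, two random choices, `U`, `W`, a measurement, `W†`, a
measurement, and `U†`, where `W` and `W†` cost `w` each. -/
def iterationCost {n : ℕ} {J : JumpEnsemble n} {g r : ℕ} (h c w : ℕ)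
    (l l' : List (Gate J g r)) : ℕ :=
  (2 * g * r + 1) + 2 + circuitCost h c l + w + 1 + w + 1 + circuitCost h c l'

end QMetropolis

end

/-!
Averaged over its random choices, one iteration of the algorithm is a completely positive, trace
preserving map of the form `1 + τ² 𝓛 + O(τ⁴)`, where `𝓛` is the Lindblad generator whose Kraus
operators are the blocks `√f_{EE'} ⟨EE'| U |0⟩` that estimate an energy, jump, and estimate again
(`stepFixed_eq`, `isWeakStep_stepH`). Everything about the semigroup `e^{t𝓛}` follows from this
expansion. It is a limit of powers of channels, so it preserves positivity and the trace and
contracts the trace norm (`IsWeakStep.tendsto_pow`), and telescoping gives the distance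
`2 e⁴ K τ⁴` between `K` iterations and time `K τ²` (`IsWeakStep.norm_pow_sub_flow_le`).

The transition operators of a jump operator `C` add up to `C`, because the outcome amplitudes of
phase estimation on an eigenvector add up to one. Hence the Kraus operators of `𝓛` generate all
operators (`adjoin_genKraus`), the semigroup makes every nonzero positive operator positive definite
(`IsWeakStep.flow_posDef`), and at time one it is a strict contraction on traceless operators. This
yields the unique stationary state and a finite mixing time (`IsWeakStep.exists_stationary`). A
state on which `𝓛` is small moves slowly under the semigroup, so it is close to the stationary state
up to the mixing time (`traceNorm_stationary_sub_gibbs_le`).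

That `𝓛` is small on the Gibbs state is approximate detailed balance. The Fourier amplitudes of the
flipped phase estimation are the complex conjugates of the standard ones, so the transition operator
of `(C†, flipped)` from `E'` to `E` is the adjoint of that of `(C, standard)` from `E` to `E'`.
Pairing gain terms with the loss terms of the reversed moves (`generator_eq_paired`) leaves an
operator that would vanish if the estimates were exact, by detailed balance of the Metropolis rule.
One run of phase estimation returns a neighbouring grid point with probability at least
`8 / π² > 4 / 5`; a Chernoff bound makes the median of `g` runs fail with probability at most
`(4 / 5)^g` (`median_tail`). A Cauchy–Schwarz inequality for the trace norm then bounds the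
contributions of the grid error and of the failures separately (`traceNorm_detailedBalance_le`).

For the running time, the unitaries of one iteration are written as circuits: controlled powers as
repeated controlled evolutions, the Fourier transform as its textbook circuit of Hadamard gates and
controlled rotations followed by the reversal of the qubits (`implementable_unitaryU`). The
parameters make each of the three error terms at most a fixed fraction of `ε` (`exists_steps`,
`exists_repetitions`, `exists_precision`); since `2 ^ r` is then bounded by a polynomial in the
data, so is the cost.
-/

noncomputable section

namespace QMetropolis

/-! ### The trace norm on Hermitian operators -/

lemma exists_diagonalization {n : ℕ} {M : Op n} (hM : M.IsHermitian) :
    ∃ (V : Op n) (d : Sys n → ℝ), Vᴴ * V = 1 ∧ V * Vᴴ = 1 ∧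
      M = V * Matrix.diagonal (fun i => (d i : ℂ)) * Vᴴ := by
  refine ⟨hM.eigenvectorUnitary, hM.eigenvalues, ?_, ?_, ?_⟩
  · exact Unitary.coe_star_mul_self _
  · exact Unitary.coe_mul_star_self _
  · conv_lhs => rw [hM.spectral_theorem, Unitary.conjStarAlgAut_apply]
    rfl

lemma traceNorm_of_diagonalization {n : ℕ} {M V : Op n} {d : Sys n → ℝ} (hV : Vᴴ * V = 1)
    (hM : M = V * Matrix.diagonal (fun i => (d i : ℂ)) * Vᴴ) :
    traceNorm M = ∑ i, |d i| := by
  set h := Matrix.isHermitian_conjTranspose_mul_self M with hh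
  have hMM : Mᴴ * M = V * (Matrix.diagonal (fun i => ((d i ^ 2 : ℝ) : ℂ)) * Vᴴ) := by
    have hd : (Matrix.diagonal (fun i => (d i : ℂ)))ᴴ = Matrix.diagonal (fun i => (d i : ℂ)) := by
      rw [Matrix.diagonal_conjTranspose]
      congr 1
      funext i
      simp
    rw [hM]
    simp only [Matrix.conjTranspose_mul, Matrix.conjTranspose_conjTranspose, hd]
    calc V * (Matrix.diagonal (fun i => (d i : ℂ)) * Vᴴ) *
          (V * Matrix.diagonal (fun i => (d i : ℂ)) * Vᴴ)
        = V * Matrix.diagonal (fun i => (d i : ℂ)) * (Vᴴ * V) *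
          Matrix.diagonal (fun i => (d i : ℂ)) * Vᴴ := by simp only [Matrix.mul_assoc]
      _ = _ := by
        rw [hV, Matrix.mul_one, Matrix.mul_assoc V, Matrix.diagonal_mul_diagonal, Matrix.mul_assoc]
        congr 3
        funext i
        push_cast
        ring
  have hc : (Mᴴ * M).charpoly.roots =
      Multiset.map (fun i => ((d i ^ 2 : ℝ) : ℂ)) Finset.univ.val := by
    have key : ∀ f : Sys n → ℂ, (∏ i, (Polynomial.X - Polynomial.C (f i))).roots =
        Multiset.map f Finset.univ.val := fun f => by
      rw [Polynomial.roots_prod]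
      · simp
      · simp [Finset.prod_ne_zero_iff, Polynomial.X_sub_C_ne_zero]
    rw [hMM, Matrix.charpoly_mul_comm, Matrix.mul_assoc, hV, Matrix.mul_one,
      Matrix.charpoly_diagonal, key]
  rw [h.roots_charpoly_eq_eigenvalues] at hc
  have hs := congrArg (fun s : Multiset ℂ => (s.map fun z => Real.sqrt z.re).sum) hc
  simp only [Multiset.map_map, Function.comp_def] at hs
  have e1 : ∀ x : ℝ, ((RCLike.ofReal x : ℂ)).re = x := fun x => Complex.ofReal_re x
  simp only [e1, Complex.ofReal_re, Real.sqrt_sq_eq_abs] at hs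
  exact hs

lemma trace_unitary_conj {n : ℕ} {V : Op n} (hV : V * Vᴴ = 1) (M : Op n) :
    (Vᴴ * M * V).trace = M.trace := by
  rw [Matrix.trace_mul_cycle, hV, Matrix.one_mul]

/-- The trace norm of a difference of positive operators is at most the sum of their traces. -/
lemma traceNorm_sub_le {n : ℕ} {P N : Op n} (hP : P.PosSemidef) (hN : N.PosSemidef) :
    traceNorm (P - N) ≤ P.trace.re + N.trace.re := by
  obtain ⟨V, d, h1, h2, hd⟩ := exists_diagonalization (hP.1.sub hN.1)
  rw [traceNorm_of_diagonalization h1 hd, ← trace_unitary_conj h2 P, ← trace_unitary_conj h2 N,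
    Matrix.trace, Matrix.trace, Complex.re_sum, Complex.re_sum, ← Finset.sum_add_distrib]
  refine Finset.sum_le_sum fun i _ => ?_
  have hdi : Vᴴ * (P - N) * V = Matrix.diagonal (fun i => (d i : ℂ)) := by
    rw [hd]
    calc Vᴴ * (V * Matrix.diagonal (fun i => (d i : ℂ)) * Vᴴ) * V
        = (Vᴴ * V) * Matrix.diagonal (fun i => (d i : ℂ)) * (Vᴴ * V) := by
          simp only [Matrix.mul_assoc]
      _ = _ := by rw [h1, Matrix.one_mul, Matrix.mul_one]
  have hi : (Vᴴ * P * V) i i - (Vᴴ * N * V) i i = (d i : ℂ) := by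
    rw [← Matrix.sub_apply, ← Matrix.sub_mul, ← Matrix.mul_sub, hdi, Matrix.diagonal_apply_eq]
  have hPi : 0 ≤ ((Vᴴ * P * V) i i).re := by
    have := (hP.conjTranspose_mul_mul_same V).diag_nonneg (i := i)
    exact (Complex.le_def.1 this).1
  have hNi : 0 ≤ ((Vᴴ * N * V) i i).re := by
    have := (hN.conjTranspose_mul_mul_same V).diag_nonneg (i := i)
    exact (Complex.le_def.1 this).1
  have hre := congrArg Complex.re hi
  simp only [Complex.sub_re, Complex.ofReal_re] at hre
  simp only [Matrix.diag_apply]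
  rw [← hre]
  exact abs_le.2 ⟨by linarith, by linarith⟩

/-- The Jordan decomposition of a Hermitian operator attains its trace norm. -/
lemma exists_posPart_negPart {n : ℕ} {M : Op n} (hM : M.IsHermitian) :
    ∃ P N : Op n, P.PosSemidef ∧ N.PosSemidef ∧ M = P - N ∧
      traceNorm M = P.trace.re + N.trace.re := by
  obtain ⟨V, d, h1, h2, hd⟩ := exists_diagonalization hM
  have hp : ∀ f : Sys n → ℝ, (∀ i, 0 ≤ f i) →
      (V * Matrix.diagonal (fun i => (f i : ℂ)) * Vᴴ).PosSemidef := fun f hf =>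
    (Matrix.PosSemidef.diagonal (d := fun i => (f i : ℂ))
      (fun i => by simpa using hf i)).mul_mul_conjTranspose_same V
  have ht : ∀ f : Sys n → ℝ,
      (V * Matrix.diagonal (fun i => (f i : ℂ)) * Vᴴ).trace.re = ∑ i, f i := fun f => by
    rw [Matrix.trace_mul_cycle, h1, Matrix.one_mul, Matrix.trace_diagonal]
    simp
  refine ⟨V * Matrix.diagonal (fun i => ((max (d i) 0 : ℝ) : ℂ)) * Vᴴ,
    V * Matrix.diagonal (fun i => ((max (-d i) 0 : ℝ) : ℂ)) * Vᴴ,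
    hp _ fun i => le_max_right _ _, hp _ fun i => le_max_right _ _, ?_, ?_⟩
  · rw [← Matrix.sub_mul, ← Matrix.mul_sub, Matrix.diagonal_sub, hd]
    congr 3
    funext i
    rw [← Complex.ofReal_sub, max_zero_sub_max_neg_zero_eq_self]
  · rw [ht, ht, traceNorm_of_diagonalization h1 hd, ← Finset.sum_add_distrib]
    refine Finset.sum_congr rfl fun i _ => ?_
    rcases le_total 0 (d i) with h | h
    · rw [abs_of_nonneg h, max_eq_left h, max_eq_right (by linarith), add_zero]
    · rw [abs_of_nonpos h, max_eq_right h, max_eq_left (by linarith), zero_add]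

lemma traceNorm_nonneg {n : ℕ} (M : Op n) : 0 ≤ traceNorm M :=
  Finset.sum_nonneg fun _ _ => Real.sqrt_nonneg _

lemma traceNorm_of_posSemidef {n : ℕ} {P : Op n} (hP : P.PosSemidef) :
    traceNorm P = P.trace.re := by
  obtain ⟨V, d, h1, h2, hd⟩ := exists_diagonalization hP.1
  have hdi : Vᴴ * P * V = Matrix.diagonal (fun i => (d i : ℂ)) := by
    rw [hd]
    calc Vᴴ * (V * Matrix.diagonal (fun i => (d i : ℂ)) * Vᴴ) * V
        = (Vᴴ * V) * Matrix.diagonal (fun i => (d i : ℂ)) * (Vᴴ * V) := by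
          simp only [Matrix.mul_assoc]
      _ = _ := by rw [h1, Matrix.one_mul, Matrix.mul_one]
  rw [traceNorm_of_diagonalization h1 hd, ← trace_unitary_conj h2 P, hdi, Matrix.trace_diagonal]
  rw [Complex.re_sum]
  refine Finset.sum_congr rfl fun i _ => ?_
  have := (hP.conjTranspose_mul_mul_same V).diag_nonneg (i := i)
  rw [hdi, Matrix.diagonal_apply_eq] at this
  rw [abs_of_nonneg (by simpa using this), Complex.ofReal_re]

lemma traceNorm_add_le {n : ℕ} {M N : Op n} (hM : M.IsHermitian) (hN : N.IsHermitian) :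
    traceNorm (M + N) ≤ traceNorm M + traceNorm N := by
  obtain ⟨P, P', hP, hP', rfl, h1⟩ := exists_posPart_negPart hM
  obtain ⟨Q, Q', hQ, hQ', rfl, h2⟩ := exists_posPart_negPart hN
  have e : P - P' + (Q - Q') = (P + Q) - (P' + Q') := by abel
  rw [h1, h2, e]
  refine (traceNorm_sub_le (hP.add hQ) (hP'.add hQ')).trans (le_of_eq ?_)
  simp only [Matrix.trace_add, Complex.add_re]
  ring

lemma traceNorm_smul {n : ℕ} (c : ℝ) {M : Op n} (hM : M.IsHermitian) :
    traceNorm (c • M) = |c| * traceNorm M := by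
  obtain ⟨V, d, h1, h2, hd⟩ := exists_diagonalization hM
  have hd' : c • M = V * Matrix.diagonal (fun i => ((c * d i : ℝ) : ℂ)) * Vᴴ := by
    have : Matrix.diagonal (fun i => ((c * d i : ℝ) : ℂ)) =
        c • Matrix.diagonal (fun i => (d i : ℂ)) := by
      rw [← Matrix.diagonal_smul]
      congr 1
      funext i
      simp
    rw [this, hd]
    simp
  rw [traceNorm_of_diagonalization h1 hd, traceNorm_of_diagonalization h1 hd', Finset.mul_sum]
  simp only [abs_mul]

lemma eq_zero_of_traceNorm_eq_zero {n : ℕ} {M : Op n} (hM : M.IsHermitian)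
    (h : traceNorm M = 0) : M = 0 := by
  obtain ⟨V, d, h1, h2, hd⟩ := exists_diagonalization hM
  rw [traceNorm_of_diagonalization h1 hd,
    Finset.sum_eq_zero_iff_of_nonneg fun i _ => abs_nonneg _] at h
  have : (fun i => (d i : ℂ)) = 0 := by
    funext i
    simpa using h i (Finset.mem_univ i)
  rw [hd, this]
  simp

/-- Hermitian operators, as a real vector space that carries the trace norm. A separate type is
used because matrices come with the topology of their entries. -/
def HermOp (n : ℕ) : Type := selfAdjoint.submodule ℝ (Op n)

namespace HermOp

instance (n : ℕ) : AddCommGroup (HermOp n) :=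
  inferInstanceAs (AddCommGroup (selfAdjoint.submodule ℝ (Op n)))

instance (n : ℕ) : Module ℝ (HermOp n) :=
  inferInstanceAs (Module ℝ (selfAdjoint.submodule ℝ (Op n)))

instance (n : ℕ) : FiniteDimensional ℝ (HermOp n) :=
  inferInstanceAs (FiniteDimensional ℝ (selfAdjoint.submodule ℝ (Op n)))

/-- The inclusion of the Hermitian operators into all operators. -/
def incl (n : ℕ) : HermOp n →ₗ[ℝ] Op n := (selfAdjoint.submodule ℝ (Op n)).subtype

lemma incl_injective (n : ℕ) : Function.Injective (incl n) := Subtype.val_injective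

lemma incl_isHermitian {n : ℕ} (M : HermOp n) : (incl n M).IsHermitian :=
  (selfAdjoint.mem_iff.1 M.2 : star M.1 = M.1)

/-- A Hermitian matrix as an element of `HermOp`. -/
def ofHerm {n : ℕ} (M : Op n) (hM : M.IsHermitian) : HermOp n :=
  (⟨M, selfAdjoint.mem_iff.2 hM⟩ : selfAdjoint.submodule ℝ (Op n))

@[simp] lemma incl_ofHerm {n : ℕ} (M : Op n) (hM : M.IsHermitian) : incl n (ofHerm M hM) = M := rfl

instance (n : ℕ) : Norm (HermOp n) := ⟨fun M => traceNorm (incl n M)⟩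

lemma norm_def {n : ℕ} (M : HermOp n) : ‖M‖ = traceNorm (incl n M) := rfl

lemma normCore (n : ℕ) : NormedSpace.Core ℝ (HermOp n) where
  norm_nonneg M := traceNorm_nonneg _
  norm_smul c M := by
    rw [norm_def, map_smul, traceNorm_smul c (incl_isHermitian M)]
    rfl
  norm_triangle M N := by
    rw [norm_def, map_add]
    exact traceNorm_add_le (incl_isHermitian M) (incl_isHermitian N)
  norm_eq_zero_iff M := by
    constructor
    · intro h
      apply incl_injective
      rw [map_zero]
      exact eq_zero_of_traceNorm_eq_zero (incl_isHermitian M) h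
    · rintro rfl
      rw [norm_def, map_zero, traceNorm_of_posSemidef Matrix.PosSemidef.zero]
      simp

instance (n : ℕ) : NormedAddCommGroup (HermOp n) := NormedAddCommGroup.ofCore (normCore n)

instance (n : ℕ) : NormedSpace ℝ (HermOp n) := NormedSpace.ofCore (normCore n)

instance (n : ℕ) : CompleteSpace (HermOp n) := FiniteDimensional.complete ℝ (HermOp n)

lemma continuous_incl (n : ℕ) : Continuous (incl n) :=
  LinearMap.continuous_of_finiteDimensional (incl n)

/-- A superoperator that preserves Hermiticity, as a bounded operator on `HermOp`. -/
def lift {n : ℕ} (F : Op n →ₗ[ℂ] Op n) (hF : ∀ M : Op n, M.IsHermitian → (F M).IsHermitian) :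
    HermOp n →L[ℝ] HermOp n :=
  LinearMap.toContinuousLinearMap
    { toFun := fun M => ofHerm (F (incl n M)) (hF _ (incl_isHermitian M))
      map_add' := fun M N => by
        apply incl_injective
        simp
      map_smul' := fun c M => by
        apply incl_injective
        simp [LinearMap.map_smul_of_tower] }

@[simp] lemma incl_lift {n : ℕ} (F : Op n →ₗ[ℂ] Op n)
    (hF : ∀ M : Op n, M.IsHermitian → (F M).IsHermitian) (M : HermOp n) :
    incl n (lift F hF M) = F (incl n M) := rfl

end HermOp

/-! ### Exponentials and powers in a Banach algebra -/

lemma norm_pow_sub_pow_le {𝔸 : Type*} [NormedRing 𝔸] {a b : 𝔸} {c : ℝ} {K : ℕ}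
    (ha : ‖a‖ ≤ 1) (hb : ∀ j < K, ‖b ^ j‖ ≤ c) : ‖a ^ K - b ^ K‖ ≤ K * (c * ‖a - b‖) := by
  induction K with
  | zero => simp
  | succ K ih =>
    have e : a ^ (K + 1) - b ^ (K + 1) = a * (a ^ K - b ^ K) + (a - b) * b ^ K := by
      rw [pow_succ', pow_succ']
      noncomm_ring
    rw [e]
    have h1 : ‖a * (a ^ K - b ^ K)‖ ≤ K * (c * ‖a - b‖) := by
      refine (norm_mul_le _ _).trans ?_
      have := ih fun j hj => hb j (by omega)
      calc ‖a‖ * ‖a ^ K - b ^ K‖ ≤ 1 * ‖a ^ K - b ^ K‖ := by gcongr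
        _ ≤ _ := by rw [one_mul]; exact this
    have h2 : ‖(a - b) * b ^ K‖ ≤ c * ‖a - b‖ := by
      refine (norm_mul_le _ _).trans ?_
      rw [mul_comm c]
      gcongr
      exact hb K (by omega)
    refine (norm_add_le _ _).trans ?_
    push_cast
    linarith

lemma norm_exp_sub_one_sub_self_le {𝔸 : Type*} [NormedRing 𝔸] [NormOneClass 𝔸] [NormedAlgebra ℝ 𝔸]
    [CompleteSpace 𝔸] (x : 𝔸) {s : ℝ} (hs0 : 0 ≤ s) (hs1 : s ≤ 1) (hx : ‖x‖ ≤ 4 * s) :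
    ‖NormedSpace.exp x - 1 - x‖ ≤ s ^ 2 * (Real.exp 4 - 5) := by
  have h1 := NormedSpace.exp_series_hasSum_exp' (𝕂 := ℝ) x
  have h2 := (hasSum_nat_add_iff' 2).2 h1
  have h3 : HasSum (fun k : ℕ => ((k.factorial : ℝ)⁻¹ • (4 : ℝ) ^ k)) (Real.exp 4) := by
    rw [Real.exp_eq_exp_ℝ]
    exact NormedSpace.exp_series_hasSum_exp' (𝕂 := ℝ) (4 : ℝ)
  have h4 := ((hasSum_nat_add_iff' 2).2 h3).mul_left (s ^ 2)
  have e2 : NormedSpace.exp x - 1 - x =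
      NormedSpace.exp x - ∑ i ∈ Finset.range 2, ((i.factorial : ℝ)⁻¹ • x ^ i) := by
    simp [Finset.sum_range_succ, sub_sub]
  have e4 : s ^ 2 * (Real.exp 4 - 5) =
      s ^ 2 * (Real.exp 4 - ∑ i ∈ Finset.range 2, ((i.factorial : ℝ)⁻¹ • (4 : ℝ) ^ i)) := by
    simp only [Finset.sum_range_succ, Finset.sum_range_zero]
    norm_num
  rw [e2, e4, ← h2.tsum_eq]
  refine tsum_of_norm_bounded h4 fun k => ?_
  rw [norm_smul, Real.norm_of_nonneg (by positivity), smul_eq_mul]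
  have hk : ‖x ^ (k + 2)‖ ≤ s ^ 2 * 4 ^ (k + 2) := by
    calc ‖x ^ (k + 2)‖ ≤ ‖x‖ ^ (k + 2) := norm_pow_le _ _
      _ ≤ (4 * s) ^ (k + 2) := by gcongr
      _ = s ^ k * (s ^ 2 * 4 ^ (k + 2)) := by ring
      _ ≤ 1 * (s ^ 2 * 4 ^ (k + 2)) := by
        gcongr
        exact pow_le_one₀ hs0 hs1
      _ = _ := one_mul _
  calc _ ≤ ((k + 2).factorial : ℝ)⁻¹ * (s ^ 2 * 4 ^ (k + 2)) := by gcongr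
    _ = _ := by ring

lemma norm_exp_le {𝔸 : Type*} [NormedRing 𝔸] [NormOneClass 𝔸] [NormedAlgebra ℝ 𝔸]
    [CompleteSpace 𝔸] (x : 𝔸) : ‖NormedSpace.exp x‖ ≤ Real.exp ‖x‖ := by
  have h1 := NormedSpace.exp_series_hasSum_exp' (𝕂 := ℝ) x
  have h3 : HasSum (fun k : ℕ => ((k.factorial : ℝ)⁻¹ • ‖x‖ ^ k)) (Real.exp ‖x‖) := by
    rw [Real.exp_eq_exp_ℝ]
    exact NormedSpace.exp_series_hasSum_exp' (𝕂 := ℝ) ‖x‖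
  rw [← h1.tsum_eq]
  refine tsum_of_norm_bounded h3 fun k => ?_
  rw [norm_smul, Real.norm_of_nonneg (by positivity), smul_eq_mul]
  gcongr
  exact norm_pow_le _ _

/-! ### Completely positive maps and Lindblad generators -/

/-- The map `ρ ↦ ∑ₖ Aₖ ρ Aₖ†`. -/
def cpMap {n : ℕ} {ι : Type*} [Fintype ι] (A : ι → Op n) : Op n →ₗ[ℂ] Op n where
  toFun ρ := ∑ k, A k * ρ * (A k)ᴴ
  map_add' ρ σ := by
    simp only [Matrix.mul_add, Matrix.add_mul, Finset.sum_add_distrib]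
  map_smul' c ρ := by
    simp only [Matrix.mul_smul, Matrix.smul_mul, Finset.smul_sum, RingHom.id_apply]

/-- The operator `∑ₖ Aₖ† Aₖ`. -/
def krausGram {n : ℕ} {ι : Type*} [Fintype ι] (A : ι → Op n) : Op n := ∑ k, (A k)ᴴ * A k

/-- The generator `ρ ↦ 2 ∑ₖ Aₖ ρ Aₖ† - (X ρ + ρ X)` with `X = ∑ₖ Aₖ† Aₖ`. -/
def lindblad {n : ℕ} {ι : Type*} [Fintype ι] (A : ι → Op n) : Op n →ₗ[ℂ] Op n :=
  (2 : ℂ) • cpMap A - (LinearMap.mulLeft ℂ (krausGram A) + LinearMap.mulRight ℂ (krausGram A))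

section Superoperators

variable {n : ℕ} {ι : Type*} [Fintype ι]

lemma cpMap_apply (A : ι → Op n) (ρ : Op n) : cpMap A ρ = ∑ k, A k * ρ * (A k)ᴴ := rfl

lemma lindblad_apply (A : ι → Op n) (ρ : Op n) :
    lindblad A ρ = (2 : ℂ) • cpMap A ρ - (krausGram A * ρ + ρ * krausGram A) := rfl

lemma krausGram_posSemidef (A : ι → Op n) : (krausGram A).PosSemidef :=
  Matrix.posSemidef_sum _ fun k _ => Matrix.posSemidef_conjTranspose_mul_self (A k)

lemma cpMap_posSemidef (A : ι → Op n) {ρ : Op n} (h : ρ.PosSemidef) : (cpMap A ρ).PosSemidef :=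
  Matrix.posSemidef_sum _ fun k _ => h.mul_mul_conjTranspose_same (A k)

lemma cpMap_isHermitian (A : ι → Op n) {ρ : Op n} (h : ρ.IsHermitian) :
    (cpMap A ρ).IsHermitian := by
  rw [Matrix.IsHermitian, cpMap_apply, Matrix.conjTranspose_sum]
  refine Finset.sum_congr rfl fun k _ => ?_
  rw [Matrix.conjTranspose_mul, Matrix.conjTranspose_mul, Matrix.conjTranspose_conjTranspose, h.eq,
    Matrix.mul_assoc]

lemma lindblad_isHermitian (A : ι → Op n) {ρ : Op n} (h : ρ.IsHermitian) :
    (lindblad A ρ).IsHermitian := by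
  have h1 : ((2 : ℂ) • cpMap A ρ).IsHermitian := by
    rw [Matrix.IsHermitian, Matrix.conjTranspose_smul, (cpMap_isHermitian A h).eq]
    simp
  have h2 : (krausGram A * ρ + ρ * krausGram A).IsHermitian := by
    rw [Matrix.IsHermitian, Matrix.conjTranspose_add, Matrix.conjTranspose_mul,
      Matrix.conjTranspose_mul, h.eq, (krausGram_posSemidef A).1.eq, add_comm]
  exact h1.sub h2

lemma trace_cpMap (A : ι → Op n) (ρ : Op n) : (cpMap A ρ).trace = (krausGram A * ρ).trace := by
  rw [cpMap_apply, krausGram, Matrix.sum_mul, Matrix.trace_sum, Matrix.trace_sum]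
  refine Finset.sum_congr rfl fun k _ => ?_
  rw [Matrix.trace_mul_cycle]

lemma trace_lindblad (A : ι → Op n) (ρ : Op n) : (lindblad A ρ).trace = 0 := by
  rw [lindblad_apply, Matrix.trace_sub, Matrix.trace_add, Matrix.trace_smul, trace_cpMap,
    Matrix.trace_mul_comm ρ]
  rw [smul_eq_mul]
  ring

lemma exists_eq_conjTranspose_mul_self {P : Op n} (hP : P.PosSemidef) :
    ∃ B : Op n, P = Bᴴ * B := by
  obtain ⟨V, d, h1, h2, hd⟩ := exists_diagonalization hP.1
  have hdi : Vᴴ * P * V = Matrix.diagonal (fun i => (d i : ℂ)) := by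
    rw [hd]
    calc Vᴴ * (V * Matrix.diagonal (fun i => (d i : ℂ)) * Vᴴ) * V
        = (Vᴴ * V) * Matrix.diagonal (fun i => (d i : ℂ)) * (Vᴴ * V) := by
          simp only [Matrix.mul_assoc]
      _ = _ := by rw [h1, Matrix.one_mul, Matrix.mul_one]
  have hpos : ∀ i, 0 ≤ d i := fun i => by
    have := (hP.conjTranspose_mul_mul_same V).diag_nonneg (i := i)
    rw [hdi, Matrix.diagonal_apply_eq] at this
    simpa using this
  refine ⟨Matrix.diagonal (fun i => ((Real.sqrt (d i) : ℝ) : ℂ)) * Vᴴ, ?_⟩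
  rw [Matrix.conjTranspose_mul, Matrix.conjTranspose_conjTranspose, Matrix.diagonal_conjTranspose,
    Matrix.mul_assoc, ← Matrix.mul_assoc (Matrix.diagonal _), Matrix.diagonal_mul_diagonal, hd,
    Matrix.mul_assoc]
  congr 3
  funext i
  rw [Pi.star_apply, Complex.star_def, Complex.conj_ofReal, ← Complex.ofReal_mul,
    Real.mul_self_sqrt (hpos i)]

lemma trace_mul_nonneg {P Q : Op n} (hP : P.PosSemidef) (hQ : Q.PosSemidef) :
    0 ≤ (P * Q).trace.re := by
  obtain ⟨B, rfl⟩ := exists_eq_conjTranspose_mul_self hP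
  rw [← Matrix.trace_mul_cycle]
  exact (Complex.le_def.1 (hQ.mul_mul_conjTranspose_same B).trace_nonneg).1

lemma trace_mul_le {P Q : Op n} (hP : (1 - P).PosSemidef) (hQ : Q.PosSemidef) :
    (P * Q).trace.re ≤ Q.trace.re := by
  have := trace_mul_nonneg hP hQ
  rw [Matrix.sub_mul, Matrix.one_mul, Matrix.trace_sub, Complex.sub_re] at this
  linarith

/-- A superoperator is bounded by its values on positive operators. -/
lemma opNorm_le_of_posSemidef {T : HermOp n →L[ℝ] HermOp n} {c : ℝ} (hc : 0 ≤ c)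
    (h : ∀ P : HermOp n, (HermOp.incl n P).PosSemidef → ‖T P‖ ≤ c * (HermOp.incl n P).trace.re) :
    ‖T‖ ≤ c := by
  refine ContinuousLinearMap.opNorm_le_bound _ hc fun M => ?_
  obtain ⟨P, N, hP, hN, hM, hn⟩ := exists_posPart_negPart (HermOp.incl_isHermitian M)
  have hM' : M = HermOp.ofHerm P hP.1 - HermOp.ofHerm N hN.1 := by
    apply HermOp.incl_injective
    rw [map_sub, HermOp.incl_ofHerm, HermOp.incl_ofHerm, hM]
  rw [HermOp.norm_def M, hn, hM', map_sub, mul_add]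
  exact (norm_sub_le _ _).trans (add_le_add (h _ hP) (h _ hN))

lemma norm_lift_le {F : Op n →ₗ[ℂ] Op n} {hF : ∀ M : Op n, M.IsHermitian → (F M).IsHermitian}
    {c : ℝ} (hc : 0 ≤ c) (h : ∀ P : Op n, P.PosSemidef → traceNorm (F P) ≤ c * P.trace.re) :
    ‖HermOp.lift F hF‖ ≤ c :=
  opNorm_le_of_posSemidef hc fun _ hP => h _ hP

lemma norm_lift_cpMap_le {A : ι → Op n} (hA : (1 - krausGram A).PosSemidef) :
    ‖HermOp.lift (cpMap A) fun _ => cpMap_isHermitian A‖ ≤ 1 := by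
  refine norm_lift_le zero_le_one fun P hP => ?_
  rw [traceNorm_of_posSemidef (cpMap_posSemidef A hP), trace_cpMap, one_mul]
  exact trace_mul_le hA hP

lemma norm_lift_lindblad_le {A : ι → Op n} (hA : (1 - krausGram A).PosSemidef) :
    ‖HermOp.lift (lindblad A) fun _ => lindblad_isHermitian A‖ ≤ 4 := by
  refine norm_lift_le (by norm_num) fun P hP => ?_
  have hX := krausGram_posSemidef A
  set X := krausGram A with hXdef
  have hXh : Xᴴ = X := hX.1.eq
  -- polarization writes `X P + P X` as a difference of positive operators
  have e : lindblad A P = (cpMap A P + cpMap A P + (1 / 2 : ℝ) • ((1 - X) * P * (1 - X)ᴴ)) -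
      (1 / 2 : ℝ) • ((1 + X) * P * (1 + X)ᴴ) := by
    rw [lindblad_apply, ← hXdef, two_smul, Matrix.conjTranspose_sub, Matrix.conjTranspose_add, hXh,
      Matrix.conjTranspose_one]
    have : X * P + P * X = (1 / 2 : ℝ) • ((1 + X) * P * (1 + X)) -
        (1 / 2 : ℝ) • ((1 - X) * P * (1 - X)) := by
      rw [← smul_sub]
      have : (1 + X) * P * (1 + X) - (1 - X) * P * (1 - X) = (2 : ℝ) • (X * P + P * X) := by
        rw [two_smul]
        noncomm_ring
      rw [this, smul_smul]
      norm_num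
    rw [this]
    abel
  have hhalf : (0 : ℝ) ≤ 1 / 2 := by norm_num
  have p1 := hP.mul_mul_conjTranspose_same (1 - X)
  have p2 := hP.mul_mul_conjTranspose_same (1 + X)
  have hc := cpMap_posSemidef A hP
  rw [e]
  refine (traceNorm_sub_le ((hc.add hc).add (p1.smul hhalf)) (p2.smul hhalf)).trans ?_
  have t1 : (cpMap A P).trace.re ≤ P.trace.re := by
    rw [trace_cpMap]
    exact trace_mul_le hA hP
  have hXX : (1 - X * X).PosSemidef := by
    have : 1 - X * X = (1 - X) + (Xᴴ * (1 - X) * X + (1 - X)ᴴ * X * (1 - X)) := by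
      rw [Matrix.conjTranspose_sub, hXh, Matrix.conjTranspose_one]
      noncomm_ring
    rw [this]
    exact hA.add ((hA.conjTranspose_mul_mul_same X).add (hX.conjTranspose_mul_mul_same (1 - X)))
  have t2 := trace_mul_le hXX hP
  have t3 : ((1 - X) * P * (1 - X)ᴴ).trace + ((1 + X) * P * (1 + X)ᴴ).trace =
      2 * (P.trace + (X * X * P).trace) := by
    rw [Matrix.trace_mul_cycle, Matrix.trace_mul_cycle (1 + X), Matrix.conjTranspose_sub,
      Matrix.conjTranspose_add, hXh, Matrix.conjTranspose_one, two_mul, ← Matrix.trace_add,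
      ← Matrix.trace_add, ← Matrix.trace_add]
    congr 1
    noncomm_ring
  have t3' := congrArg Complex.re t3
  simp only [Complex.add_re, Complex.mul_re, Complex.re_ofNat, Complex.im_ofNat, zero_mul,
    sub_zero] at t3'
  simp only [Matrix.trace_add, Matrix.trace_smul, Complex.add_re, Complex.smul_re, smul_eq_mul]
  linarith

end Superoperators

/-! ### The semigroup of a Lindblad generator and its short-time approximation -/

namespace HermOp

instance (n : ℕ) : Nontrivial (HermOp n) := by
  refine ⟨ofHerm 1 Matrix.isHermitian_one, 0, fun h => ?_⟩
  have := congrArg (incl n) h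
  rw [incl_ofHerm, map_zero] at this
  exact one_ne_zero this

lemma isClosed_posSemidef (n : ℕ) : IsClosed {M : HermOp n | (incl n M).PosSemidef} := by
  have : {M : HermOp n | (incl n M).PosSemidef} =
      ⋂ x : Sys n → ℂ, {M : HermOp n | 0 ≤ (star x ⬝ᵥ (incl n M *ᵥ x)).re} := by
    ext M
    simp only [Set.mem_ofPred_eq, Set.mem_iInter]
    constructor
    · intro h x
      exact (Complex.le_def.1 (h.dotProduct_mulVec_nonneg x)).1
    · intro h
      refine Matrix.PosSemidef.of_dotProduct_mulVec_nonneg (incl_isHermitian M) fun x => ?_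
      refine Complex.le_def.2 ⟨h x, ?_⟩
      exact ((incl_isHermitian M).im_star_dotProduct_mulVec_self x).symm
  rw [this]
  refine isClosed_iInter fun x => isClosed_le continuous_const ?_
  refine Complex.continuous_re.comp ?_
  exact continuous_const.dotProduct ((continuous_incl n).matrix_mulVec continuous_const)

lemma continuous_trace (n : ℕ) : Continuous fun M : HermOp n => (incl n M).trace.re :=
  Complex.continuous_re.comp (continuous_incl n).matrix_trace

lemma norm_of_posSemidef {n : ℕ} {P : HermOp n} (hP : (incl n P).PosSemidef) :
    ‖P‖ = (incl n P).trace.re := traceNorm_of_posSemidef hP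

lemma trace_im {n : ℕ} (M : HermOp n) : (incl n M).trace.im = 0 := by
  have h := Matrix.trace_conjTranspose (incl n M)
  rw [(incl_isHermitian M).eq] at h
  have := congrArg Complex.im h
  rw [Complex.star_def, Complex.conj_im] at this
  linarith

end HermOp

open HermOp

lemma eventually_sqrt_div_le {t : ℝ} (ht : 0 < t) : ∀ᶠ K : ℕ in Filter.atTop,
    0 < Real.sqrt (t / K) ∧ Real.sqrt (t / K) ≤ 1 := by
  filter_upwards [Filter.eventually_ge_atTop (⌈t⌉₊ + 1)] with K hK
  have hKt : t ≤ K := (Nat.le_ceil t).trans (by exact_mod_cast (by omega : ⌈t⌉₊ ≤ K))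
  have hK0 : (0 : ℝ) < K := ht.trans_le hKt
  exact ⟨Real.sqrt_pos.2 (by positivity), Real.sqrt_le_one.2 ((div_le_one hK0).2 hKt)⟩

section Semigroup

variable {n : ℕ} {ι : Type*} [Fintype ι] (A : ι → Op n)

/-- The Lindblad generator as a bounded operator on the Hermitian operators. -/
def genH : HermOp n →L[ℝ] HermOp n := lift (lindblad A) fun _ => lindblad_isHermitian A

/-- The semigroup `e^{t𝓛}` on the Hermitian operators. -/
def flow (t : ℝ) : HermOp n →L[ℝ] HermOp n := NormedSpace.exp (t • genH A)

lemma incl_genH_pow (k : ℕ) (M : HermOp n) :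
    incl n ((genH A ^ k) M) = (lindblad A)^[k] (incl n M) := by
  induction k generalizing M with
  | zero => rfl
  | succ k ih =>
    rw [pow_succ, Function.iterate_succ_apply]
    exact ih _

lemma expFlow_eq_flow (t : ℝ) (M : HermOp n) :
    expFlow (lindblad A) t (incl n M) = incl n (flow A t M) := by
  have h1 := NormedSpace.exp_series_hasSum_exp' (𝕂 := ℝ) (t • genH A)
  have h2 := (ContinuousLinearMap.apply ℝ (HermOp n) M).hasSum h1
  have h3 := (LinearMap.toContinuousLinearMap (incl n)).hasSum h2
  refine Eq.trans (tsum_congr fun k => ?_) h3.tsum_eq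
  simp only [ContinuousLinearMap.apply_apply]
  rw [smul_pow, smul_smul, smul_apply]
  rw [LinearMap.coe_toContinuousLinearMap', map_smul, incl_genH_pow]
  ext i j
  simp only [Matrix.smul_apply, smul_eq_mul, Complex.real_smul]
  push_cast
  ring

lemma flow_add (s t : ℝ) : flow A (s + t) = flow A s * flow A t := by
  let _ : NormedAlgebra ℚ (HermOp n →L[ℝ] HermOp n) := NormedAlgebra.restrictScalars ℚ ℝ _
  rw [flow, flow, flow, add_smul]
  exact NormedSpace.exp_add_of_commute (((Commute.refl _).smul_left s).smul_right t)

lemma flow_zero : flow A 0 = 1 := by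
  rw [flow, zero_smul, NormedSpace.exp_zero]

lemma flow_nat_mul (K : ℕ) (s : ℝ) : flow A (K * s) = flow A s ^ K := by
  let _ : NormedAlgebra ℚ (HermOp n →L[ℝ] HermOp n) := NormedAlgebra.restrictScalars ℚ ℝ _
  rw [flow, flow, ← NormedSpace.exp_nsmul, mul_smul, Nat.cast_smul_eq_nsmul]

lemma hasDerivAt_flow (t : ℝ) (M : HermOp n) :
    HasDerivAt (fun s => flow A s M) (flow A t (genH A M)) t := by
  have h := hasDerivAt_exp_smul_const (𝕂 := ℝ) (genH A) t
  exact (ContinuousLinearMap.apply ℝ (HermOp n) M).hasFDerivAt.comp_hasDerivAt t h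

lemma hasDerivAt_flow' (t : ℝ) (M : HermOp n) :
    HasDerivAt (fun s => flow A s M) (genH A (flow A t M)) t := by
  have h := hasDerivAt_exp_smul_const' (𝕂 := ℝ) (genH A) t
  exact (ContinuousLinearMap.apply ℝ (HermOp n) M).hasFDerivAt.comp_hasDerivAt t h

variable {A}

lemma norm_genH_le (hA : (1 - krausGram A).PosSemidef) : ‖genH A‖ ≤ 4 := norm_lift_lindblad_le hA

lemma norm_flow_sub_le (hA : (1 - krausGram A).PosSemidef) {s : ℝ} (h0 : 0 ≤ s) (h1 : s ≤ 1) :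
    ‖flow A s - 1 - s • genH A‖ ≤ s ^ 2 * (Real.exp 4 - 5) := by
  refine norm_exp_sub_one_sub_self_le _ h0 h1 ?_
  rw [norm_smul, Real.norm_of_nonneg h0, mul_comm]
  gcongr
  exact norm_genH_le hA

lemma norm_flow_le_exp (hA : (1 - krausGram A).PosSemidef) {t : ℝ} (ht : 0 ≤ t) :
    ‖flow A t‖ ≤ Real.exp (4 * t) := by
  refine (norm_exp_le _).trans (Real.exp_le_exp.2 ?_)
  rw [norm_smul, Real.norm_of_nonneg ht, mul_comm]
  gcongr
  exact norm_genH_le hA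

/-- A family of superoperators on the Hermitian operators that preserve positivity and the trace
and agree with `1 + τ²𝓛` up to `2τ⁴`. -/
structure IsWeakStep (A : ι → Op n) (S : ℝ → HermOp n →L[ℝ] HermOp n) : Prop where
  gram_le : (1 - krausGram A).PosSemidef
  pos : ∀ τ, 0 < τ → τ ≤ 1 → ∀ P, (incl n P).PosSemidef → (incl n (S τ P)).PosSemidef
  trace : ∀ τ, 0 < τ → τ ≤ 1 → ∀ P, (incl n (S τ P)).trace.re = (incl n P).trace.re
  approx : ∀ τ, 0 < τ → τ ≤ 1 → ‖S τ - 1 - τ ^ 2 • genH A‖ ≤ 2 * τ ^ 4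

namespace IsWeakStep

variable {S : ℝ → HermOp n →L[ℝ] HermOp n} (h : IsWeakStep A S)

include h

lemma norm_le_one {τ : ℝ} (h0 : 0 < τ) (h1 : τ ≤ 1) : ‖S τ‖ ≤ 1 :=
  opNorm_le_of_posSemidef zero_le_one fun P hP => by
    rw [norm_of_posSemidef (h.pos τ h0 h1 P hP), h.trace τ h0 h1, one_mul]

lemma norm_sub_flow_le {τ : ℝ} (h0 : 0 < τ) (h1 : τ ≤ 1) :
    ‖S τ - flow A (τ ^ 2)‖ ≤ 2 * Real.exp 4 * τ ^ 4 := by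
  have e : S τ - flow A (τ ^ 2) =
      (S τ - 1 - τ ^ 2 • genH A) - (flow A (τ ^ 2) - 1 - τ ^ 2 • genH A) := by abel
  rw [e]
  refine (norm_sub_le _ _).trans ?_
  have a1 := h.approx τ h0 h1
  have a2 := norm_flow_sub_le h.gram_le (s := τ ^ 2) (by positivity)
    (pow_le_one₀ h0.le h1)
  have hp : 0 < τ ^ 4 := by positivity
  have he : 0 < Real.exp 4 := Real.exp_pos 4
  nlinarith

lemma pow_posSemidef {τ : ℝ} (h0 : 0 < τ) (h1 : τ ≤ 1) (K : ℕ) {P : HermOp n}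
    (hP : (incl n P).PosSemidef) : (incl n ((S τ ^ K) P)).PosSemidef := by
  induction K generalizing P with
  | zero => exact hP
  | succ K ih =>
    rw [pow_succ]
    exact ih (h.pos τ h0 h1 P hP)

lemma pow_trace {τ : ℝ} (h0 : 0 < τ) (h1 : τ ≤ 1) (K : ℕ) (P : HermOp n) :
    (incl n ((S τ ^ K) P)).trace.re = (incl n P).trace.re := by
  induction K generalizing P with
  | zero => rfl
  | succ K ih =>
    rw [pow_succ]
    exact (ih _).trans (h.trace τ h0 h1 P)

open Filter Topology in
/-- The semigroup is the limit of powers of short steps. -/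
lemma tendsto_pow {t : ℝ} (ht : 0 < t) :
    Tendsto (fun K : ℕ => S (Real.sqrt (t / K)) ^ K) atTop (𝓝 (flow A t)) := by
  rw [tendsto_iff_norm_sub_tendsto_zero]
  have hlim : Tendsto (fun K : ℕ => (Real.exp (4 * t) * (2 * Real.exp 4 * t ^ 2)) / (K : ℝ))
      atTop (𝓝 0) := tendsto_const_div_atTop_nhds_zero_nat _
  refine squeeze_zero' (Eventually.of_forall fun K => norm_nonneg _) ?_ hlim
  filter_upwards [eventually_ge_atTop (⌈t⌉₊ + 1)] with K hK
  have hKt : t ≤ K := (Nat.le_ceil t).trans (by exact_mod_cast (by omega : ⌈t⌉₊ ≤ K))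
  have hK0 : (0 : ℝ) < K := ht.trans_le hKt
  have hτ0 : 0 < Real.sqrt (t / K) := Real.sqrt_pos.2 (by positivity)
  have hτ1 : Real.sqrt (t / K) ≤ 1 := Real.sqrt_le_one.2 ((div_le_one hK0).2 hKt)
  have hsq : Real.sqrt (t / K) ^ 2 = t / K := Real.sq_sqrt (by positivity)
  have hb : ∀ j < K, ‖flow A (t / K) ^ j‖ ≤ Real.exp (4 * t) := fun j hj => by
    rw [← flow_nat_mul]
    refine (norm_flow_le_exp h.gram_le (by positivity)).trans (Real.exp_le_exp.2 ?_)
    have : (j : ℝ) ≤ K := by exact_mod_cast hj.le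
    have : (j : ℝ) * (t / K) ≤ K * (t / K) := by gcongr
    rw [mul_div_cancel₀ _ hK0.ne'] at this
    linarith
  have e : flow A t = flow A (t / K) ^ K := by
    rw [← flow_nat_mul, mul_div_cancel₀ _ hK0.ne']
  rw [e]
  refine (norm_pow_sub_pow_le (h.norm_le_one hτ0 hτ1) hb).trans ?_
  have h2 := h.norm_sub_flow_le hτ0 hτ1
  rw [hsq] at h2
  have h4 : Real.sqrt (t / K) ^ 4 = (t / K) ^ 2 := by
    rw [show (4 : ℕ) = 2 * 2 from rfl, pow_mul, hsq]
  rw [h4] at h2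
  calc (K : ℝ) * (Real.exp (4 * t) * ‖S (Real.sqrt (t / K)) - flow A (t / K)‖)
      ≤ K * (Real.exp (4 * t) * (2 * Real.exp 4 * (t / K) ^ 2)) := by gcongr
    _ = _ := by field_simp

lemma flow_posSemidef {t : ℝ} (ht : 0 ≤ t) {P : HermOp n} (hP : (incl n P).PosSemidef) :
    (incl n (flow A t P)).PosSemidef := by
  rcases ht.eq_or_lt with rfl | ht
  · rw [flow_zero]
    exact hP
  have h1 := ((ContinuousLinearMap.apply ℝ (HermOp n) P).continuous.tendsto _).comp
    (h.tendsto_pow ht)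
  refine (isClosed_posSemidef n).mem_of_tendsto h1 ?_
  filter_upwards [eventually_sqrt_div_le ht] with K hK
  exact h.pow_posSemidef hK.1 hK.2 K hP

lemma flow_trace {t : ℝ} (ht : 0 ≤ t) (M : HermOp n) :
    (incl n (flow A t M)).trace.re = (incl n M).trace.re := by
  rcases ht.eq_or_lt with rfl | ht
  · rw [flow_zero]
    rfl
  have h1 := ((continuous_trace n).tendsto _).comp
    (((ContinuousLinearMap.apply ℝ (HermOp n) M).continuous.tendsto _).comp (h.tendsto_pow ht))
  refine tendsto_nhds_unique h1 (tendsto_const_nhds.congr' ?_)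
  filter_upwards [eventually_sqrt_div_le ht] with K hK
  exact (h.pow_trace hK.1 hK.2 K M).symm

lemma norm_flow_le_one {t : ℝ} (ht : 0 ≤ t) : ‖flow A t‖ ≤ 1 :=
  opNorm_le_of_posSemidef zero_le_one fun P hP => by
    rw [norm_of_posSemidef (h.flow_posSemidef ht hP), h.flow_trace ht, one_mul]

lemma norm_flow_apply_le {t : ℝ} (ht : 0 ≤ t) (M : HermOp n) : ‖flow A t M‖ ≤ ‖M‖ := by
  simpa using (flow A t).le_of_opNorm_le (h.norm_flow_le_one ht) M

/-- The error of `K` steps of the algorithm. -/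
lemma norm_pow_sub_flow_le {τ : ℝ} (h0 : 0 < τ) (h1 : τ ≤ 1) (K : ℕ) :
    ‖S τ ^ K - flow A (K * τ ^ 2)‖ ≤ 2 * Real.exp 4 * K * τ ^ 4 := by
  rw [flow_nat_mul]
  refine (norm_pow_sub_pow_le (h.norm_le_one h0 h1) (c := 1) fun j _ => ?_).trans ?_
  · rw [← flow_nat_mul]
    exact h.norm_flow_le_one (by positivity)
  · have := h.norm_sub_flow_le h0 h1
    calc (K : ℝ) * (1 * ‖S τ - flow A (τ ^ 2)‖) ≤ K * (1 * (2 * Real.exp 4 * τ ^ 4)) := by gcongr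
      _ = _ := by ring

/-- The semigroup moves a state at a speed of at most the norm of the generator on it. -/
lemma norm_flow_sub_self_le {t : ℝ} (ht : 0 ≤ t) (M : HermOp n) :
    ‖flow A t M - M‖ ≤ ‖genH A M‖ * t := by
  have := norm_image_sub_le_of_norm_deriv_le_segment' (f := fun s => flow A s M)
    (f' := fun s => flow A s (genH A M)) (C := ‖genH A M‖) (a := 0) (b := t)
    (fun s _ => (hasDerivAt_flow A s M).hasDerivWithinAt)
    (fun s hs => h.norm_flow_apply_le hs.1 _) t (Set.right_mem_Icc.2 ht)
  simpa [flow_zero] using this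

end IsWeakStep

end Semigroup

open HermOp

/-! ### Irreducibility and mixing -/

/-- Matrices that map `ker ρ` into itself after taking adjoints form an algebra. -/
def kerStabilizer {n : ℕ} (ρ : Op n) : Subalgebra ℂ (Op n) where
  carrier := {B | ∀ v : Sys n → ℂ, ρ *ᵥ v = 0 → ρ *ᵥ (Bᴴ *ᵥ v) = 0}
  mul_mem' {B C} hB hC v hv := by
    rw [Matrix.conjTranspose_mul, ← Matrix.mulVec_mulVec]
    exact hC _ (hB v hv)
  add_mem' {B C} hB hC v hv := by
    rw [Matrix.conjTranspose_add, Matrix.add_mulVec, Matrix.mulVec_add, hB v hv, hC v hv, add_zero]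
  algebraMap_mem' c v hv := by
    rw [Algebra.algebraMap_eq_smul_one, Matrix.conjTranspose_smul, Matrix.conjTranspose_one,
      Matrix.smul_mulVec, Matrix.one_mulVec, Matrix.mulVec_smul, hv, smul_zero]

lemma eq_zero_of_kerStabilizer_eq_top {n : ℕ} {ρ : Op n} (h : kerStabilizer ρ = ⊤)
    {v : Sys n → ℂ} (hv : v ≠ 0) (h0 : ρ *ᵥ v = 0) : ρ = 0 := by
  obtain ⟨j, hj⟩ := Function.ne_iff.1 hv
  have hw : ∀ w : Sys n → ℂ, ρ *ᵥ w = 0 := fun w => by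
    have hB : (Matrix.vecMulVec w (Pi.single j ((v j)⁻¹)))ᴴ ∈ kerStabilizer ρ := by
      rw [h]
      exact Algebra.mem_top
    have := hB v h0
    rw [Matrix.conjTranspose_conjTranspose, Matrix.vecMulVec_mulVec, single_dotProduct,
      inv_mul_cancel₀ hj] at this
    simpa using this
  ext i k
  have := congrFun (hw (Pi.single k 1)) i
  simpa using this

section Mixing

variable {n : ℕ} {ι : Type*} [Fintype ι] {A : ι → Op n}

/-- If `ρ v = 0`, then only the gain term of the generator contributes to `⟨v, 𝓛(ρ) v⟩`. -/
lemma dotProduct_lindblad_mulVec {ρ : Op n} (hρ : ρ.IsHermitian) {v : Sys n → ℂ}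
    (hv : ρ *ᵥ v = 0) : star v ⬝ᵥ (lindblad A ρ *ᵥ v) =
      2 * ∑ k, star ((A k)ᴴ *ᵥ v) ⬝ᵥ (ρ *ᵥ ((A k)ᴴ *ᵥ v)) := by
  have hv' : star v ᵥ* ρ = 0 := by
    have := congrArg star hv
    rwa [Matrix.star_mulVec, hρ.eq, star_zero] at this
  rw [lindblad_apply, Matrix.sub_mulVec, Matrix.add_mulVec, ← Matrix.mulVec_mulVec, hv,
    Matrix.mulVec_zero, ← Matrix.mulVec_mulVec, zero_add, dotProduct_sub,
    Matrix.dotProduct_mulVec (star v) ρ, hv', zero_dotProduct, sub_zero, Matrix.smul_mulVec,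
    dotProduct_smul, smul_eq_mul, cpMap_apply, Matrix.sum_mulVec, dotProduct_sum]
  congr 1
  refine Finset.sum_congr rfl fun k _ => ?_
  rw [Matrix.star_mulVec, Matrix.conjTranspose_conjTranspose, ← Matrix.mulVec_mulVec,
    ← Matrix.mulVec_mulVec, Matrix.dotProduct_mulVec (star v)]

lemma posDef_of_forall_ne {ρ : Op n} (hρ : ρ.PosSemidef)
    (h : ∀ v : Sys n → ℂ, ρ *ᵥ v = 0 → v = 0) : ρ.PosDef := by
  refine Matrix.PosDef.of_dotProduct_mulVec_pos hρ.1 fun v hv => ?_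
  refine lt_of_le_of_ne (hρ.dotProduct_mulVec_nonneg v) fun h0 => hv ?_
  exact h v ((hρ.dotProduct_mulVec_zero_iff v).1 h0.symm)

lemma exists_sub_smul_one_posSemidef {ρ : Op n} (hρ : ρ.PosDef) :
    ∃ δ : ℝ, 0 < δ ∧ (ρ - δ • (1 : Op n)).PosSemidef := by
  obtain ⟨V, d, h1, h2, hd⟩ := exists_diagonalization hρ.1
  have hV : IsUnit V := ⟨⟨V, Vᴴ, h2, h1⟩, rfl⟩
  have hdi : Vᴴ * ρ * V = Matrix.diagonal (fun i => (d i : ℂ)) := by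
    rw [hd]
    calc Vᴴ * (V * Matrix.diagonal (fun i => (d i : ℂ)) * Vᴴ) * V
        = (Vᴴ * V) * Matrix.diagonal (fun i => (d i : ℂ)) * (Vᴴ * V) := by
          simp only [Matrix.mul_assoc]
      _ = _ := by rw [h1, Matrix.one_mul, Matrix.mul_one]
  have hpos : ∀ i, 0 < d i := fun i => by
    have := (hρ.conjTranspose_mul_mul_same
      (Matrix.mulVec_injective_of_isUnit hV)).diag_pos (i := i)
    rw [hdi, Matrix.diagonal_apply_eq] at this
    simpa using this
  obtain ⟨i₀, -, hi₀⟩ := Finset.exists_min_image Finset.univ d Finset.univ_nonempty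
  refine ⟨d i₀, hpos i₀, ?_⟩
  have e : ρ - d i₀ • (1 : Op n) =
      V * Matrix.diagonal (fun i => ((d i - d i₀ : ℝ) : ℂ)) * Vᴴ := by
    have : Matrix.diagonal (fun i => ((d i - d i₀ : ℝ) : ℂ)) =
        Matrix.diagonal (fun i => (d i : ℂ)) - d i₀ • (1 : Op n) := by
      ext i j
      by_cases hij : i = j
      · subst hij
        simp
      · simp [hij]
    rw [this, Matrix.mul_sub, Matrix.sub_mul, hd]
    simp [h2]
  rw [e]
  exact (Matrix.PosSemidef.diagonal (d := fun i => ((d i - d i₀ : ℝ) : ℂ))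
    (fun i => by simpa using hi₀ i (Finset.mem_univ i))).mul_mul_conjTranspose_same V

namespace IsWeakStep

variable {S : ℝ → HermOp n →L[ℝ] HermOp n} (h : IsWeakStep A S)

include h

/-- If the Kraus operators generate all operators, the semigroup maps every nonzero positive
operator to a positive definite one: if `ρ_t v = 0`, then `s ↦ ⟨v, ρ_s v⟩` is minimal at `s = t`,
and its derivative there is a multiple of `∑ₖ ⟨Aₖ† v, ρ_t Aₖ† v⟩`. -/
lemma flow_posDef (hgen : Algebra.adjoin ℂ (Set.range A) = ⊤) {t : ℝ} (ht : 0 < t) {P : HermOp n}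
    (hP : (incl n P).PosSemidef) (hP0 : P ≠ 0) : (incl n (flow A t P)).PosDef := by
  have hρ := h.flow_posSemidef ht.le hP
  have htr : flow A t P ≠ 0 := fun h0 => by
    have h1 := h.flow_trace ht.le P
    rw [h0, map_zero, Matrix.trace_zero, Complex.zero_re, ← norm_of_posSemidef hP] at h1
    exact hP0 (norm_eq_zero.1 h1.symm)
  have hstab : Set.range A ⊆ kerStabilizer (incl n (flow A t P)) := by
    rintro _ ⟨k, rfl⟩ v hv
    set φ : HermOp n →ₗ[ℝ] ℝ :=
      { toFun := fun M => (star v ⬝ᵥ (incl n M *ᵥ v)).re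
        map_add' := fun M N => by
          rw [map_add, Matrix.add_mulVec, dotProduct_add, Complex.add_re]
        map_smul' := fun c M => by
          rw [map_smul, Matrix.smul_mulVec, dotProduct_smul, Complex.smul_re]
          rfl } with hφ
    have hφn : ∀ M : HermOp n, (incl n M).PosSemidef → 0 ≤ φ M := fun M hM =>
      (Complex.le_def.1 (hM.dotProduct_mulVec_nonneg v)).1
    have hd : HasDerivAt (fun s => φ (flow A s P)) (φ (genH A (flow A t P))) t :=
      (LinearMap.toContinuousLinearMap φ).hasFDerivAt.comp_hasDerivAt t (hasDerivAt_flow' A t P)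
    have h0 : φ (flow A t P) = 0 := by
      change (star v ⬝ᵥ (incl n (flow A t P) *ᵥ v)).re = 0
      rw [hv, dotProduct_zero, Complex.zero_re]
    have hmin : IsLocalMin (fun s => φ (flow A s P)) t := by
      filter_upwards [lt_mem_nhds ht] with s hs
      rw [h0]
      exact hφn _ (h.flow_posSemidef hs.le hP)
    have hz := hmin.hasDerivAt_eq_zero hd
    have hz' : (star v ⬝ᵥ (lindblad A (incl n (flow A t P)) *ᵥ v)).re = 0 := hz
    rw [dotProduct_lindblad_mulVec hρ.1 hv] at hz'
    have hnn : ∀ k, 0 ≤ star ((A k)ᴴ *ᵥ v) ⬝ᵥ (incl n (flow A t P) *ᵥ ((A k)ᴴ *ᵥ v)) :=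
      fun k => hρ.dotProduct_mulVec_nonneg _
    have hsum : (∑ k, (star ((A k)ᴴ *ᵥ v) ⬝ᵥ
        (incl n (flow A t P) *ᵥ ((A k)ᴴ *ᵥ v))).re) = 0 := by
      rw [← Complex.re_sum]
      simpa using hz'
    have hk := (Finset.sum_eq_zero_iff_of_nonneg
      fun k _ => (Complex.le_def.1 (hnn k)).1).1 hsum k (Finset.mem_univ k)
    refine (hρ.dotProduct_mulVec_zero_iff _).1 (Complex.ext hk ?_)
    exact (Complex.le_def.1 (hnn k)).2.symm
  have htop : kerStabilizer (incl n (flow A t P)) = ⊤ :=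
    top_unique (hgen ▸ Algebra.adjoin_le hstab)
  refine posDef_of_forall_ne hρ fun v hv => ?_
  by_contra hv0
  apply htr
  apply incl_injective
  rw [map_zero]
  exact eq_zero_of_kerStabilizer_eq_top htop hv0 hv

/-- The semigroup at time one is a strict contraction on traceless operators. -/
lemma exists_contraction (hgen : Algebra.adjoin ℂ (Set.range A) = ⊤) :
    ∃ c : ℝ, 0 ≤ c ∧ c < 1 ∧ ∀ M : HermOp n, (incl n M).trace.re = 0 →
      ‖flow A 1 M‖ ≤ c * ‖M‖ := by
  -- both parts of the Jordan decomposition are mapped above a common multiple of the identity,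
  -- which cancels in the difference
  have hstrict : ∀ M : HermOp n, (incl n M).trace.re = 0 → M ≠ 0 → ‖flow A 1 M‖ < ‖M‖ := by
    intro M hM hM0
    obtain ⟨P, N, hP, hN, hMe, hn⟩ := exists_posPart_negPart (incl_isHermitian M)
    have hMe' : M = ofHerm P hP.1 - ofHerm N hN.1 := by
      apply incl_injective
      rw [map_sub, incl_ofHerm, incl_ofHerm, hMe]
    have htr : P.trace.re = N.trace.re := by
      rw [hMe, Matrix.trace_sub, Complex.sub_re] at hM
      linarith
    have hpos : 0 < P.trace.re := by
      have : 0 < ‖M‖ := norm_pos_iff.2 hM0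
      rw [norm_def, hn] at this
      linarith
    have hne : ∀ (Q : Op n) (hQ : Q.PosSemidef), 0 < Q.trace.re → ofHerm Q hQ.1 ≠ 0 := by
      intro Q hQ hQt h0
      have := congrArg (incl n) h0
      rw [incl_ofHerm, map_zero] at this
      rw [this] at hQt
      simp at hQt
    have hdP := h.flow_posDef hgen one_pos (P := ofHerm P hP.1) hP (hne P hP hpos)
    have hdN := h.flow_posDef hgen one_pos (P := ofHerm N hN.1) hN (hne N hN (htr ▸ hpos))
    obtain ⟨δ₁, h1, hδ₁⟩ := exists_sub_smul_one_posSemidef hdP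
    obtain ⟨δ₂, h2, hδ₂⟩ := exists_sub_smul_one_posSemidef hdN
    have hsub : ∀ (Q : Op n) (δ δ' : ℝ), δ' ≤ δ → (Q - δ • (1 : Op n)).PosSemidef →
        (Q - δ' • (1 : Op n)).PosSemidef := by
      intro Q δ δ' hd hQ
      have : Q - δ' • (1 : Op n) = (Q - δ • (1 : Op n)) + (δ - δ') • (1 : Op n) := by
        rw [sub_smul]
        abel
      rw [this]
      exact hQ.add (Matrix.PosSemidef.one.smul (sub_nonneg.2 hd))
    have q1 := hsub _ _ _ (min_le_left δ₁ δ₂) hδ₁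
    have q2 := hsub _ _ _ (min_le_right δ₁ δ₂) hδ₂
    set δ := min δ₁ δ₂ with hδdef
    have hδ : 0 < δ := lt_min h1 h2
    have e : incl n (flow A 1 M) = (incl n (flow A 1 (ofHerm P hP.1)) - δ • (1 : Op n)) -
        (incl n (flow A 1 (ofHerm N hN.1)) - δ • (1 : Op n)) := by
      rw [hMe', map_sub, map_sub]
      abel
    have htone : 0 < ((1 : Op n).trace).re := by
      rw [Matrix.trace_one, Complex.natCast_re]
      exact_mod_cast Fintype.card_pos
    have tP := h.flow_trace zero_le_one (ofHerm P hP.1)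
    have tN := h.flow_trace zero_le_one (ofHerm N hN.1)
    rw [incl_ofHerm] at tP tN
    rw [norm_def, norm_def, hn, e]
    refine (traceNorm_sub_le q1 q2).trans_lt ?_
    simp only [Matrix.trace_sub, Matrix.trace_smul, Complex.sub_re, Complex.smul_re, smul_eq_mul,
      tP, tN]
    have : 0 < δ * ((1 : Op n).trace).re := mul_pos hδ htone
    linarith
  -- the contraction is uniform because the unit sphere is compact
  have : ProperSpace (HermOp n) := FiniteDimensional.proper ℝ _
  set K : Set (HermOp n) := {M | (incl n M).trace.re = 0} ∩ Metric.sphere 0 1 with hK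
  have hKc : IsCompact K :=
    (isCompact_sphere (0 : HermOp n) 1).inter_left (isClosed_eq (continuous_trace n)
        continuous_const)
  rcases K.eq_empty_or_nonempty with hE | hne
  · refine ⟨0, le_rfl, one_pos, fun M hM => ?_⟩
    by_cases hM0 : M = 0
    · simp [hM0]
    · exfalso
      have : (‖M‖⁻¹ • M) ∈ K := by
        refine ⟨?_, ?_⟩
        · change (incl n (‖M‖⁻¹ • M)).trace.re = 0
          rw [map_smul, Matrix.trace_smul, Complex.smul_re, hM, smul_zero]
        · rw [mem_sphere_zero_iff_norm, norm_smul, norm_inv, norm_norm,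
            inv_mul_cancel₀ (norm_ne_zero_iff.2 hM0)]
      rw [hE] at this
      exact this
  · obtain ⟨M₀, hM₀, hmax⟩ := hKc.exists_isMaxOn hne
      ((flow A 1).continuous.norm.continuousOn)
    have hM₀n : ‖M₀‖ = 1 := mem_sphere_zero_iff_norm.1 hM₀.2
    refine ⟨‖flow A 1 M₀‖, norm_nonneg _, ?_, fun M hM => ?_⟩
    · refine (hstrict M₀ hM₀.1 fun h0 => ?_).trans_eq hM₀n
      rw [h0, norm_zero] at hM₀n
      exact zero_ne_one hM₀n
    · by_cases hM0 : M = 0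
      · simp [hM0]
      have hpos : 0 < ‖M‖ := norm_pos_iff.2 hM0
      have hmem : (‖M‖⁻¹ • M) ∈ K := by
        refine ⟨?_, ?_⟩
        · change (incl n (‖M‖⁻¹ • M)).trace.re = 0
          rw [map_smul, Matrix.trace_smul, Complex.smul_re, hM, smul_zero]
        · rw [mem_sphere_zero_iff_norm, norm_smul, norm_inv, norm_norm,
            inv_mul_cancel₀ (norm_ne_zero_iff.2 hM0)]
      have : ‖flow A 1 (‖M‖⁻¹ • M)‖ ≤ ‖flow A 1 M₀‖ := hmax hmem
      rw [map_smul, norm_smul, norm_inv, norm_norm] at this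
      rwa [inv_mul_le_iff₀ hpos, mul_comm] at this

omit h in
lemma trace_ofHerm_of_isState {ρ : Op n} (hρ : IsState ρ) :
    (incl n (ofHerm ρ hρ.1.1)).trace.re = 1 := by
  rw [incl_ofHerm, hρ.2, Complex.one_re]

lemma norm_flow_nat_le {c : ℝ} (hc : ∀ M : HermOp n, (incl n M).trace.re = 0 →
    ‖flow A 1 M‖ ≤ c * ‖M‖) (hc0 : 0 ≤ c) (k : ℕ) {M : HermOp n} (hM : (incl n M).trace.re = 0) :
    ‖flow A k M‖ ≤ c ^ k * ‖M‖ := by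
  induction k with
  | zero => simp [flow_zero]
  | succ k ih =>
    have e : flow A ((k + 1 : ℕ) : ℝ) M = flow A 1 (flow A k M) := by
      rw [Nat.cast_succ, add_comm, flow_add]
      rfl
    rw [e]
    refine (hc _ ?_).trans ?_
    · rw [h.flow_trace (Nat.cast_nonneg k), hM]
    · rw [pow_succ', mul_assoc]
      gcongr

lemma flow_fixed {M : HermOp n} (hM : genH A M = 0) {t : ℝ} (ht : 0 ≤ t) : flow A t M = M := by
  have := h.norm_flow_sub_self_le ht M
  rw [hM, norm_zero, zero_mul] at this
  exact sub_eq_zero.1 (norm_le_zero_iff.1 this)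

/-- Existence of the stationary state and convergence to it. -/
lemma exists_stationary (hgen : Algebra.adjoin ℂ (Set.range A) = ⊤) :
    ∃ σ : HermOp n, genH A σ = 0 ∧ (incl n σ).PosSemidef ∧ (incl n σ).trace.re = 1 ∧
      ∀ ε : ℝ, 0 < ε → ∃ t : ℝ, 0 ≤ t ∧ ∀ ρ : HermOp n, (incl n ρ).PosSemidef →
        (incl n ρ).trace.re = 1 → ‖flow A t ρ - σ‖ ≤ ε := by
  obtain ⟨c, hc0, hc1, hc⟩ := h.exists_contraction hgen
  -- the range of the generator is traceless, so the generator has a kernel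
  have hns : ¬ Function.Surjective (genH A) := fun hs => by
    obtain ⟨M, hM⟩ := hs (ofHerm 1 Matrix.isHermitian_one)
    have h1 : (incl n (genH A M)).trace = 0 := trace_lindblad A _
    rw [hM, incl_ofHerm, Matrix.trace_one] at h1
    exact Fintype.card_ne_zero (Nat.cast_eq_zero.1 h1)
  have hni : ¬ Function.Injective (genH A) := fun hi =>
    hns ((LinearMap.injective_iff_surjective (f := (genH A : HermOp n →ₗ[ℝ] HermOp n))).1 hi)
  obtain ⟨M, hM, hM0⟩ : ∃ M, genH A M = 0 ∧ M ≠ 0 := by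
    by_contra hcon
    push Not at hcon
    exact hni ((injective_iff_map_eq_zero (genH A)).2 hcon)
  have htM : (incl n M).trace.re ≠ 0 := fun h0 => by
    have h1 := hc M h0
    rw [h.flow_fixed hM zero_le_one] at h1
    have : 0 < ‖M‖ := norm_pos_iff.2 hM0
    nlinarith
  set σ : HermOp n := ((incl n M).trace.re)⁻¹ • M with hσ
  have hσ0 : genH A σ = 0 := by rw [hσ, map_smul, hM, smul_zero]
  have hσt : (incl n σ).trace.re = 1 := by
    rw [hσ, map_smul, Matrix.trace_smul, Complex.smul_re, smul_eq_mul, inv_mul_cancel₀ htM]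
  have hconv : ∀ (k : ℕ) (ρ : HermOp n), (incl n ρ).trace.re = 1 →
      ‖flow A k ρ - σ‖ ≤ c ^ k * ‖ρ - σ‖ := fun k ρ hρ => by
    have e : flow A k ρ - σ = flow A k (ρ - σ) := by
      rw [map_sub, h.flow_fixed hσ0 (Nat.cast_nonneg k)]
    rw [e]
    refine h.norm_flow_nat_le hc hc0 k ?_
    rw [map_sub, Matrix.trace_sub, Complex.sub_re, hρ, hσt, sub_self]
  have hcard : (0 : ℝ) < Fintype.card (Sys n) := by exact_mod_cast Fintype.card_pos
  -- the completely mixed state converges to `σ`, so `σ` is positive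
  set ρ₀ : HermOp n := (Fintype.card (Sys n) : ℝ)⁻¹ • ofHerm 1 Matrix.isHermitian_one with hρ₀
  have hρ₀p : (incl n ρ₀).PosSemidef := by
    rw [hρ₀, map_smul, incl_ofHerm]
    exact Matrix.PosSemidef.one.smul (inv_nonneg.2 hcard.le)
  have hρ₀t : (incl n ρ₀).trace.re = 1 := by
    rw [hρ₀, map_smul, incl_ofHerm, Matrix.trace_smul, Complex.smul_re, Matrix.trace_one,
      Complex.natCast_re, smul_eq_mul, inv_mul_cancel₀ hcard.ne']
  have hlim : Filter.Tendsto (fun k : ℕ => flow A k ρ₀) Filter.atTop (nhds σ) := by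
    rw [tendsto_iff_norm_sub_tendsto_zero]
    refine squeeze_zero (fun _ => norm_nonneg _) (fun k => hconv k ρ₀ hρ₀t) ?_
    have := (tendsto_pow_atTop_nhds_zero_of_lt_one hc0 hc1).mul_const ‖ρ₀ - σ‖
    rwa [zero_mul] at this
  have hσp : (incl n σ).PosSemidef := (isClosed_posSemidef n).mem_of_tendsto hlim
    (Filter.Eventually.of_forall fun k => h.flow_posSemidef (Nat.cast_nonneg k) hρ₀p)
  refine ⟨σ, hσ0, hσp, hσt, fun ε hε => ?_⟩
  obtain ⟨k, hk⟩ := exists_pow_lt_of_lt_one (half_pos hε) hc1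
  refine ⟨k, Nat.cast_nonneg k, fun ρ hρ hρt => (hconv k ρ hρt).trans ?_⟩
  have h2 : ‖ρ - σ‖ ≤ 2 := by
    refine (norm_sub_le _ _).trans ?_
    rw [norm_of_posSemidef hρ, norm_of_posSemidef hσp, hρt, hσt]
    norm_num
  calc c ^ k * ‖ρ - σ‖ ≤ ε / 2 * 2 := by gcongr
    _ = ε := by ring

lemma stationary_unique (hgen : Algebra.adjoin ℂ (Set.range A) = ⊤) {σ σ' : HermOp n}
    (hσ : genH A σ = 0) (hσ' : genH A σ' = 0)
    (ht : (incl n σ).trace.re = (incl n σ').trace.re) : σ = σ' := by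
  obtain ⟨c, hc0, hc1, hc⟩ := h.exists_contraction hgen
  have h1 := hc (σ - σ') (by rw [map_sub, Matrix.trace_sub, Complex.sub_re, ht, sub_self])
  rw [h.flow_fixed (by rw [map_sub, hσ, hσ', sub_zero]) zero_le_one] at h1
  have h2 : ‖σ - σ'‖ ≤ 0 := by
    have := norm_nonneg (σ - σ')
    nlinarith
  exact sub_eq_zero.1 (norm_le_zero_iff.1 h2)

end IsWeakStep

end Mixing

/-! ### Kraus operators of one iteration -/

section Columns

variable {n g r : ℕ}

/-- The operator `⟨a| O |0⟩` on the system, for basis states `a` and `0` of registers 2, 3, 4. -/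
def col (O : FullOp n g r) (a : Anc g r) : Op n := fun i j => O (i, a) (j, anc0 g r)

lemma conjChannel_eq_cpMap (O : FullOp n g r) (ρ : Op n) : conjChannel O ρ = cpMap (col O) ρ := by
  ext i j
  simp only [conjChannel, traceAnc, cpMap_apply, Matrix.sum_apply]
  refine Finset.sum_congr rfl fun a _ => ?_
  have h1 : ∀ (k : Sys n) (b : Anc g r), (O * withAnc g r ρ) (i, a) (k, b) =
      if b = anc0 g r then (col O a * ρ) i k else 0 := fun k b => by
    rw [Matrix.mul_apply, Fintype.sum_prod_type, Matrix.mul_apply]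
    split_ifs with hb
    · refine Finset.sum_congr rfl fun l _ => ?_
      rw [Finset.sum_eq_single (anc0 g r)]
      · simp [withAnc, hb, col]
      · intro c _ hc
        simp [withAnc, hc.symm]
      · simp
    · refine Finset.sum_eq_zero fun l _ => Finset.sum_eq_zero fun c _ => ?_
      simp [withAnc, Ne.symm hb]
  rw [Matrix.mul_apply, Fintype.sum_prod_type, Matrix.mul_apply]
  refine Finset.sum_congr rfl fun k _ => ?_
  simp only [h1, ite_mul, zero_mul, Finset.sum_ite_eq', Finset.mem_univ, if_true]
  rfl

lemma zeroBlock_conjTranspose_mul (O O' : FullOp n g r) :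
    zeroBlock (Oᴴ * O') = ∑ a, (col O a)ᴴ * col O' a := by
  ext i j
  rw [Matrix.sum_apply, zeroBlock, Matrix.mul_apply, Fintype.sum_prod_type, Finset.sum_comm]
  rfl

lemma zeroBlock_eq_krausGram (O : FullOp n g r) : zeroBlock (Oᴴ * O) = krausGram (col O) :=
  zeroBlock_conjTranspose_mul O O

lemma col_mul_congr (M : FullOp n g r) {O O' : FullOp n g r} (h : col O = col O') :
    col (M * O) = col (M * O') := by
  funext a
  ext i j
  simp only [col, Matrix.mul_apply]
  refine Finset.sum_congr rfl fun x _ => ?_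
  have := congrFun (congrFun (congrFun h x.2) x.1) j
  rw [col, col] at this
  rw [this]

lemma col_sub (O O' : FullOp n g r) (a : Anc g r) : col (O - O') a = col O a - col O' a := rfl

lemma col_smul (c : ℂ) (O : FullOp n g r) (a : Anc g r) : col (c • O) a = c • col O a := rfl

lemma zeroBlock_one : zeroBlock (1 : FullOp n g r) = 1 := by
  ext i j
  simp [zeroBlock, Matrix.one_apply]

/-- An operator that is diagonal on registers 2 and 3 and acts as a real `2 × 2` matrix, dependent
on their state, on register 4. -/
def ancOp (n : ℕ) {g r : ℕ} (h : Est g r → Est g r → Bool → Bool → ℝ) : FullOp n g r :=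
  fun x y => if x.1 = y.1 ∧ x.2.1 = y.2.1 ∧ x.2.2.1 = y.2.2.1 then
    ((h x.2.1 x.2.2.1 x.2.2.2 y.2.2.2 : ℝ) : ℂ) else 0

lemma ancOp_apply (h : Est g r → Est g r → Bool → Bool → ℝ) (x y : Sys n × Anc g r) :
    ancOp n h x y = if x.1 = y.1 ∧ x.2.1 = y.2.1 ∧ x.2.2.1 = y.2.2.1 then
      ((h x.2.1 x.2.2.1 x.2.2.2 y.2.2.2 : ℝ) : ℂ) else 0 := rfl

lemma ancOp_mul_apply (h : Est g r → Est g r → Bool → Bool → ℝ) (O : FullOp n g r)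
    (x y : Sys n × Anc g r) : (ancOp n h * O) x y =
      ∑ b, (h x.2.1 x.2.2.1 x.2.2.2 b : ℂ) * O (x.1, x.2.1, x.2.2.1, b) y := by
  obtain ⟨i, E, E', f⟩ := x
  simp only [Matrix.mul_apply, Fintype.sum_prod_type, ancOp_apply]
  rw [Finset.sum_eq_single i]
  · rw [Finset.sum_eq_single E]
    · rw [Finset.sum_eq_single E']
      · simp
      · intro F _ hF
        simp [hF.symm]
      · simp
    · intro F _ hF
      simp [hF.symm]
    · simp
  · intro k _ hk
    simp [hk.symm]
  · simp

lemma ancOp_mul (h h' : Est g r → Est g r → Bool → Bool → ℝ) :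
    ancOp n h * ancOp n h' = ancOp n fun E E' x y => ∑ b, h E E' x b * h' E E' b y := by
  ext x y
  rw [ancOp_mul_apply]
  simp only [ancOp_apply]
  split_ifs with hc
  · push_cast
    rfl
  · simp only [mul_zero, Finset.sum_const_zero]

lemma ancOp_conjTranspose (h : Est g r → Est g r → Bool → Bool → ℝ) :
    (ancOp n h)ᴴ = ancOp n fun E E' x y => h E E' y x := by
  ext x y
  rw [Matrix.conjTranspose_apply, ancOp_apply, ancOp_apply]
  by_cases hc : x.1 = y.1 ∧ x.2.1 = y.2.1 ∧ x.2.2.1 = y.2.2.1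
  · have hc' : y.1 = x.1 ∧ y.2.1 = x.2.1 ∧ y.2.2.1 = x.2.2.1 :=
      ⟨hc.1.symm, hc.2.1.symm, hc.2.2.symm⟩
    rw [if_pos hc, if_pos hc', hc.2.1, hc.2.2, Complex.star_def, Complex.conj_ofReal]
  · have hc' : ¬ (y.1 = x.1 ∧ y.2.1 = x.2.1 ∧ y.2.2.1 = x.2.2.1) :=
      fun h' => hc ⟨h'.1.symm, h'.2.1.symm, h'.2.2.symm⟩
    rw [if_neg hc, if_neg hc', star_zero]

lemma ancOp_sub (h h' : Est g r → Est g r → Bool → Bool → ℝ) :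
    ancOp n h - ancOp n h' = ancOp n fun E E' x y => h E E' x y - h' E E' x y := by
  ext x y
  simp only [ancOp_apply, Matrix.sub_apply]
  split_ifs <;> simp

lemma ancOp_smul (c : ℝ) (h : Est g r → Est g r → Bool → Bool → ℝ) :
    (c : ℂ) • ancOp n h = ancOp n fun E E' x y => c * h E E' x y := by
  ext x y
  simp only [ancOp_apply, Matrix.smul_apply, smul_eq_mul]
  split_ifs <;> simp

lemma proj_eq_ancOp (b : Bool) :
    proj n g r b = ancOp n fun _ _ x y => if x = b ∧ y = b then 1 else 0 := by
  ext ⟨i, E, E', f⟩ ⟨j, F, F', f'⟩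
  simp only [proj, Matrix.diagonal_apply, ancOp_apply, Prod.mk.injEq]
  by_cases h1 : i = j ∧ E = F ∧ E' = F'
  · cases f <;> cases f' <;> cases b <;> simp [h1]
  · rw [if_neg h1, if_neg fun h => h1 ⟨h.1, h.2.1, h.2.2.1⟩]

lemma one_kronecker_apply (w : Matrix (Anc g r) (Anc g r) ℂ) (x y : Sys n × Anc g r) :
    ((1 : Op n) ⊗ₖ w) x y = if x.1 = y.1 then w x.2 y.2 else 0 := by
  rw [Matrix.kroneckerMap_apply, Matrix.one_apply, ite_mul, one_mul, zero_mul]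

lemma accW_eq_ancOp (κ β τ : ℝ) :
    accW n g r κ β τ = ancOp n fun E E' => rotation τ (acceptRate κ β E E') := by
  ext x y
  refine (one_kronecker_apply _ x y).trans ?_
  rw [ancOp_apply]
  by_cases h1 : x.1 = y.1 <;> by_cases h2 : x.2.1 = y.2.1 <;>
    by_cases h3 : x.2.2.1 = y.2.2.1 <;> simp [h1, h2, h3]

/-- The operator that is `s E E'` times `|y⟩⟨x|` on register 4. -/
def flagOp (n : ℕ) {g r : ℕ} (x y : Bool) (s : Est g r → Est g r → ℝ) : FullOp n g r :=
  ancOp n fun E E' b c => if b = y ∧ c = x then s E E' else 0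

lemma accW10_eq_flagOp (κ β : ℝ) :
    accW10 n g r κ β = flagOp n false true fun E E' => Real.sqrt (acceptRate κ β E E') := by
  ext x y
  refine (one_kronecker_apply _ x y).trans ?_
  rw [flagOp, ancOp_apply]
  by_cases h1 : x.1 = y.1 <;> by_cases h2 : x.2.1 = y.2.1 <;> by_cases h3 : x.2.2.1 = y.2.2.1 <;>
    simp [h1, h2, h3]
  split_ifs <;> simp

lemma flagOp_mul (x y z : Bool) (s t : Est g r → Est g r → ℝ) :
    flagOp n y z s * flagOp n x y t = flagOp n x z fun E E' => s E E' * t E E' := by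
  rw [flagOp, flagOp, ancOp_mul, flagOp]
  congr 1
  funext E E' b c
  cases x <;> cases y <;> cases z <;> cases b <;> cases c <;> simp

lemma flagOp_conjTranspose (x y : Bool) (s : Est g r → Est g r → ℝ) :
    (flagOp n x y s)ᴴ = flagOp n y x s := by
  rw [flagOp, ancOp_conjTranspose, flagOp]
  congr 1
  funext E E' b c
  cases x <;> cases y <;> cases b <;> cases c <;> simp

lemma flagOp_smul (c : ℝ) (x y : Bool) (s : Est g r → Est g r → ℝ) :
    (c : ℂ) • flagOp n x y s = flagOp n x y fun E E' => c * s E E' := by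
  rw [flagOp, ancOp_smul, flagOp]
  simp only [mul_ite, mul_zero]

lemma flagOp_sub (x y : Bool) (s t : Est g r → Est g r → ℝ) :
    flagOp n x y s - flagOp n x y t = flagOp n x y fun E E' => s E E' - t E E' := by
  rw [flagOp, flagOp, ancOp_sub, flagOp]
  congr 1
  funext E E' b c
  split_ifs <;> simp

lemma proj_true_mul_accW_mul_proj_false (κ β τ : ℝ) :
    proj n g r true * accW n g r κ β τ * proj n g r false =
      flagOp n false true fun E E' => τ * Real.sqrt (acceptRate κ β E E') := by
  rw [proj_eq_ancOp, accW_eq_ancOp, proj_eq_ancOp, ancOp_mul, ancOp_mul, flagOp]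
  congr 1
  funext E E' b c
  cases b <;> cases c <;> simp [rotation]

lemma proj_true_mul_accW_conjTranspose_mul_proj_false (κ β τ : ℝ) :
    proj n g r true * (accW n g r κ β τ)ᴴ * proj n g r false =
      flagOp n false true fun E E' => τ * Real.sqrt (acceptRate κ β E E') := by
  rw [proj_eq_ancOp, accW_eq_ancOp, proj_eq_ancOp, ancOp_conjTranspose, ancOp_mul, ancOp_mul,
    flagOp]
  congr 1
  funext E E' b c
  cases b <;> cases c <;> simp [rotation]

lemma proj_false_mul_accW_mul_proj_false (κ β τ : ℝ) :
    proj n g r false * accW n g r κ β τ * proj n g r false =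
      flagOp n false false fun E E' => Real.sqrt (1 - τ ^ 2 * acceptRate κ β E E') := by
  rw [proj_eq_ancOp, accW_eq_ancOp, ancOp_mul, ancOp_mul, flagOp]
  congr 1
  funext E E' b c
  cases b <;> cases c <;> simp [rotation]

lemma proj_false_mul_accW_conjTranspose_mul_proj_false (κ β τ : ℝ) :
    proj n g r false * (accW n g r κ β τ)ᴴ * proj n g r false =
      flagOp n false false fun E E' => Real.sqrt (1 - τ ^ 2 * acceptRate κ β E E') := by
  rw [proj_eq_ancOp, accW_eq_ancOp, ancOp_conjTranspose, ancOp_mul, ancOp_mul, flagOp]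
  congr 1
  funext E E' b c
  cases b <;> cases c <;> simp [rotation]

lemma col_flagOp_mul (x y : Bool) (s : Est g r → Est g r → ℝ) (O : FullOp n g r) (E E' : Est g r)
    (b : Bool) : col (flagOp n x y s * O) (E, E', b) =
      if b = y then (s E E' : ℂ) • col O (E, E', x) else 0 := by
  ext i j
  rw [col, flagOp, ancOp_mul_apply]
  cases x <;> cases y <;> cases b <;> simp [col]

/-- The unitary keeps the flag in the state it starts from. -/
def FlagFree (U : FullOp n g r) : Prop := ∀ E E', col U (E, E', true) = 0

lemma FlagFree.col_proj {U : FullOp n g r} (hU : FlagFree U) :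
    col (flagOp n false false (fun _ _ => 1) * U) = col U := by
  funext ⟨E, E', b⟩
  rw [col_flagOp_mul]
  cases b
  · simp
  · simp [hU E E']

lemma acceptRate_pos (κ β : ℝ) (E E' : Est g r) : 0 < acceptRate κ β E E' :=
  lt_min one_pos (Real.exp_pos _)

lemma acceptRate_le_one (κ β : ℝ) (E E' : Est g r) : acceptRate κ β E E' ≤ 1 := min_le_left _ _

/-- The Kraus operators of the acceptance branch in lowest order in `τ`. -/
def acceptKraus (κ β : ℝ) (U : FullOp n g r) : Anc g r → Op n :=
  col (flagOp n false true (fun E E' => Real.sqrt (acceptRate κ β E E')) * U)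

/-- The Kraus operators of the part of the acceptance branches that is of fourth order in `τ`. -/
def acceptKraus₂ (κ β : ℝ) (U : FullOp n g r) : Anc g r → Op n :=
  col (flagOp n false true (fun E E' => acceptRate κ β E E') * U)

/-- The Kraus operators of the part of the rejection branch that is of fourth order in `τ`. -/
def rejectKraus₂ (κ β : ℝ) (U : FullOp n g r) : Anc g r → Op n :=
  col (Uᴴ * (flagOp n false false (fun E E' => acceptRate κ β E E') * U))

lemma generatorFixed_eq_lindblad (κ β : ℝ) (U : FullOp n g r) (ρ : Op n) :
    generatorFixed κ β g r U ρ = lindblad (acceptKraus κ β U) ρ := by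
  have e : Uᴴ * (accW10 n g r κ β)ᴴ * accW10 n g r κ β * U =
      (accW10 n g r κ β * U)ᴴ * (accW10 n g r κ β * U) := by
    rw [Matrix.conjTranspose_mul]
    simp only [Matrix.mul_assoc]
  rw [generatorFixed, e, zeroBlock_eq_krausGram, conjChannel_eq_cpMap, accW10_eq_flagOp]
  rfl

lemma krausGram_col_flagOp_mul (x y : Bool) (s : Est g r → Est g r → ℝ) (U : FullOp n g r) :
    krausGram (col (flagOp n x y s * U)) =
      zeroBlock (Uᴴ * (flagOp n x x (fun E E' => s E E' * s E E') * U)) := by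
  rw [← zeroBlock_eq_krausGram, Matrix.conjTranspose_mul, flagOp_conjTranspose, Matrix.mul_assoc,
    ← Matrix.mul_assoc (flagOp n y x s), flagOp_mul]

lemma krausGram_acceptKraus (κ β : ℝ) (U : FullOp n g r) :
    krausGram (acceptKraus κ β U) = rejectKraus₂ κ β U (anc0 g r) := by
  rw [acceptKraus, krausGram_col_flagOp_mul]
  simp only [Real.mul_self_sqrt (acceptRate_pos κ β _ _).le]
  rfl

lemma krausGram_rejectKraus₂ (κ β : ℝ) {U : FullOp n g r} (hU : U * Uᴴ = 1) :
    krausGram (rejectKraus₂ κ β U) = krausGram (acceptKraus₂ κ β U) := by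
  rw [rejectKraus₂, acceptKraus₂, krausGram_col_flagOp_mul, ← zeroBlock_eq_krausGram,
    Matrix.conjTranspose_mul, Matrix.conjTranspose_conjTranspose, Matrix.mul_assoc,
    ← Matrix.mul_assoc U, hU, Matrix.one_mul, Matrix.conjTranspose_mul, flagOp_conjTranspose,
    Matrix.mul_assoc, ← Matrix.mul_assoc (flagOp n false false _), flagOp_mul]

lemma one_sub_krausGram_posSemidef {U : FullOp n g r} (hU : Uᴴ * U = 1) (hf : FlagFree U)
    {s : Est g r → Est g r → ℝ} (hs : ∀ E E', s E E' * s E E' ≤ 1) (y : Bool) :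
    (1 - krausGram (col (flagOp n false y s * U))).PosSemidef := by
  have e : 1 - krausGram (col (flagOp n false y s * U)) = krausGram
      (col (flagOp n false false (fun E E' => Real.sqrt (1 - s E E' * s E E')) * U)) := by
    have h1 : (1 : Op n) =
        zeroBlock (Uᴴ * (flagOp n false false (fun _ _ => 1) * U)) := by
      have : ∀ O : FullOp n g r, zeroBlock O = col O (anc0 g r) := fun _ => rfl
      rw [this, col_mul_congr Uᴴ hf.col_proj, hU, ← this, zeroBlock_one]
    rw [krausGram_col_flagOp_mul, krausGram_col_flagOp_mul]
    conv_lhs => rw [h1]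
    have hz : ∀ O O' : FullOp n g r, zeroBlock O - zeroBlock O' = zeroBlock (O - O') :=
      fun _ _ => rfl
    rw [hz, ← Matrix.mul_sub, ← Matrix.sub_mul, flagOp_sub]
    simp only [Real.mul_self_sqrt (sub_nonneg.2 (hs _ _))]
  rw [e]
  exact krausGram_posSemidef _

lemma one_sub_krausGram_acceptKraus (κ β : ℝ) {U : FullOp n g r} (hU : Uᴴ * U = 1)
    (hf : FlagFree U) : (1 - krausGram (acceptKraus κ β U)).PosSemidef :=
  one_sub_krausGram_posSemidef hU hf (fun E E' => by
    rw [Real.mul_self_sqrt (acceptRate_pos κ β _ _).le]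
    exact acceptRate_le_one κ β E E') true

lemma one_sub_krausGram_acceptKraus₂ (κ β : ℝ) {U : FullOp n g r} (hU : Uᴴ * U = 1)
    (hf : FlagFree U) : (1 - krausGram (acceptKraus₂ κ β U)).PosSemidef :=
  one_sub_krausGram_posSemidef hU hf (fun E E' => by
    have h0 := (acceptRate_pos κ β E E').le
    have h1 := acceptRate_le_one κ β E E'
    nlinarith) true

lemma cpMap_sub_smul {ι : Type*} [Fintype ι] (A B : ι → Op n) (c : ℝ) (ρ : Op n) :
    cpMap (fun k => A k - (c : ℂ) • B k) ρ = cpMap A ρ -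
      (c : ℂ) • (∑ k, B k * ρ * (A k)ᴴ + ∑ k, A k * ρ * (B k)ᴴ) +
        ((c ^ 2 : ℝ) : ℂ) • cpMap B ρ := by
  simp only [cpMap_apply, ← Finset.sum_add_distrib, Finset.smul_sum, ← Finset.sum_sub_distrib]
  refine Finset.sum_congr rfl fun k _ => ?_
  rw [Matrix.conjTranspose_sub, Matrix.conjTranspose_smul, Complex.star_def, Complex.conj_ofReal]
  simp only [Matrix.sub_mul, Matrix.mul_sub, Matrix.smul_mul, Matrix.mul_smul, smul_add, smul_smul,
    smul_sub]
  push_cast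
  rw [pow_two]
  abel

lemma sum_col_one_left (F : Anc g r → Op n) :
    ∑ a, col (1 : FullOp n g r) a * F a = F (anc0 g r) := by
  have h1 : col (1 : FullOp n g r) (anc0 g r) = 1 := zeroBlock_one
  rw [Finset.sum_eq_single (anc0 g r)]
  · rw [h1, Matrix.one_mul]
  · intro a _ ha
    have : col (1 : FullOp n g r) a = 0 := by
      ext i j
      simp [col, ha]
    rw [this, Matrix.zero_mul]
  · simp

/-- Exact expansion of one iteration in powers of `τ²`. -/
lemma stepFixed_eq {κ β τ : ℝ} (hτ : 0 ≤ τ) (hτ1 : τ ≤ 1) {U : FullOp n g r} (hU : Uᴴ * U = 1)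
    (hf : FlagFree U) (ρ : Op n) :
    stepFixed κ β τ g r U ρ = ρ + ((τ ^ 2 : ℝ) : ℂ) • lindblad (acceptKraus κ β U) ρ +
      ((τ ^ 4 : ℝ) : ℂ) • (cpMap (rejectKraus₂ κ β U) ρ - cpMap (acceptKraus₂ κ β U) ρ) := by
  have hrate : ∀ E E' : Est g r, 0 ≤ 1 - τ ^ 2 * acceptRate κ β E E' := fun E E' => by
    have h0 := (acceptRate_pos κ β E E').le
    have h1 := acceptRate_le_one κ β E E'
    have h2 : τ ^ 2 ≤ 1 := pow_le_one₀ hτ hτ1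
    nlinarith
  -- the two acceptance branches add up to `2 τ²` times the first-order part minus `τ⁴` times
  -- the correction
  have hacc : conjChannel (opAccept κ β τ g r U) ρ + conjChannel (opAltAccept κ β τ g r U) ρ =
      ((τ ^ 2 : ℝ) : ℂ) • ((2 : ℂ) • cpMap (acceptKraus κ β U) ρ) -
        ((τ ^ 4 : ℝ) : ℂ) • cpMap (acceptKraus₂ κ β U) ρ := by
    rw [opAccept, opAltAccept, proj_true_mul_accW_mul_proj_false,
      proj_true_mul_accW_conjTranspose_mul_proj_false, proj_false_mul_accW_mul_proj_false,
      flagOp_mul]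
    simp only [conjChannel_eq_cpMap, cpMap_apply, acceptKraus, acceptKraus₂]
    rw [← Finset.sum_add_distrib, Finset.smul_sum, Finset.smul_sum, Finset.smul_sum,
      ← Finset.sum_sub_distrib]
    refine Finset.sum_congr rfl fun a _ => ?_
    obtain ⟨E, E', b⟩ := a
    simp only [col_flagOp_mul]
    cases b
    · simp
    · simp only [if_true, Matrix.conjTranspose_smul, Complex.star_def, Complex.conj_ofReal,
        Matrix.smul_mul, Matrix.mul_smul, smul_smul, ← add_smul, ← sub_smul]
      congr 1
      have e1 := Real.mul_self_sqrt (acceptRate_pos κ β E E').le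
      have e2 := Real.mul_self_sqrt (hrate E E')
      generalize Real.sqrt (1 - τ ^ 2 * acceptRate κ β E E') = q at e2 ⊢
      generalize Real.sqrt (acceptRate κ β E E') = p at e1 ⊢
      generalize acceptRate κ β E E' = f at e1 e2 ⊢
      norm_cast
      calc τ * p * (τ * p) + τ * p * q * (τ * p * q)
          = τ ^ 2 * (p * p) + τ ^ 2 * (p * p) * (q * q) := by ring
        _ = _ := by
          rw [e1, e2]
          ring
  have hrej : conjChannel (opReject κ β τ g r U) ρ = ρ -
      ((τ ^ 2 : ℝ) : ℂ) • (krausGram (acceptKraus κ β U) * ρ +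
        ρ * krausGram (acceptKraus κ β U)) +
      ((τ ^ 4 : ℝ) : ℂ) • cpMap (rejectKraus₂ κ β U) ρ := by
    have hcol : col (opReject κ β τ g r U) = fun a => col (1 : FullOp n g r) a -
        ((τ ^ 2 : ℝ) : ℂ) • rejectKraus₂ κ β U a := by
      have hs : flagOp n false false (fun E E' : Est g r =>
          Real.sqrt (1 - τ ^ 2 * acceptRate κ β E E') *
            Real.sqrt (1 - τ ^ 2 * acceptRate κ β E E')) =
          flagOp n false false (fun _ _ => 1) -
            ((τ ^ 2 : ℝ) : ℂ) • flagOp n false false (fun E E' => acceptRate κ β E E') := by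
        rw [flagOp_smul, flagOp_sub]
        simp only [Real.mul_self_sqrt (hrate _ _)]
      rw [opReject, proj_false_mul_accW_conjTranspose_mul_proj_false,
        proj_false_mul_accW_mul_proj_false, Matrix.mul_assoc Uᴴ, flagOp_mul, hs]
      funext a
      rw [Matrix.mul_assoc, Matrix.sub_mul, Matrix.mul_sub, col_sub, Matrix.smul_mul,
        Matrix.mul_smul, col_smul, col_mul_congr Uᴴ hf.col_proj, hU]
      rfl
    rw [conjChannel_eq_cpMap, hcol, cpMap_sub_smul]
    have hone : cpMap (col (1 : FullOp n g r)) ρ = ρ := by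
      rw [cpMap_apply]
      simp only [Matrix.mul_assoc]
      rw [sum_col_one_left fun a => ρ * (col (1 : FullOp n g r) a)ᴴ]
      have h1 : col (1 : FullOp n g r) (anc0 g r) = 1 := zeroBlock_one
      rw [h1, Matrix.conjTranspose_one, Matrix.mul_one]
    have hX := krausGram_acceptKraus κ β U
    have hXh : (rejectKraus₂ κ β U (anc0 g r))ᴴ = rejectKraus₂ κ β U (anc0 g r) := by
      rw [← hX]
      exact (krausGram_posSemidef _).1.eq
    have h2 : ∑ a, col (1 : FullOp n g r) a * ρ * (rejectKraus₂ κ β U a)ᴴ =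
        ρ * rejectKraus₂ κ β U (anc0 g r) := by
      simp only [Matrix.mul_assoc]
      rw [sum_col_one_left fun a => ρ * (rejectKraus₂ κ β U a)ᴴ, hXh]
    have h3 : ∑ a, rejectKraus₂ κ β U a * ρ * (col (1 : FullOp n g r) a)ᴴ =
        rejectKraus₂ κ β U (anc0 g r) * ρ := by
      have := congrArg Matrix.conjTranspose
        (sum_col_one_left fun a => (rejectKraus₂ κ β U a * ρ)ᴴ)
      rw [Matrix.conjTranspose_sum] at this
      simp only [Matrix.conjTranspose_mul (col _ _), Matrix.conjTranspose_conjTranspose] at this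
      exact this
    rw [hone, h2, h3, hX]
    congr 3
    ring
  rw [stepFixed, hacc, hrej, lindblad_apply, smul_sub, smul_sub]
  abel

end Columns

/-! ### Embedding block operators into larger registers -/

section Embedding

variable {n g r : ℕ}

lemma sum_est_eq_off {M : Type*} [AddCommMonoid M] (i : Fin g) (E : Est g r) (φ : Est g r → M) :
    ∑ F : Est g r, (if ∀ j, j ≠ i → E j = F j then φ F else 0) =
      ∑ c : Bits r, φ (Function.update E i c) := by
  rw [← Finset.sum_filter]
  symm
  refine Finset.sum_bij' (fun c _ => Function.update E i c) (fun F _ => F i) ?_ ?_ ?_ ?_ ?_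
  · intro c _
    simp only [Finset.mem_filter, Finset.mem_univ, true_and]
    intro j hj
    rw [Function.update_of_ne hj]
  · intro F _
    exact Finset.mem_univ _
  · intro c _
    simp
  · intro F hF
    simp only [Finset.mem_filter, Finset.mem_univ, true_and] at hF
    funext j
    by_cases hj : j = i
    · subst hj
      simp
    · rw [Function.update_of_ne hj, hF j hj]
  · intro c _
    rfl

lemma onBlock_mul_apply (i : Fin g) (Q : Matrix (Sys n × Bits r) (Sys n × Bits r) ℂ)
    {m : Type*} (R : Matrix (Sys n × Est g r) m ℂ) (x : Sys n × Est g r) (y : m) :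
    (onBlock i Q * R) x y =
      ∑ k, ∑ c, Q (x.1, x.2 i) (k, c) * R (k, Function.update x.2 i c) y := by
  rw [Matrix.mul_apply, Fintype.sum_prod_type]
  refine Finset.sum_congr rfl fun k _ => ?_
  simp only [onBlock, ite_mul, zero_mul]
  rw [sum_est_eq_off i x.2 fun F => Q (x.1, x.2 i) (k, F i) * R (k, F) y]
  simp

lemma onBlock_mul (i : Fin g) (Q R : Matrix (Sys n × Bits r) (Sys n × Bits r) ℂ) :
    onBlock i (Q * R) = onBlock i Q * onBlock i R := by
  ext x y
  rw [onBlock_mul_apply]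
  by_cases h : ∀ j, j ≠ i → x.2 j = y.2 j
  · rw [onBlock, if_pos h, Matrix.mul_apply, Fintype.sum_prod_type]
    refine Finset.sum_congr rfl fun k _ => Finset.sum_congr rfl fun c _ => ?_
    rw [onBlock, if_pos]
    · simp
    · intro j hj
      simpa [Function.update_of_ne hj] using h j hj
  · rw [onBlock, if_neg h]
    symm
    refine Finset.sum_eq_zero fun k _ => Finset.sum_eq_zero fun c _ => ?_
    rw [onBlock, if_neg, mul_zero]
    intro h'
    refine h fun j hj => ?_
    simpa [Function.update_of_ne hj] using h' j hj

lemma onBlock_one (i : Fin g) :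
    onBlock i (1 : Matrix (Sys n × Bits r) (Sys n × Bits r) ℂ) = 1 := by
  ext ⟨x, E⟩ ⟨y, F⟩
  simp only [onBlock, Matrix.one_apply, Prod.mk.injEq]
  by_cases hx : x = y
  · by_cases hE : E = F
    · simp [hx, hE]
    · rw [if_neg (fun h : x = y ∧ E = F => hE h.2)]
      by_cases h : ∀ j, j ≠ i → E j = F j
      · rw [if_pos h, if_neg]
        rintro ⟨-, hi⟩
        refine hE (funext fun j => ?_)
        by_cases hj : j = i
        · rw [hj, hi]
        · exact h j hj
      · rw [if_neg h]
  · simp [hx]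

lemma onBlock_conjTranspose (i : Fin g) (Q : Matrix (Sys n × Bits r) (Sys n × Bits r) ℂ) :
    (onBlock i Q)ᴴ = onBlock i Qᴴ := by
  ext x y
  rw [Matrix.conjTranspose_apply, onBlock, onBlock, Matrix.conjTranspose_apply]
  by_cases h : ∀ j, j ≠ i → x.2 j = y.2 j
  · rw [if_pos h, if_pos fun j hj => (h j hj).symm]
  · rw [if_neg h, if_neg fun h' => h fun j hj => (h' j hj).symm, star_zero]

lemma onReg2_mul_apply (Q : Matrix (Sys n × Est g r) (Sys n × Est g r) ℂ)
    {m : Type*} (R : Matrix (Sys n × Anc g r) m ℂ) (x : Sys n × Anc g r) (y : m) :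
    (onReg2 Q * R) x y = ∑ k, ∑ F, Q (x.1, x.2.1) (k, F) * R (k, F, x.2.2) y := by
  simp only [Matrix.mul_apply, Fintype.sum_prod_type]
  refine Finset.sum_congr rfl fun k _ => Finset.sum_congr rfl fun F _ => ?_
  simp only [← Fintype.sum_prod_type (fun z : Est g r × Bool => onReg2 Q x (k, F, z) *
    R (k, F, z) y)]
  rw [Finset.sum_eq_single x.2.2]
  · simp [onReg2]
  · intro z _ hz
    simp [onReg2, hz.symm]
  · simp

lemma onReg3_mul_apply (Q : Matrix (Sys n × Est g r) (Sys n × Est g r) ℂ)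
    {m : Type*} (R : Matrix (Sys n × Anc g r) m ℂ) (x : Sys n × Anc g r) (y : m) :
    (onReg3 Q * R) x y =
      ∑ k, ∑ F, Q (x.1, x.2.2.1) (k, F) * R (k, x.2.1, F, x.2.2.2) y := by
  simp only [Matrix.mul_apply, Fintype.sum_prod_type]
  refine Finset.sum_congr rfl fun k _ => ?_
  rw [Finset.sum_eq_single x.2.1]
  · refine Finset.sum_congr rfl fun F _ => ?_
    rw [Finset.sum_eq_single x.2.2.2]
    · simp [onReg3]
    · intro z _ hz
      simp [onReg3, hz.symm]
    · simp
  · intro z _ hz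
    simp [onReg3, hz.symm]
  · simp

lemma onReg2_mul (Q R : Matrix (Sys n × Est g r) (Sys n × Est g r) ℂ) :
    (onReg2 (Q * R) : FullOp n g r) = onReg2 Q * onReg2 R := by
  ext x y
  rw [onReg2_mul_apply]
  simp only [onReg2]
  split_ifs with h
  · rw [Matrix.mul_apply, Fintype.sum_prod_type]
  · simp

lemma onReg3_mul (Q R : Matrix (Sys n × Est g r) (Sys n × Est g r) ℂ) :
    (onReg3 (Q * R) : FullOp n g r) = onReg3 Q * onReg3 R := by
  ext x y
  rw [onReg3_mul_apply]
  simp only [onReg3]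
  split_ifs with h
  · rw [Matrix.mul_apply, Fintype.sum_prod_type]
  · simp

lemma onReg2_one : (onReg2 1 : FullOp n g r) = 1 := by
  ext ⟨x, E, E', f⟩ ⟨y, F, F', f'⟩
  simp only [onReg2, Matrix.one_apply, Prod.mk.injEq]
  by_cases h1 : x = y <;> by_cases h2 : E = F <;> by_cases h3 : E' = F' <;>
    by_cases h4 : f = f' <;> simp [h1, h2, h3, h4]

lemma onReg3_one : (onReg3 1 : FullOp n g r) = 1 := by
  ext ⟨x, E, E', f⟩ ⟨y, F, F', f'⟩
  simp only [onReg3, Matrix.one_apply, Prod.mk.injEq]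
  by_cases h1 : x = y <;> by_cases h2 : E = F <;> by_cases h3 : E' = F' <;>
    by_cases h4 : f = f' <;> simp [h1, h2, h3, h4]

lemma onReg2_conjTranspose (Q : Matrix (Sys n × Est g r) (Sys n × Est g r) ℂ) :
    (onReg2 Q : FullOp n g r)ᴴ = onReg2 Qᴴ := by
  ext x y
  simp only [Matrix.conjTranspose_apply, onReg2]
  by_cases h : x.2.2 = y.2.2
  · rw [if_pos h, if_pos h.symm]
  · rw [if_neg h, if_neg (Ne.symm h), star_zero]

lemma onReg3_conjTranspose (Q : Matrix (Sys n × Est g r) (Sys n × Est g r) ℂ) :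
    (onReg3 Q : FullOp n g r)ᴴ = onReg3 Qᴴ := by
  ext x y
  simp only [Matrix.conjTranspose_apply, onReg3]
  by_cases h : x.2.1 = y.2.1 ∧ x.2.2.2 = y.2.2.2
  · rw [if_pos h, if_pos ⟨h.1.symm, h.2.symm⟩]
  · rw [if_neg h, if_neg fun h' => h ⟨h'.1.symm, h'.2.symm⟩, star_zero]

/-- The operator `⟨E| Q |0⟩` on the system, for an operator on system and estimate register. -/
def estCol (Q : Matrix (Sys n × Est g r) (Sys n × Est g r) ℂ) (E : Est g r) : Op n :=
  fun i j => Q (i, E) (j, fun _ _ => false)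

/-- The operator `⟨b| Q |0⟩` on the system, for an operator on system and one block. -/
def blockCol (Q : Matrix (Sys n × Bits r) (Sys n × Bits r) ℂ) (b : Bits r) : Op n :=
  fun i j => Q (i, b) (j, fun _ => false)

lemma estCol_list_prod (Q : Matrix (Sys n × Bits r) (Sys n × Bits r) ℂ) (l : List (Fin g))
    (hl : l.Nodup) (E : Est g r) :
    estCol ((l.map fun i => onBlock i Q).prod) E =
      if ∀ j, j ∉ l → E j = fun _ => false then (l.map fun i => blockCol Q (E i)).prod else 0 := by
  induction l generalizing E with
  | nil =>
    ext i j
    simp only [estCol, List.map_nil, List.prod_nil, List.not_mem_nil, not_false_eq_true,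
      forall_true_left, Matrix.one_apply, Prod.mk.injEq]
    by_cases h : ∀ j, E j = fun _ => false
    · have : E = fun _ _ => false := funext h
      simp [this, Matrix.one_apply]
    · have : ¬ E = fun _ _ => false := fun h' => h fun j => congrFun h' j
      simp [h, this]
  | cons i l ih =>
    obtain ⟨hi, hl⟩ := List.nodup_cons.1 hl
    ext x y
    have h1 : ∀ F k, ((l.map fun i => onBlock i Q).prod) (k, F) (y, fun _ _ => false) =
        (if ∀ j, j ∉ l → F j = fun _ => false then
          (l.map fun i => blockCol Q (F i)).prod else 0) k y := fun F k => by
      rw [← ih hl F]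
      rfl
    rw [estCol, List.map_cons, List.prod_cons, onBlock_mul_apply]
    simp only [h1]
    by_cases h : ∀ j, j ∉ i :: l → E j = fun _ => false
    · rw [if_pos h, List.map_cons, List.prod_cons, Matrix.mul_apply]
      refine Finset.sum_congr rfl fun k _ => ?_
      rw [Finset.sum_eq_single (fun _ => false)]
      · rw [if_pos]
        · have e : (l.map fun j => blockCol Q (Function.update E i (fun _ => false) j)) =
              l.map fun j => blockCol Q (E j) := List.map_congr_left fun j hj => by
            rw [Function.update_of_ne]
            rintro rfl
            exact hi hj
          rw [e]
          rfl
        · intro j hj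
          by_cases hji : j = i
          · rw [hji, Function.update_self]
          · rw [Function.update_of_ne hji]
            exact h j (by simp [hji, hj])
      · intro c _ hc
        rw [if_neg, Matrix.zero_apply, mul_zero]
        intro h'
        have := h' i hi
        rw [Function.update_self] at this
        exact hc this
      · simp
    · rw [if_neg h, Matrix.zero_apply]
      refine Finset.sum_eq_zero fun k _ => Finset.sum_eq_zero fun c _ => ?_
      rw [if_neg, Matrix.zero_apply, mul_zero]
      intro h'
      refine h fun j hj => ?_
      have hji : j ≠ i := fun e => hj (by simp [e])
      have := h' j fun e => hj (by simp [e])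
      rwa [Function.update_of_ne hji] at this

lemma estCol_boostedQPE (κ : ℝ) (H : Op n) (flip : Bool) (E : Est g r) :
    estCol (boostedQPE κ H g r flip) E =
      (List.ofFn fun i => blockCol (qpe κ H r flip) (E i)).prod := by
  have h := estCol_list_prod (qpe κ H r flip) (List.finRange g) (List.nodup_finRange g) E
  rw [if_pos fun j hj => absurd (List.mem_finRange j) hj] at h
  rw [boostedQPE, List.ofFn_eq_map, h, List.ofFn_eq_map]

lemma kronecker_one_mul_apply (C : Op n) {m : Type*} (R : Matrix (Sys n × Anc g r) m ℂ)
    (x : Sys n × Anc g r) (y : m) :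
    ((C ⊗ₖ (1 : Matrix (Anc g r) (Anc g r) ℂ)) * R) x y = ∑ k, C x.1 k * R (k, x.2) y := by
  rw [Matrix.mul_apply, Fintype.sum_prod_type]
  refine Finset.sum_congr rfl fun k _ => ?_
  rw [Finset.sum_eq_single x.2]
  · simp
  · intro z _ hz
    simp [hz.symm]
  · simp

lemma col_unitaryU (κ : ℝ) (H : Op n) (flip : Bool) (C : Op n) (E E' : Est g r) (b : Bool) :
    col (unitaryU κ H g r flip C) (E, E', b) = if b = false then
      estCol (boostedQPE κ H g r flip) E' * C * estCol (boostedQPE κ H g r flip) E else 0 := by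
  set Q := boostedQPE κ H g r flip with hQ
  ext i j
  have h2 : ∀ (k : Sys n) (F F' : Est g r),
      ((C ⊗ₖ (1 : Matrix (Anc g r) (Anc g r) ℂ)) * onReg2 Q) (k, F, F', b) (j, anc0 g r) =
        if F' = (fun _ _ => false) ∧ b = false then (C * estCol Q F) k j else 0 := by
    intro k F F'
    rw [kronecker_one_mul_apply, Matrix.mul_apply]
    simp only [onReg2, anc0, Prod.mk.injEq]
    split_ifs with h
    · rfl
    · simp
  rw [col, unitaryU, ← hQ, Matrix.mul_assoc, onReg3_mul_apply]
  simp only [h2]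
  cases b
  · simp only [and_true, if_true, mul_ite, mul_zero, Finset.sum_ite_eq', Finset.mem_univ]
    rw [Matrix.mul_assoc, Matrix.mul_apply]
    rfl
  · simp

lemma flagFree_unitaryU (κ : ℝ) (H : Op n) (flip : Bool) (C : Op n) :
    FlagFree (unitaryU κ H g r flip C) := fun E E' => by
  rw [col_unitaryU]
  simp

end Embedding

/-! ### Phase estimation in the energy eigenbasis -/

section PhaseEstimation

variable {n g r : ℕ}

/-- Bit strings as numbers below `2 ^ r`. -/
def bitsEquiv (r : ℕ) : Bits r ≃ Fin (2 ^ r) :=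
  (Equiv.arrowCongr (Equiv.refl _) finTwoEquiv.symm).trans finFunctionFinEquiv

lemma bitsEquiv_apply (b : Bits r) : (bitsEquiv r b : ℕ) = b.val := by
  rw [bitsEquiv, Equiv.trans_apply, finFunctionFinEquiv_apply_val, Bits.val]
  refine Finset.sum_congr rfl fun j _ => ?_
  change ((finTwoEquiv.symm (b j) : Fin 2) : ℕ) * 2 ^ (j : ℕ) = _
  cases b j <;> simp [finTwoEquiv]

lemma Bits.val_lt (b : Bits r) : b.val < 2 ^ r := by
  rw [← bitsEquiv_apply]
  exact (bitsEquiv r b).2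

lemma Bits.val_injective : Function.Injective (Bits.val (r := r)) := fun b c h => by
  rw [← bitsEquiv_apply, ← bitsEquiv_apply] at h
  exact (bitsEquiv r).injective (Fin.ext h)

lemma Bits.sum_val {M : Type*} [AddCommMonoid M] (φ : ℕ → M) :
    ∑ b : Bits r, φ b.val = ∑ k ∈ Finset.range (2 ^ r), φ k := by
  rw [Finset.sum_range, ← (bitsEquiv r).sum_comp]
  simp only [bitsEquiv_apply]

lemma Bits.exists_val {k : ℕ} (hk : k < 2 ^ r) : ∃ b : Bits r, b.val = k :=
  ⟨(bitsEquiv r).symm ⟨k, hk⟩, by rw [← bitsEquiv_apply, Equiv.apply_symm_apply]⟩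

@[simp] lemma Bits.val_zero : Bits.val (fun _ : Fin r => false) = 0 := by simp [Bits.val]

open Complex in
lemma sum_exp_bits (b c : Bits r) :
    ∑ k : Bits r, exp (2 * Real.pi * I * (k.val * ((c.val : ℂ) - b.val)) / 2 ^ r) =
      if b = c then 2 ^ r else 0 := by
  have hN : (2 : ℂ) ^ r ≠ 0 := by positivity
  set z := exp (2 * Real.pi * I * ((c.val : ℂ) - b.val) / 2 ^ r) with hz
  have hk : ∀ k : Bits r, exp (2 * Real.pi * I * (k.val * ((c.val : ℂ) - b.val)) / 2 ^ r) =
      z ^ k.val := fun k => by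
    rw [hz, ← Complex.exp_nat_mul]
    congr 1
    ring
  simp only [hk]
  rw [Bits.sum_val fun k => z ^ k]
  split_ifs with h
  · have : z = 1 := by rw [hz, h]; simp
    simp [this]
  · have hz1 : z ≠ 1 := by
      intro h1
      obtain ⟨m, hm⟩ := Complex.exp_eq_one_iff.1 h1
      have hpi : (2 * Real.pi * I : ℂ) ≠ 0 := Complex.two_pi_I_ne_zero
      have h2 : ((c.val : ℂ) - b.val) = m * 2 ^ r := by
        have h3 : (2 * Real.pi * I : ℂ) * (((c.val : ℂ) - b.val) / 2 ^ r) =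
            (2 * Real.pi * I : ℂ) * m := by rw [← mul_div_assoc, hm]; ring
        have := mul_left_cancel₀ hpi h3
        rw [← this, div_mul_cancel₀ _ hN]
      have h3 : (c.val : ℤ) - b.val = m * 2 ^ r := by exact_mod_cast h2
      have hb := b.val_lt
      have hc := c.val_lt
      have hm0 : m = 0 := by
        by_contra hne
        have : (2 : ℤ) ^ r ≤ |m * 2 ^ r| := by
          rw [abs_mul, abs_of_pos (by positivity : (0 : ℤ) < 2 ^ r)]
          have : 1 ≤ |m| := Int.one_le_abs hne
          nlinarith [(by positivity : (0 : ℤ) < 2 ^ r)]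
        rw [← h3] at this
        have hb' : (b.val : ℤ) < 2 ^ r := by exact_mod_cast hb
        have hc' : (c.val : ℤ) < 2 ^ r := by exact_mod_cast hc
        have : |(c.val : ℤ) - b.val| < 2 ^ r := abs_lt.2 ⟨by omega, by omega⟩
        omega
      rw [hm0, zero_mul] at h3
      exact h (Bits.val_injective (by omega))
    have hzN : z ^ 2 ^ r = 1 := by
      rw [hz, ← Complex.exp_nat_mul, Complex.exp_eq_one_iff]
      refine ⟨c.val - b.val, ?_⟩
      push_cast
      field_simp
    rw [geom_sum_eq hz1, hzN, sub_self, zero_div]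

open Complex in
lemma qft_conjTranspose_mul_self : (qft r)ᴴ * qft r = 1 := by
  ext b c
  rw [Matrix.mul_apply, Matrix.one_apply]
  have hs : ((Real.sqrt (2 ^ r) : ℝ) : ℂ) * (Real.sqrt (2 ^ r) : ℝ) = 2 ^ r := by
    rw [← Complex.ofReal_mul, Real.mul_self_sqrt (by positivity)]
    push_cast
    rfl
  have hk : ∀ k : Bits r, (qft r)ᴴ b k * qft r k c =
      exp (2 * Real.pi * I * (k.val * ((c.val : ℂ) - b.val)) / 2 ^ r) / 2 ^ r := fun k => by
    rw [Matrix.conjTranspose_apply, qft, qft, Complex.star_def, map_div₀, Complex.conj_ofReal,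
      ← Complex.exp_conj, div_mul_div_comm, hs, ← Complex.exp_add]
    congr 2
    simp only [map_div₀, map_mul, Complex.conj_ofReal, Complex.conj_I, map_ofNat, map_pow,
      Complex.conj_natCast]
    push_cast
    ring
  simp only [hk]
  rw [← Finset.sum_div, sum_exp_bits]
  split_ifs
  · exact div_self (by positivity)
  · exact zero_div _

lemma qft_mul_conjTranspose_self : qft r * (qft r)ᴴ = 1 :=
  mul_eq_one_comm.1 qft_conjTranspose_mul_self

lemma hadamardLayer_conjTranspose : (hadamardLayer r)ᴴ = hadamardLayer r := by
  ext b k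
  rw [Matrix.conjTranspose_apply, hadamardLayer, hadamardLayer, star_prod]
  refine Finset.prod_congr rfl fun j _ => ?_
  rw [star_div₀, Complex.star_def, Complex.conj_ofReal, Bool.and_comm]
  split_ifs <;> simp

lemma hadamardLayer_mul_self : hadamardLayer r * hadamardLayer r = 1 := by
  ext b c
  rw [Matrix.mul_apply, Matrix.one_apply]
  simp only [hadamardLayer, ← Finset.prod_mul_distrib]
  have hs : ((Real.sqrt 2 : ℝ) : ℂ) * (Real.sqrt 2 : ℝ) = 2 := by
    rw [← Complex.ofReal_mul, Real.mul_self_sqrt (by positivity)]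
    rfl
  rw [← Fintype.prod_sum fun (j : Fin r) (x : Bool) =>
    ((if b j && x then (-1 : ℂ) else 1) / (Real.sqrt 2 : ℂ)) *
      ((if x && c j then (-1 : ℂ) else 1) / (Real.sqrt 2 : ℂ))]
  have hj : ∀ j, ∑ x : Bool, ((if b j && x then (-1 : ℂ) else 1) / (Real.sqrt 2 : ℂ)) *
      ((if x && c j then (-1 : ℂ) else 1) / (Real.sqrt 2 : ℂ)) = if b j = c j then 1 else 0 := by
    intro j
    simp only [div_mul_div_comm, hs]
    cases b j <;> cases c j <;> norm_num
  simp only [hj]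
  split_ifs with h
  · simp [h]
  · obtain ⟨j, hj⟩ := Function.ne_iff.1 h
    exact Finset.prod_eq_zero (Finset.mem_univ j) (if_neg hj)

lemma ctrlPowers_conjTranspose_apply (U : Op n) (x y : Sys n × Bits r) :
    (ctrlPowers r U)ᴴ x y = if x.2 = y.2 then ((U ^ x.2.val)ᴴ) x.1 y.1 else 0 := by
  rw [Matrix.conjTranspose_apply, ctrlPowers]
  by_cases h : x.2 = y.2
  · rw [if_pos h, if_pos h.symm, h, Matrix.conjTranspose_apply]
  · rw [if_neg h, if_neg (Ne.symm h), star_zero]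

lemma ctrlPowers_conjTranspose_mul_self {U : Op n} (hU : Uᴴ * U = 1) :
    (ctrlPowers r U)ᴴ * ctrlPowers r U = 1 := by
  have hp : ∀ k : ℕ, (U ^ k)ᴴ * U ^ k = 1 := fun k => by
    have : U ∈ Matrix.unitaryGroup (Sys n) ℂ := Matrix.mem_unitaryGroup_iff'.2 hU
    exact Matrix.mem_unitaryGroup_iff'.1 (pow_mem this k)
  ext ⟨x, b⟩ ⟨y, c⟩
  have hz : ∀ z : Sys n, ∑ e, (ctrlPowers r U)ᴴ (x, b) (z, e) * ctrlPowers r U (z, e) (y, c) =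
      if b = c then ((U ^ b.val)ᴴ) x z * (U ^ b.val) z y else 0 := fun z => by
    rw [Finset.sum_eq_single b]
    · simp [ctrlPowers]
    · intro e _ he
      rw [ctrlPowers_conjTranspose_apply, if_neg (Ne.symm he), zero_mul]
    · simp
  rw [Matrix.mul_apply, Fintype.sum_prod_type, Matrix.one_apply]
  simp only [hz, Prod.mk.injEq]
  by_cases h : b = c
  · have := congrFun (congrFun (hp b.val) x) y
    rw [Matrix.mul_apply, Matrix.one_apply] at this
    simp only [h, and_true, if_true] at this ⊢
    exact this
  · simp [h]

lemma one_kronecker_mul (P Q : Matrix (Bits r) (Bits r) ℂ) :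
    ((1 : Op n) ⊗ₖ P) * ((1 : Op n) ⊗ₖ Q) = (1 : Op n) ⊗ₖ (P * Q) := by
  rw [← Matrix.mul_kronecker_mul, Matrix.one_mul]

lemma one_kronecker_conjTranspose (P : Matrix (Bits r) (Bits r) ℂ) :
    ((1 : Op n) ⊗ₖ P)ᴴ = (1 : Op n) ⊗ₖ Pᴴ := by
  rw [Matrix.conjTranspose_kronecker, Matrix.conjTranspose_one]

lemma conjTranspose_mul_self_mul {ι : Type*} [Fintype ι] [DecidableEq ι] {A B : Matrix ι ι ℂ}
    (hA : Aᴴ * A = 1) (hB : Bᴴ * B = 1) : (A * B)ᴴ * (A * B) = 1 := by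
  rw [Matrix.conjTranspose_mul, Matrix.mul_assoc, ← Matrix.mul_assoc Aᴴ, hA, Matrix.one_mul, hB]

lemma qpe_conjTranspose_mul_self {κ : ℝ} {H : Op n} (hU : (evolution κ H)ᴴ * evolution κ H = 1)
    (flip : Bool) : (qpe κ H r flip)ᴴ * qpe κ H r flip = 1 := by
  have h1 : ((1 : Op n) ⊗ₖ hadamardLayer r)ᴴ * ((1 : Op n) ⊗ₖ hadamardLayer r) = 1 := by
    rw [one_kronecker_conjTranspose, one_kronecker_mul, hadamardLayer_conjTranspose,
      hadamardLayer_mul_self, Matrix.one_kronecker_one]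
  have h2 := ctrlPowers_conjTranspose_mul_self (r := r) hU
  have h3 : (ctrlPowers r (evolution κ H))ᴴᴴ * (ctrlPowers r (evolution κ H))ᴴ = 1 := by
    rw [Matrix.conjTranspose_conjTranspose]
    exact mul_eq_one_comm.1 h2
  have h4 : ((1 : Op n) ⊗ₖ qft r)ᴴ * ((1 : Op n) ⊗ₖ qft r) = 1 := by
    rw [one_kronecker_conjTranspose, one_kronecker_mul, qft_conjTranspose_mul_self,
      Matrix.one_kronecker_one]
  have h5 : ((1 : Op n) ⊗ₖ (qft r)ᴴ)ᴴ * ((1 : Op n) ⊗ₖ (qft r)ᴴ) = 1 := by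
    rw [one_kronecker_conjTranspose, one_kronecker_mul, Matrix.conjTranspose_conjTranspose,
      qft_mul_conjTranspose_self, Matrix.one_kronecker_one]
  cases flip
  · simp only [qpe, Bool.false_eq_true, if_false]
    exact conjTranspose_mul_self_mul (conjTranspose_mul_self_mul h5 h2) h1
  · simp only [qpe, if_true]
    exact conjTranspose_mul_self_mul (conjTranspose_mul_self_mul h4 h3) h1

lemma onBlock_conjTranspose_mul_self (i : Fin g)
    {Q : Matrix (Sys n × Bits r) (Sys n × Bits r) ℂ} (hQ : Qᴴ * Q = 1) :
    (onBlock i Q)ᴴ * onBlock i Q = 1 := by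
  rw [onBlock_conjTranspose, ← onBlock_mul, hQ, onBlock_one]

lemma boostedQPE_conjTranspose_mul_self {κ : ℝ} {H : Op n}
    (hU : (evolution κ H)ᴴ * evolution κ H = 1) (flip : Bool) :
    (boostedQPE κ H g r flip)ᴴ * boostedQPE κ H g r flip = 1 := by
  have h : ∀ l : List (Fin g), ((l.map fun i => onBlock i (qpe κ H r flip)).prod)ᴴ *
      (l.map fun i => onBlock i (qpe κ H r flip)).prod = 1 := fun l => by
    induction l with
    | nil => simp
    | cons i l ih =>
      rw [List.map_cons, List.prod_cons]
      exact conjTranspose_mul_self_mul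
        (onBlock_conjTranspose_mul_self i (qpe_conjTranspose_mul_self hU flip)) ih
  rw [boostedQPE, List.ofFn_eq_map]
  exact h _

lemma unitaryU_conjTranspose_mul_self {κ : ℝ} {H : Op n}
    (hU : (evolution κ H)ᴴ * evolution κ H = 1) (flip : Bool) {C : Op n} (hC : Cᴴ * C = 1) :
    (unitaryU κ H g r flip C)ᴴ * unitaryU κ H g r flip C = 1 := by
  have hQ := boostedQPE_conjTranspose_mul_self (g := g) (r := r) hU flip
  rw [unitaryU]
  refine conjTranspose_mul_self_mul (conjTranspose_mul_self_mul ?_ ?_) ?_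
  · rw [onReg3_conjTranspose, ← onReg3_mul, hQ, onReg3_one]
  · rw [Matrix.conjTranspose_kronecker, ← Matrix.mul_kronecker_mul, hC, Matrix.conjTranspose_one,
      Matrix.one_mul, Matrix.one_kronecker_one]
  · rw [onReg2_conjTranspose, ← onReg2_mul, hQ, onReg2_one]

/-- The probability amplitude of the outcome `b` of phase estimation on an eigenvector whose
eigenvalue is `x` times the grid spacing `κ / 2 ^ r`. -/
def amp (x : ℝ) (b : Bits r) : ℂ :=
  (∑ k : Bits r, Complex.exp (2 * Real.pi * Complex.I * (k.val * ((x : ℂ) - b.val)) / 2 ^ r)) /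
    2 ^ r

/-- The amplitudes of the flipped version are the complex conjugates of the standard ones. -/
def ampFlip (flip : Bool) (x : ℝ) (b : Bits r) : ℂ :=
  if flip then (starRingEnd ℂ) (amp x b) else amp x b

lemma norm_ampFlip (flip : Bool) (x : ℝ) (b : Bits r) : ‖ampFlip flip x b‖ = ‖amp x b‖ := by
  cases flip
  · rfl
  · exact RCLike.norm_conj _

open Complex in
lemma sum_amp (x : ℝ) : ∑ b : Bits r, amp x b = 1 := by
  simp only [amp]
  rw [← Finset.sum_div, Finset.sum_comm, div_eq_one_iff_eq (by positivity)]
  have hk : ∀ k : Bits r, ∑ b : Bits r,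
      exp (2 * Real.pi * I * (k.val * ((x : ℂ) - b.val)) / 2 ^ r) =
      exp (2 * Real.pi * I * (k.val * x) / 2 ^ r) *
        if k = (fun _ => false) then 2 ^ r else 0 := fun k => by
    rw [← sum_exp_bits, Finset.mul_sum]
    refine Finset.sum_congr rfl fun b _ => ?_
    rw [← Complex.exp_add]
    congr 1
    rw [Bits.val_zero]
    push_cast
    ring
  simp only [hk, mul_ite, mul_zero, Finset.sum_ite_eq', Finset.mem_univ, if_true, Bits.val_zero]
  simp

lemma sum_ampFlip (flip : Bool) (x : ℝ) : ∑ b : Bits r, ampFlip flip x b = 1 := by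
  cases flip
  · exact sum_amp x
  · simp only [ampFlip, if_true]
    rw [← map_sum, sum_amp, map_one]

variable {κ : ℝ} {H V : Op n} {d : Sys n → ℝ}

lemma exp_smul_diagonalization (h2 : V * Vᴴ = 1)
    (hH : H = V * Matrix.diagonal (fun i => (d i : ℂ)) * Vᴴ) (c : ℂ) :
    NormedSpace.exp (c • H) = V * Matrix.diagonal (fun i => Complex.exp (c * d i)) * Vᴴ := by
  have hinv : V⁻¹ = Vᴴ := Matrix.inv_eq_right_inv h2
  have hunit : IsUnit V := ⟨⟨V, Vᴴ, h2, mul_eq_one_comm.1 h2⟩, rfl⟩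
  have e : c • H = V * Matrix.diagonal (fun i => c * d i) * V⁻¹ := by
    have : Matrix.diagonal (fun i => c * (d i : ℂ)) =
        c • Matrix.diagonal (fun i => (d i : ℂ)) := by
      rw [← Matrix.diagonal_smul]
      rfl
    rw [hinv, this, hH]
    simp
  rw [e, Matrix.exp_conj _ _ hunit, Matrix.exp_diagonal, hinv]
  congr 3
  funext i
  rw [Pi.coe_exp, ← Complex.exp_eq_exp_ℂ]

lemma mul_conj_diag (h1 : Vᴴ * V = 1) (p q : Sys n → ℂ) :
    (V * Matrix.diagonal p * Vᴴ) * (V * Matrix.diagonal q * Vᴴ) =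
      V * Matrix.diagonal (fun i => p i * q i) * Vᴴ := by
  calc (V * Matrix.diagonal p * Vᴴ) * (V * Matrix.diagonal q * Vᴴ)
      = V * Matrix.diagonal p * (Vᴴ * V) * Matrix.diagonal q * Vᴴ := by
        simp only [Matrix.mul_assoc]
    _ = _ := by rw [h1, Matrix.mul_one, Matrix.mul_assoc V, Matrix.diagonal_mul_diagonal]

lemma conj_diag_conjTranspose (p : Sys n → ℂ) :
    (V * Matrix.diagonal p * Vᴴ)ᴴ =
      V * Matrix.diagonal (fun i => (starRingEnd ℂ) (p i)) * Vᴴ := by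
  rw [Matrix.conjTranspose_mul, Matrix.conjTranspose_mul, Matrix.conjTranspose_conjTranspose,
    Matrix.diagonal_conjTranspose, Matrix.mul_assoc]
  rfl

lemma evolution_eq (h2 : V * Vᴴ = 1)
    (hH : H = V * Matrix.diagonal (fun i => (d i : ℂ)) * Vᴴ) : evolution κ H =
      V * Matrix.diagonal (fun i => Complex.exp (2 * Real.pi * Complex.I / κ * d i)) * Vᴴ :=
  exp_smul_diagonalization h2 hH _

lemma evolution_conjTranspose_mul_self (hH : H.IsHermitian) :
    (evolution κ H)ᴴ * evolution κ H = 1 := by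
  obtain ⟨V, d, h1, h2, hd⟩ := exists_diagonalization hH
  rw [evolution_eq h2 hd, conj_diag_conjTranspose, mul_conj_diag h1]
  have : ∀ i, (starRingEnd ℂ) (Complex.exp (2 * Real.pi * Complex.I / κ * d i)) *
      Complex.exp (2 * Real.pi * Complex.I / κ * d i) = 1 := fun i => by
    rw [← Complex.exp_conj, ← Complex.exp_add, Complex.exp_eq_one_iff]
    refine ⟨0, ?_⟩
    simp only [map_div₀, map_mul, Complex.conj_ofReal, Complex.conj_I, map_ofNat]
    push_cast
    ring
  simp only [this]
  rw [Matrix.diagonal_one, Matrix.mul_one, h2]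

lemma conj_diag_pow (h1 : Vᴴ * V = 1) (h2 : V * Vᴴ = 1) (p : Sys n → ℂ) (k : ℕ) :
    (V * Matrix.diagonal p * Vᴴ) ^ k = V * Matrix.diagonal (fun i => p i ^ k) * Vᴴ := by
  induction k with
  | zero => simp [h2]
  | succ k ih =>
    rw [pow_succ, ih, mul_conj_diag h1]
    simp only [pow_succ]

lemma hadamardLayer_zero (k : Bits r) :
    hadamardLayer r k (fun _ => false) = 1 / ((Real.sqrt (2 ^ r) : ℝ) : ℂ) := by
  have : Real.sqrt (2 ^ r) = Real.sqrt 2 ^ r := by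
    rw [Real.sqrt_eq_iff_eq_sq (by positivity) (by positivity), ← pow_mul, mul_comm, pow_mul,
      Real.sq_sqrt (by norm_num)]
  simp [hadamardLayer, this]

lemma ctrlPowers_kronecker_col (Z P : Matrix (Bits r) (Bits r) ℂ)
    (T : Matrix (Sys n × Bits r) (Sys n × Bits r) ℂ) (F : Bits r → Op n)
    (hT : ∀ x y, T x y = if x.2 = y.2 then F x.2 x.1 y.1 else 0) (b : Bits r) :
    blockCol (((1 : Op n) ⊗ₖ Z) * T * ((1 : Op n) ⊗ₖ P)) b =
      ∑ k, (Z b k * P k (fun _ => false)) • F k := by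
  ext x y
  rw [blockCol, Matrix.mul_assoc, Matrix.mul_apply, Fintype.sum_prod_type, Finset.sum_eq_single x]
  · rw [Matrix.sum_apply]
    refine Finset.sum_congr rfl fun k _ => ?_
    rw [Matrix.mul_apply, Fintype.sum_prod_type, Finset.sum_eq_single y]
    · rw [Finset.sum_eq_single k]
      · rw [hT]
        simp only [Matrix.kroneckerMap_apply, Matrix.one_apply, Matrix.smul_apply, smul_eq_mul,
          if_true]
        ring
      · intro c _ hc
        rw [hT, if_neg (fun h => hc h.symm), zero_mul]
      · simp
    · intro z _ hz
      simp [Matrix.kroneckerMap_apply, hz]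
    · simp
  · intro z _ hz
    simp [Matrix.kroneckerMap_apply, hz.symm]
  · simp

open Complex in
lemma blockCol_qpe (h1 : Vᴴ * V = 1) (h2 : V * Vᴴ = 1)
    (hH : H = V * Matrix.diagonal (fun i => (d i : ℂ)) * Vᴴ) (flip : Bool) (b : Bits r) :
    blockCol (qpe κ H r flip) b =
      V * Matrix.diagonal (fun i => ampFlip flip (d i * 2 ^ r / κ) b) * Vᴴ := by
  have hs : ((Real.sqrt (2 ^ r) : ℝ) : ℂ) * (Real.sqrt (2 ^ r) : ℝ) = 2 ^ r := by
    rw [← Complex.ofReal_mul, Real.mul_self_sqrt (by positivity)]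
    push_cast
    rfl
  have hsum : ∀ (c : Bits r → ℂ) (p : Bits r → Sys n → ℂ),
      ∑ k, c k • (V * Matrix.diagonal (p k) * Vᴴ) =
        V * Matrix.diagonal (fun i => ∑ k, c k * p k i) * Vᴴ := fun c p => by
    have : Matrix.diagonal (fun i => ∑ k, c k * p k i) =
        ∑ k, c k • Matrix.diagonal (p k) := by
      ext i j
      rw [Matrix.sum_apply]
      by_cases hij : i = j
      · subst hij
        simp
      · simp [hij]
    rw [this, Matrix.mul_sum, Matrix.sum_mul]
    simp
  have hstd : ∀ (k : Bits r) (i : Sys n),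
      star (qft r k b) * (1 / ((Real.sqrt (2 ^ r) : ℝ) : ℂ)) *
        exp (2 * Real.pi * I / κ * d i) ^ k.val =
      exp (2 * Real.pi * I * (k.val * (((d i * 2 ^ r / κ : ℝ) : ℂ) - b.val)) / 2 ^ r) / 2 ^ r := by
    intro k i
    rw [qft, Complex.star_def, map_div₀, Complex.conj_ofReal, div_mul_div_comm, hs, mul_one,
      div_mul_eq_mul_div, ← Complex.exp_conj, ← Complex.exp_nat_mul, ← Complex.exp_add]
    congr 2
    simp only [map_div₀, map_mul, Complex.conj_ofReal, Complex.conj_I, map_ofNat, map_pow,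
      Complex.conj_natCast]
    push_cast
    have hN : (2 : ℂ) ^ r ≠ 0 := by positivity
    field_simp
    ring
  cases flip
  · simp only [qpe, Bool.false_eq_true, if_false]
    rw [ctrlPowers_kronecker_col _ _ (ctrlPowers r (evolution κ H)) (fun k => evolution κ H ^ k.val)
      fun x y => rfl]
    simp only [evolution_eq h2 hH, conj_diag_pow h1 h2, hadamardLayer_zero,
      Matrix.conjTranspose_apply]
    rw [hsum]
    congr 3
    funext i
    simp only [ampFlip, Bool.false_eq_true, if_false, amp, Finset.sum_div, hstd]
  · simp only [qpe, if_true]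
    rw [ctrlPowers_kronecker_col _ _ _ (fun k => (evolution κ H ^ k.val)ᴴ) fun x y =>
      ctrlPowers_conjTranspose_apply _ x y]
    simp only [evolution_eq h2 hH, conj_diag_pow h1 h2, hadamardLayer_zero,
      conj_diag_conjTranspose]
    rw [hsum]
    congr 3
    funext i
    simp only [ampFlip, if_true, amp, Finset.sum_div, ← hstd, map_sum]
    refine Finset.sum_congr rfl fun k _ => ?_
    rw [map_mul, map_mul, Complex.star_def, Complex.conj_conj, map_div₀, map_one,
      Complex.conj_ofReal]
    have : qft r b k = qft r k b := by
      rw [qft, qft, mul_comm (Bits.val b)]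
    rw [this]

/-- The amplitude of the outcome `E` of boosted phase estimation. -/
def estAmp (flip : Bool) (x : ℝ) (E : Est g r) : ℂ := ∏ i, ampFlip flip x (E i)

lemma estCol_eq (h1 : Vᴴ * V = 1) (h2 : V * Vᴴ = 1)
    (hH : H = V * Matrix.diagonal (fun i => (d i : ℂ)) * Vᴴ) (flip : Bool) (E : Est g r) :
    estCol (boostedQPE κ H g r flip) E =
      V * Matrix.diagonal (fun i => estAmp flip (d i * 2 ^ r / κ) E) * Vᴴ := by
  have hl : ∀ l : List (Fin g), (l.map fun i => blockCol (qpe κ H r flip) (E i)).prod =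
      V * Matrix.diagonal (fun j => (l.map fun i =>
        ampFlip flip (d j * 2 ^ r / κ) (E i)).prod) * Vᴴ := fun l => by
    induction l with
    | nil => simp [h2]
    | cons i l ih =>
      rw [List.map_cons, List.prod_cons, ih, blockCol_qpe h1 h2 hH, mul_conj_diag h1]
      simp
  rw [estCol_boostedQPE, List.ofFn_eq_map, hl]
  simp only [← List.ofFn_eq_map, List.prod_ofFn]
  rfl

lemma sum_estAmp (flip : Bool) (x : ℝ) : ∑ E : Est g r, estAmp flip x E = 1 := by
  simp only [estAmp]
  rw [← Fintype.prod_sum fun (_ : Fin g) (b : Bits r) => ampFlip flip x b]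
  simp [sum_ampFlip]

lemma norm_estAmp_sq (flip : Bool) (x : ℝ) (E : Est g r) :
    ‖estAmp flip x E‖ ^ 2 = ∏ i, ‖amp x (E i)‖ ^ 2 := by
  rw [estAmp, norm_prod, Finset.prod_pow]
  simp only [norm_ampFlip]

open Complex in
/-- The outcome probabilities of phase estimation add up to one. -/
lemma sum_norm_amp_sq (x : ℝ) : ∑ b : Bits r, ‖amp x b‖ ^ 2 = 1 := by
  -- the amplitudes are the image of a unit vector under the inverse Fourier transform
  set u : Bits r → ℂ := fun k => exp (2 * Real.pi * I * (k.val * x) / 2 ^ r) /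
    ((Real.sqrt (2 ^ r) : ℝ) : ℂ) with hu
  have hs : ((Real.sqrt (2 ^ r) : ℝ) : ℂ) * (Real.sqrt (2 ^ r) : ℝ) = 2 ^ r := by
    rw [← Complex.ofReal_mul, Real.mul_self_sqrt (by positivity)]
    push_cast
    rfl
  have hamp : (fun b => amp x b) = (qft r)ᴴ *ᵥ u := by
    funext b
    rw [amp, Finset.sum_div, Matrix.mulVec, dotProduct]
    refine Finset.sum_congr rfl fun k _ => ?_
    rw [hu, Matrix.conjTranspose_apply, qft, Complex.star_def, map_div₀, Complex.conj_ofReal,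
      div_mul_div_comm, hs, ← Complex.exp_conj, ← Complex.exp_add]
    congr 2
    simp only [map_div₀, map_mul, Complex.conj_ofReal, Complex.conj_I, map_ofNat, map_pow,
      Complex.conj_natCast]
    push_cast
    ring
  have hdot : star (fun b : Bits r => amp x b) ⬝ᵥ (fun b : Bits r => amp x b) = star u ⬝ᵥ u := by
    rw [hamp, Matrix.star_mulVec, Matrix.conjTranspose_conjTranspose, ← Matrix.dotProduct_mulVec,
      Matrix.mulVec_mulVec, qft_mul_conjTranspose_self, Matrix.one_mulVec]
  have hnorm : ∀ w : Bits r → ℂ, star w ⬝ᵥ w = ((∑ b, ‖w b‖ ^ 2 : ℝ) : ℂ) := fun w => by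
    rw [dotProduct]
    push_cast
    refine Finset.sum_congr rfl fun b _ => ?_
    rw [Pi.star_apply, Complex.star_def, Complex.conj_mul']
  rw [hnorm, hnorm] at hdot
  have h := Complex.ofReal_injective hdot
  rw [h]
  have hu1 : ∀ k, ‖u k‖ ^ 2 = 1 / 2 ^ r := fun k => by
    have e : 2 * Real.pi * I * (k.val * x) / 2 ^ r =
        ((2 * Real.pi * (k.val * x) / 2 ^ r : ℝ) : ℂ) * I := by
      push_cast
      ring
    rw [hu]
    simp only
    rw [norm_div, e, Complex.norm_exp_ofReal_mul_I, Complex.norm_real,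
      Real.norm_of_nonneg (Real.sqrt_nonneg _), div_pow, Real.sq_sqrt (by positivity), one_pow]
  simp only [hu1]
  rw [Bits.sum_val fun _ => (1 / 2 ^ r : ℝ)]
  simp

lemma sum_norm_estAmp_sq (flip : Bool) (x : ℝ) :
    ∑ E : Est g r, ‖estAmp flip x E‖ ^ 2 = 1 := by
  simp only [norm_estAmp_sq]
  rw [← Fintype.prod_sum fun (_ : Fin g) (b : Bits r) => ‖amp x b‖ ^ 2]
  simp [sum_norm_amp_sq]

end PhaseEstimation

/-! ### Concentration of the median estimate -/

section Concentration

variable {g r : ℕ}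

/-- The trigonometric inequality behind the success probability `8 / π² > 4 / 5` of phase
estimation. -/
lemma sin_sq_bound_of_le_half {θ : ℝ} (h0 : 0 < θ) (h1 : θ ≤ 1 / 2) :
    4 / 5 * Real.pi ^ 2 ≤ Real.sin (Real.pi * θ) ^ 2 * (1 / θ ^ 2 + 1 / (1 - θ) ^ 2) := by
  have hpi := Real.pi_gt_three
  have hpi' := Real.pi_lt_d4
  have hpp : Real.pi ^ 2 < 9.8699 := by nlinarith
  have hp0 : 0 < Real.pi := Real.pi_pos
  rcases le_total θ (1 / 5) with h | h
  · -- near `0`, the first term suffices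
    have hx0 : 0 < Real.pi * θ := by positivity
    have hs := Real.sin_gt_sub_cube hx0
    have hθ2 : θ ^ 2 ≤ 1 / 25 := by nlinarith
    have hy : (Real.pi * θ) ^ 2 ≤ 0.3948 := by
      rw [mul_pow]
      nlinarith [sq_nonneg θ]
    have h2 : Real.pi * θ * 0.9013 ≤ Real.sin (Real.pi * θ) := by nlinarith
    have h3 : (Real.pi * θ * 0.9013) ^ 2 ≤ Real.sin (Real.pi * θ) ^ 2 :=
      pow_le_pow_left₀ (by positivity) h2 2
    calc 4 / 5 * Real.pi ^ 2 ≤ (Real.pi * θ * 0.9013) ^ 2 * (1 / θ ^ 2 + 0) := by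
          have : (Real.pi * θ * 0.9013) ^ 2 * (1 / θ ^ 2 + 0) = Real.pi ^ 2 * 0.9013 ^ 2 := by
            field_simp
            ring
          rw [this]
          nlinarith [sq_nonneg Real.pi]
      _ ≤ _ := by
        gcongr
        positivity
  · -- near `1/2`, write `θ = 1/2 - u` and `sin (π θ) = cos (π u)`
    obtain ⟨u, rfl⟩ : ∃ u, θ = 1 / 2 - u := ⟨1 / 2 - θ, by ring⟩
    have hu0 : 0 ≤ u := by linarith
    have hu1 : u ≤ 3 / 10 := by linarith
    have e1 : Real.sin (Real.pi * (1 / 2 - u)) = Real.cos (Real.pi * u) := by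
      rw [mul_sub, mul_one_div, Real.sin_pi_div_two_sub]
    rw [e1]
    have hc := Real.one_sub_sq_div_two_le_cos (x := Real.pi * u)
    obtain ⟨y, hy⟩ : ∃ y, y = 4 * u ^ 2 := ⟨_, rfl⟩
    have hy0 : 0 ≤ y := by rw [hy]; positivity
    have hy1 : y ≤ 9 / 25 := by rw [hy]; nlinarith
    have hc2 : 1 - 1.23374 * y ≤ Real.cos (Real.pi * u) := by
      rw [mul_pow] at hc
      have hu2 : 0 ≤ u ^ 2 := sq_nonneg u
      nlinarith
    have hc3 : (1 - 1.23374 * y) ^ 2 ≤ Real.cos (Real.pi * u) ^ 2 :=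
      pow_le_pow_left₀ (by linarith) hc2 2
    have e2 : 1 / (1 / 2 - u) ^ 2 + 1 / (1 - (1 / 2 - u)) ^ 2 = 8 * (1 + y) / (1 - y) ^ 2 := by
      have a1 : (1 / 2 - u) ≠ 0 := by linarith
      have a2 : (1 - (1 / 2 - u)) ≠ 0 := by linarith
      have a3 : 1 - y ≠ 0 := by linarith
      rw [div_add_div _ _ (pow_ne_zero 2 a1) (pow_ne_zero 2 a2),
        div_eq_div_iff (mul_ne_zero (pow_ne_zero 2 a1) (pow_ne_zero 2 a2)) (pow_ne_zero 2 a3), hy]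
      ring
    rw [e2, mul_div_assoc', le_div_iff₀ (by nlinarith)]
    have hq : 0 ≤ (1 - y) ^ 2 := sq_nonneg _
    have hm : (1 - 1.23374 * y) ^ 2 * (8 * (1 + y)) ≤
        Real.cos (Real.pi * u) ^ 2 * (8 * (1 + y)) := by gcongr
    have hpoly : 0.98699 * (1 - y) ^ 2 ≤ (1 - 1.23374 * y) ^ 2 * (1 + y) := by
      nlinarith [mul_nonneg hy0 (sub_nonneg.2 hy1), mul_nonneg (mul_nonneg hy0 hy0)
        (sub_nonneg.2 hy1), sq_nonneg y]
    nlinarith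

lemma sin_sq_bound {θ : ℝ} (h0 : 0 < θ) (h1 : θ < 1) :
    4 / 5 * Real.pi ^ 2 ≤ Real.sin (Real.pi * θ) ^ 2 * (1 / θ ^ 2 + 1 / (1 - θ) ^ 2) := by
  rcases le_total θ (1 / 2) with h | h
  · exact sin_sq_bound_of_le_half h0 h
  · have := sin_sq_bound_of_le_half (θ := 1 - θ) (by linarith) (by linarith)
    have e : Real.sin (Real.pi * (1 - θ)) = Real.sin (Real.pi * θ) := by
      rw [mul_sub, mul_one, Real.sin_pi_sub]
    rw [e, sub_sub_cancel, add_comm (1 / (1 - θ) ^ 2)] at this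
    exact this

open Complex in
/-- The geometric sum for the amplitude, with the sine in the denominator estimated by its
argument. -/
lemma norm_amp_sq_ge {x : ℝ} {b : Bits r} (hx : ∀ m : ℤ, x ≠ m) :
    Real.sin (Real.pi * (x - b.val)) ^ 2 / (Real.pi ^ 2 * (x - b.val) ^ 2) ≤ ‖amp x b‖ ^ 2 := by
  have hN : (0 : ℝ) < 2 ^ r := by positivity
  have hNc : (2 : ℂ) ^ r ≠ 0 := by positivity
  have hxb : x - b.val ≠ 0 := fun h => hx b.val (by push_cast; linarith)
  set φ : ℝ := 2 * Real.pi * (x - b.val) / 2 ^ r with hφ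
  have hφ0 : φ ≠ 0 := by
    rw [hφ]
    have := Real.pi_ne_zero
    positivity
  set z := exp (I * φ) with hz
  have hk : ∀ k : Bits r, exp (2 * Real.pi * I * (k.val * ((x : ℂ) - b.val)) / 2 ^ r) =
      z ^ k.val := fun k => by
    rw [hz, ← Complex.exp_nat_mul, hφ]
    congr 1
    push_cast
    ring
  have hzN : z ^ 2 ^ r = exp (I * ((2 * Real.pi * (x - b.val) : ℝ) : ℂ)) := by
    rw [hz, ← Complex.exp_nat_mul, hφ]
    congr 1
    push_cast
    field_simp
  have hsin : Real.sin (Real.pi * (x - b.val)) ≠ 0 := by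
    intro h
    obtain ⟨m, hm⟩ := Real.sin_eq_zero_iff.1 h
    have : x - b.val = m := by
      have := mul_left_cancel₀ Real.pi_ne_zero ((mul_comm _ _).trans hm)
      exact this.symm
    exact hx (m + b.val) (by push_cast; linarith)
  have hnum : ‖z ^ 2 ^ r - 1‖ = 2 * |Real.sin (Real.pi * (x - b.val))| := by
    rw [hzN, Complex.norm_exp_I_mul_ofReal_sub_one, Real.norm_eq_abs, abs_mul, abs_two]
    congr 3
    ring
  have hz1 : z ≠ 1 := fun h => by
    rw [h, one_pow, sub_self, norm_zero] at hnum
    have := abs_pos.2 hsin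
    linarith
  have hden : ‖z - 1‖ ≤ |φ| := by
    rw [hz, Complex.norm_exp_I_mul_ofReal_sub_one, Real.norm_eq_abs, abs_mul, abs_two]
    have := Real.abs_sin_le_abs (x := φ / 2)
    rw [abs_div, abs_two] at this
    linarith
  have hden0 : 0 < ‖z - 1‖ := norm_pos_iff.2 (sub_ne_zero.2 hz1)
  have hnorm : ‖amp x b‖ = 2 * |Real.sin (Real.pi * (x - b.val))| / ‖z - 1‖ / 2 ^ r := by
    rw [amp]
    simp only [hk]
    rw [Bits.sum_val fun k => z ^ k, geom_sum_eq hz1, norm_div, norm_div, hnum]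
    simp
  have hφa : |φ| * 2 ^ r = 2 * (Real.pi * |x - b.val|) := by
    rw [hφ, abs_div, abs_mul, abs_mul, abs_two, abs_of_pos Real.pi_pos, abs_of_pos hN,
      div_mul_cancel₀ _ hN.ne']
    ring
  have hle : |Real.sin (Real.pi * (x - b.val))| / (Real.pi * |x - b.val|) ≤ ‖amp x b‖ := by
    have hpos : 0 < Real.pi * |x - b.val| := mul_pos Real.pi_pos (abs_pos.2 hxb)
    rw [hnorm, div_div, div_le_div_iff₀ hpos (by positivity)]
    have : ‖z - 1‖ * 2 ^ r ≤ 2 * (Real.pi * |x - b.val|) := by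
      rw [← hφa]
      gcongr
    nlinarith [abs_nonneg (Real.sin (Real.pi * (x - b.val)))]
  calc _ = (|Real.sin (Real.pi * (x - b.val))| / (Real.pi * |x - b.val|)) ^ 2 := by
        rw [div_pow, mul_pow, sq_abs, sq_abs]
    _ ≤ _ := pow_le_pow_left₀ (by positivity) hle 2

open Complex in
lemma amp_self (b : Bits r) : amp (b.val : ℝ) b = 1 := by
  rw [amp]
  simp only [ofReal_natCast, sub_self, mul_zero, zero_div, exp_zero]
  rw [Bits.sum_val fun _ => (1 : ℂ)]
  simp

/-- An outcome within one grid point of the exact phase. -/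
def Near (x : ℝ) (m : ℕ) : Prop := |(m : ℝ) - x| ≤ 1

open Classical in
/-- One run of phase estimation returns a neighbouring grid point with probability at least
`4 / 5`. -/
lemma success_probability {x : ℝ} (h0 : 0 ≤ x) (h1 : x ≤ 2 ^ r - 1) :
    4 / 5 ≤ ∑ b : Bits r, if ⌊x⌋₊ ≤ b.val ∧ b.val ≤ ⌈x⌉₊ then ‖amp x b‖ ^ 2 else 0 := by
  have hfl : ⌊x⌋₊ < 2 ^ r := by
    have : (⌊x⌋₊ : ℝ) < 2 ^ r := (Nat.floor_le h0).trans_lt (by linarith)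
    exact_mod_cast this
  obtain ⟨b, hb⟩ := Bits.exists_val hfl
  have hnn : ∀ c : Bits r,
      0 ≤ if ⌊x⌋₊ ≤ c.val ∧ c.val ≤ ⌈x⌉₊ then ‖amp x c‖ ^ 2 else 0 := fun c => by
    split_ifs
    · positivity
    · exact le_rfl
  by_cases hint : ∃ m : ℤ, x = m
  · obtain ⟨m, hm⟩ := hint
    have hxb : x = b.val := by
      have hm0 : 0 ≤ m := by rw [hm] at h0; exact_mod_cast h0
      lift m to ℕ using hm0
      have hx : x = (m : ℝ) := by rw [hm]; push_cast; rfl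
      rw [hb, hx, Nat.floor_natCast]
    have hle := Finset.single_le_sum (fun c _ => hnn c) (Finset.mem_univ b)
    refine le_trans ?_ hle
    rw [if_pos ⟨hb.ge, hb.le.trans (Nat.floor_le_ceil x)⟩]
    conv_rhs => rw [hxb]
    rw [amp_self]
    norm_num
  · have hx : ∀ m : ℤ, x ≠ m := fun m hm => hint ⟨m, hm⟩
    have hfloor : (⌊x⌋₊ : ℝ) < x :=
      lt_of_le_of_ne (Nat.floor_le h0) fun h => hx ⌊x⌋₊ (by rw [← h]; simp)
    have hlt := Nat.lt_floor_add_one x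
    have hc : ⌊x⌋₊ + 1 < 2 ^ r := by
      have : ((⌊x⌋₊ + 1 : ℕ) : ℝ) < 2 ^ r := by push_cast; linarith
      exact_mod_cast this
    obtain ⟨c, hcv⟩ := Bits.exists_val hc
    have hbc : b ≠ c := fun h => by rw [h] at hb; omega
    have hceil : ⌊x⌋₊ + 1 ≤ ⌈x⌉₊ := by
      rw [Nat.succ_le_iff, Nat.lt_ceil]
      exact hfloor
    obtain ⟨θ, hθ⟩ : ∃ θ, θ = x - b.val := ⟨_, rfl⟩
    have hθ0 : 0 < θ := by rw [hθ, hb]; linarith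
    have hθ1 : θ < 1 := by rw [hθ, hb]; linarith
    have hxc : x - c.val = θ - 1 := by rw [hθ, hb, hcv]; push_cast; ring
    have a1 := norm_amp_sq_ge (b := b) hx
    have a2 := norm_amp_sq_ge (b := c) hx
    rw [← hθ] at a1
    have hs : Real.sin (Real.pi * (θ - 1)) ^ 2 = Real.sin (Real.pi * θ) ^ 2 := by
      rw [mul_sub, mul_one, Real.sin_sub_pi, neg_sq]
    rw [hxc, hs] at a2
    have key := sin_sq_bound hθ0 hθ1
    have hsum : ‖amp x b‖ ^ 2 + ‖amp x c‖ ^ 2 ≤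
        ∑ b : Bits r, if ⌊x⌋₊ ≤ b.val ∧ b.val ≤ ⌈x⌉₊ then ‖amp x b‖ ^ 2 else 0 := by
      have := Finset.sum_le_univ_sum_of_nonneg (s := {b, c}) hnn
      rw [Finset.sum_pair hbc, if_pos ⟨hb.ge, hb.le.trans (Nat.floor_le_ceil x)⟩,
        if_pos ⟨by omega, by omega⟩] at this
      exact this
    refine le_trans ?_ ((add_le_add a1 a2).trans hsum)
    have hpp : 0 < Real.pi ^ 2 := by have := Real.pi_pos; positivity
    have e : Real.sin (Real.pi * θ) ^ 2 / (Real.pi ^ 2 * θ ^ 2) +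
        Real.sin (Real.pi * θ) ^ 2 / (Real.pi ^ 2 * (θ - 1) ^ 2) =
        (Real.sin (Real.pi * θ) ^ 2 * (1 / θ ^ 2 + 1 / (1 - θ) ^ 2)) / Real.pi ^ 2 := by
      have : (θ - 1) ^ 2 = (1 - θ) ^ 2 := by ring
      rw [this]
      have : 1 - θ ≠ 0 := by linarith
      have : Real.pi ≠ 0 := Real.pi_ne_zero
      field_simp
    rw [e, le_div_iff₀ hpp]
    exact key

open Classical in
/-- If the median is off, then at least half of the entries are off. -/
lemma median_near_or {x : ℝ} (h0 : 0 ≤ x) (E : Est g r) :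
    Near x (median E) ∨ g ≤ 2 * (Finset.univ.filter fun i : Fin g =>
      ¬ (⌊x⌋₊ ≤ (E i).val ∧ (E i).val ≤ ⌈x⌉₊)).card := by
  set s : Set ℕ := {v : ℕ | g ≤ 2 * (Finset.univ.filter fun i : Fin g => (E i).val ≤ v).card}
    with hs
  have hne : s.Nonempty := ⟨2 ^ r, by
    have : (Finset.univ.filter fun i : Fin g => (E i).val ≤ 2 ^ r) = Finset.univ :=
      Finset.filter_true_of_mem fun i _ => (E i).val_lt.le
    rw [hs, Set.mem_ofPred_eq, this, Finset.card_univ, Fintype.card_fin]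
    omega⟩
  have hmem : g ≤ 2 * (Finset.univ.filter fun i : Fin g => (E i).val ≤ median E).card :=
    Nat.sInf_mem hne
  rcases lt_or_ge (median E) ⌊x⌋₊ with hlo | hlo
  · right
    refine hmem.trans (Nat.mul_le_mul_left 2 (Finset.card_le_card fun i hi => ?_))
    simp only [Finset.mem_filter, Finset.mem_univ, true_and] at hi ⊢
    omega
  rcases lt_or_ge ⌈x⌉₊ (median E) with hhi | hhi
  · right
    have hnot : ¬ g ≤ 2 * (Finset.univ.filter fun i : Fin g => (E i).val ≤ ⌈x⌉₊).card := by
      have hhi' : ⌈x⌉₊ < sInf s := hhi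
      have h := Nat.notMem_of_lt_sInf hhi'
      rwa [hs, Set.mem_ofPred_eq] at h
    have hcard := Finset.card_filter_add_card_filter_not (s := (Finset.univ : Finset (Fin g)))
      (fun i => (E i).val ≤ ⌈x⌉₊)
    rw [Finset.card_univ, Fintype.card_fin] at hcard
    have hsub : (Finset.univ.filter fun i : Fin g => ¬ (E i).val ≤ ⌈x⌉₊).card ≤
        (Finset.univ.filter fun i : Fin g =>
          ¬ (⌊x⌋₊ ≤ (E i).val ∧ (E i).val ≤ ⌈x⌉₊)).card := by
      refine Finset.card_le_card fun i hi => ?_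
      simp only [Finset.mem_filter, Finset.mem_univ, true_and] at hi ⊢
      omega
    omega
  · left
    have e1 : (⌊x⌋₊ : ℝ) ≤ median E := by exact_mod_cast hlo
    have e2 : (median E : ℝ) ≤ ⌈x⌉₊ := by exact_mod_cast hhi
    have e3 := Nat.lt_floor_add_one x
    have e4 := Nat.ceil_lt_add_one h0
    exact abs_le.2 ⟨by linarith, by linarith⟩

open Classical in
/-- Chernoff bound for the median of `g` runs. -/
lemma median_tail (flip : Bool) {x : ℝ} (h0 : 0 ≤ x) (h1 : x ≤ 2 ^ r - 1) :
    ∑ E : Est g r, (if Near x (median E) then 0 else ‖estAmp flip x E‖ ^ 2) ≤ (4 / 5) ^ g := by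
  set good : Bits r → Prop := fun b => ⌊x⌋₊ ≤ b.val ∧ b.val ≤ ⌈x⌉₊ with hgood
  -- the exponential weight `4 ^ (number of failures) / 2 ^ g` is at least `1` on bad outcomes
  set w : Bits r → ℝ := fun b => ‖amp x b‖ ^ 2 * (if good b then 1 else 4) with hw
  have hterm : ∀ E : Est g r, (if Near x (median E) then 0 else ‖estAmp flip x E‖ ^ 2) ≤
      (∏ i, w (E i)) / 2 ^ g := fun E => by
    split_ifs with hE
    · have : ∀ i, 0 ≤ w (E i) := fun i => by
        rw [hw]
        simp only
        split_ifs <;> positivity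
      exact div_nonneg (Finset.prod_nonneg fun i _ => this i) (by positivity)
    · have hcard := (median_near_or h0 E).resolve_left hE
      rw [norm_estAmp_sq]
      simp only [hw]
      rw [Finset.prod_mul_distrib, Finset.prod_ite, Finset.prod_const_one, one_mul,
        Finset.prod_const, le_div_iff₀ (by positivity)]
      refine mul_le_mul_of_nonneg_left ?_ (Finset.prod_nonneg fun i _ => by positivity)
      calc (2 : ℝ) ^ g ≤ 2 ^ (2 * (Finset.univ.filter fun i : Fin g => ¬ good (E i)).card) :=
            pow_le_pow_right₀ (by norm_num) hcard
        _ = _ := by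
          rw [pow_mul]
          norm_num
  refine (Finset.sum_le_sum fun E _ => hterm E).trans ?_
  rw [← Finset.sum_div, ← Fintype.prod_sum fun (_ : Fin g) (b : Bits r) => w b,
    Finset.prod_const, Finset.card_univ, Fintype.card_fin, ← div_pow]
  have hsum : ∑ b, w b ≤ 8 / 5 := by
    have hs := success_probability h0 h1
    have ht := sum_norm_amp_sq (r := r) x
    have e : ∑ b, w b = 4 * ∑ b : Bits r, ‖amp x b‖ ^ 2 -
        3 * ∑ b : Bits r, if ⌊x⌋₊ ≤ b.val ∧ b.val ≤ ⌈x⌉₊ then ‖amp x b‖ ^ 2 else 0 := by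
      rw [Finset.mul_sum, Finset.mul_sum, ← Finset.sum_sub_distrib]
      refine Finset.sum_congr rfl fun b _ => ?_
      simp only [hw, hgood]
      split_ifs <;> ring
    rw [e, ht]
    linarith
  have hnn : 0 ≤ ∑ b, w b := Finset.sum_nonneg fun b _ => by
    rw [hw]
    simp only
    split_ifs <;> positivity
  refine pow_le_pow_left₀ (by positivity) ?_ g
  linarith

end Concentration

/-! ### The Gibbs state is almost stationary -/

section CauchySchwarz

variable {n : ℕ}

/-- The square of the Hilbert–Schmidt norm. -/
def hsNormSq (A : Op n) : ℝ := ∑ j, ∑ p, ‖A j p‖ ^ 2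

lemma hsNormSq_nonneg (A : Op n) : 0 ≤ hsNormSq A :=
  Finset.sum_nonneg fun _ _ => Finset.sum_nonneg fun _ _ => by positivity

lemma trace_mul_conjTranspose_re (A : Op n) : (A * Aᴴ).trace.re = hsNormSq A := by
  rw [Matrix.trace, Complex.re_sum, hsNormSq]
  refine Finset.sum_congr rfl fun j _ => ?_
  rw [Matrix.diag_apply, Matrix.mul_apply, Complex.re_sum]
  refine Finset.sum_congr rfl fun p _ => ?_
  rw [Matrix.conjTranspose_apply, Complex.star_def, Complex.mul_conj', ← Complex.ofReal_pow,
    Complex.ofReal_re]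

lemma hsNormSq_parallelogram (A B : Op n) :
    hsNormSq (A + B) + hsNormSq (A - B) = 2 * hsNormSq A + 2 * hsNormSq B := by
  simp only [hsNormSq, Finset.mul_sum, ← Finset.sum_add_distrib]
  refine Finset.sum_congr rfl fun j _ => Finset.sum_congr rfl fun p _ => ?_
  have := parallelogram_law_with_norm ℝ (A j p) (B j p)
  simp only [Matrix.add_apply, Matrix.sub_apply]
  linarith

lemma hsNormSq_smul (t : ℝ) (A : Op n) : hsNormSq (t • A) = t ^ 2 * hsNormSq A := by
  simp only [hsNormSq, Finset.mul_sum]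
  refine Finset.sum_congr rfl fun j _ => Finset.sum_congr rfl fun p _ => ?_
  rw [Matrix.smul_apply, norm_smul, mul_pow, Real.norm_eq_abs, sq_abs]

/-- A Cauchy–Schwarz inequality for the trace norm. By polarization, the operator on the left is
half the difference of `∑ₖ (tAₖ + t⁻¹Bₖ)(tAₖ + t⁻¹Bₖ)†` and `∑ₖ (tAₖ - t⁻¹Bₖ)(tAₖ - t⁻¹Bₖ)†`. -/
lemma traceNorm_sum_mul_conjTranspose_le {ι : Type*} [Fintype ι] (w : ι → ℝ) (A B : ι → Op n)
    (hw : ∀ k, 0 ≤ w k) {x y : ℝ} (hx : 0 < x) (hy : 0 < y)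
    (hA : ∑ k, w k * hsNormSq (A k) ≤ x ^ 2) (hB : ∑ k, w k * hsNormSq (B k) ≤ y ^ 2) :
    traceNorm (∑ k, w k • (A k * (B k)ᴴ + B k * (A k)ᴴ)) ≤ 2 * (x * y) := by
  obtain ⟨t, ht, ht2⟩ : ∃ t : ℝ, 0 < t ∧ t ^ 2 = y / x :=
    ⟨Real.sqrt (y / x), Real.sqrt_pos.2 (by positivity), Real.sq_sqrt (by positivity)⟩
  set P : Op n := ∑ k, (w k / 2) • ((t • A k + t⁻¹ • B k) * (t • A k + t⁻¹ • B k)ᴴ) with hP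
  set N : Op n := ∑ k, (w k / 2) • ((t • A k - t⁻¹ • B k) * (t • A k - t⁻¹ • B k)ᴴ) with hN
  have hpsd : ∀ Z : ι → Op n, (∑ k, (w k / 2) • (Z k * (Z k)ᴴ)).PosSemidef := fun Z =>
    Matrix.posSemidef_sum _ fun k _ =>
      (Matrix.posSemidef_self_mul_conjTranspose (Z k)).smul (by have := hw k; positivity)
  have htr : ∀ Z : ι → Op n, (∑ k, (w k / 2) • (Z k * (Z k)ᴴ)).trace.re =
      ∑ k, w k / 2 * hsNormSq (Z k) := fun Z => by
    rw [Matrix.trace_sum, Complex.re_sum]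
    refine Finset.sum_congr rfl fun k _ => ?_
    rw [Matrix.trace_smul, Complex.smul_re, trace_mul_conjTranspose_re, smul_eq_mul]
  have e : ∑ k, w k • (A k * (B k)ᴴ + B k * (A k)ᴴ) = P - N := by
    rw [hP, hN, ← Finset.sum_sub_distrib]
    refine Finset.sum_congr rfl fun k _ => ?_
    rw [← smul_sub]
    simp only [Matrix.conjTranspose_add, Matrix.conjTranspose_sub, Matrix.conjTranspose_smul,
      star_trivial, Matrix.add_mul, Matrix.sub_mul, Matrix.mul_add, Matrix.mul_sub,
      Matrix.smul_mul, Matrix.mul_smul]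
    match_scalars <;> field_simp <;> ring
  rw [e]
  refine (traceNorm_sub_le (hpsd _) (hpsd _)).trans ?_
  rw [htr, htr, ← Finset.sum_add_distrib]
  have e2 : ∀ k, w k / 2 * hsNormSq (t • A k + t⁻¹ • B k) +
      w k / 2 * hsNormSq (t • A k - t⁻¹ • B k) =
      y / x * (w k * hsNormSq (A k)) + x / y * (w k * hsNormSq (B k)) := fun k => by
    have := hsNormSq_parallelogram (t • A k) (t⁻¹ • B k)
    rw [hsNormSq_smul, hsNormSq_smul, inv_pow, ht2, inv_div] at this
    linear_combination w k / 2 * this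
  simp only [e2]
  rw [Finset.sum_add_distrib, ← Finset.mul_sum, ← Finset.mul_sum]
  calc _ ≤ y / x * x ^ 2 + x / y * y ^ 2 := by gcongr
    _ = _ := by field_simp; ring

lemma traceNorm_conj_le {V M : Op n} (h2 : Vᴴ * V = 1) (hM : M.IsHermitian) :
    traceNorm (V * M * Vᴴ) ≤ traceNorm M := by
  obtain ⟨P, N, hP, hN, rfl, hn⟩ := exists_posPart_negPart hM
  have h := traceNorm_sub_le (hP.mul_mul_conjTranspose_same V) (hN.mul_mul_conjTranspose_same V)
  rw [hn, Matrix.mul_sub, Matrix.sub_mul]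
  have ht : ∀ Z : Op n, (V * Z * Vᴴ).trace = Z.trace := fun Z => by
    rw [Matrix.trace_mul_cycle, h2, Matrix.one_mul]
  rwa [ht, ht] at h

end CauchySchwarz

section DetailedBalance

variable {n : ℕ} {ι : Type*} [Fintype ι]

lemma diagonal_mul_mul_diagonal_apply (u v : Sys n → ℂ) (C : Op n) (j p : Sys n) :
    (Matrix.diagonal u * C * Matrix.diagonal v) j p = u j * C j p * v p := by
  rw [Matrix.mul_diagonal, Matrix.diagonal_mul]

lemma sum_norm_sq_row {C : Op n} (hC : C * Cᴴ = 1) (j : Sys n) : ∑ p, ‖C j p‖ ^ 2 = 1 := by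
  have h := congrFun (congrFun hC j) j
  rw [Matrix.mul_apply, Matrix.one_apply_eq] at h
  have h' := congrArg Complex.re h
  rw [Complex.re_sum, Complex.one_re] at h'
  rw [← h']
  refine Finset.sum_congr rfl fun p _ => ?_
  rw [Matrix.conjTranspose_apply, Complex.star_def, Complex.mul_conj', ← Complex.ofReal_pow,
    Complex.ofReal_re]

lemma sum_norm_sq_column {C : Op n} (hC : Cᴴ * C = 1) (p : Sys n) : ∑ j, ‖C j p‖ ^ 2 = 1 := by
  have h := sum_norm_sq_row (C := Cᴴ) (by rwa [Matrix.conjTranspose_conjTranspose]) p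
  simpa using h

/-- A weighted sum over pairs of estimates `(E, E')` of squared entries dominated by those of
`q_{E'}(j) C_{jp} q_E(p)`, where `ν` marks the unlikely estimates. -/
lemma sum_mul_hsNormSq_le {C : Op n} {q : ι → Sys n → ℂ} {ν : ι → Sys n → ℝ} {δ c c' W : ℝ}
    {w : Sys n → Sys n → ℝ} (f : ι × ι → ℝ) (hf1 : ∀ k, f k ≤ 1) (Z : ι × ι → Op n)
    (hq : ∀ p, ∑ E, ‖q E p‖ ^ 2 = 1) (hν : ∀ p, ∑ E, ν E p * ‖q E p‖ ^ 2 ≤ δ)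
    (hc : 0 ≤ c + c' * (2 * δ)) (hc' : 0 ≤ c') (hw : ∀ j p, 0 ≤ w j p)
    (hW : ∑ j, ∑ p, w j p * ‖C j p‖ ^ 2 ≤ W)
    (hZ : ∀ k j p, ‖Z k j p‖ ^ 2 ≤ (c + c' * (ν k.2 j + ν k.1 p)) * (w j p *
      (‖q k.2 j‖ ^ 2 * ‖C j p‖ ^ 2 * ‖q k.1 p‖ ^ 2))) :
    ∑ k, f k * hsNormSq (Z k) ≤ (c + c' * (2 * δ)) * W := by
  have hin : ∀ j p, ∑ E, ∑ E', (c + c' * (ν E' j + ν E p)) * (‖q E' j‖ ^ 2 * ‖q E p‖ ^ 2) ≤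
      c + c' * (2 * δ) := fun j p => by
    have e : ∑ E, ∑ E', (c + c' * (ν E' j + ν E p)) * (‖q E' j‖ ^ 2 * ‖q E p‖ ^ 2) =
        c * ((∑ E, ‖q E p‖ ^ 2) * ∑ E', ‖q E' j‖ ^ 2) +
        c' * ((∑ E, ‖q E p‖ ^ 2) * (∑ E', ν E' j * ‖q E' j‖ ^ 2) +
          (∑ E, ν E p * ‖q E p‖ ^ 2) * ∑ E', ‖q E' j‖ ^ 2) := by
      rw [Finset.sum_mul_sum, Finset.sum_mul_sum, Finset.sum_mul_sum]
      simp only [Finset.mul_sum, ← Finset.sum_add_distrib]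
      refine Finset.sum_congr rfl fun E _ => Finset.sum_congr rfl fun E' _ => ?_
      ring
    rw [e, hq, hq]
    have := mul_le_mul_of_nonneg_left (add_le_add (hν j) (hν p)) hc'
    linarith
  calc ∑ k, f k * hsNormSq (Z k) ≤ ∑ k, hsNormSq (Z k) :=
        Finset.sum_le_sum fun k _ => mul_le_of_le_one_left (hsNormSq_nonneg _) (hf1 k)
    _ = ∑ j, ∑ p, ∑ k, ‖Z k j p‖ ^ 2 := by
        simp only [hsNormSq]
        rw [Finset.sum_comm]
        refine Finset.sum_congr rfl fun j _ => ?_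
        rw [Finset.sum_comm]
    _ ≤ ∑ j, ∑ p, (c + c' * (2 * δ)) * (w j p * ‖C j p‖ ^ 2) := by
        refine Finset.sum_le_sum fun j _ => Finset.sum_le_sum fun p _ => ?_
        have hn : 0 ≤ w j p * ‖C j p‖ ^ 2 := mul_nonneg (hw j p) (by positivity)
        refine le_trans ?_ (mul_le_mul_of_nonneg_right (hin j p) hn)
        rw [Fintype.sum_prod_type, Finset.sum_mul]
        refine Finset.sum_le_sum fun E _ => ?_
        rw [Finset.sum_mul]
        refine Finset.sum_le_sum fun E' _ => (hZ (E, E') j p).trans (le_of_eq ?_)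
        ring
    _ ≤ _ := by
        simp only [← Finset.mul_sum]
        exact mul_le_mul_of_nonneg_left hW hc

open Classical in
/-- Quantitative detailed balance in the eigenbasis of the stationary weights `π`. If the estimates
were exact, then `f_{EE'} π_p = f'_{EE'} π_j` for all entries `(j, p)` that contribute, and the
operator would vanish; here this holds up to a factor `e` that is close to `1` on good
estimates, while bad estimates are unlikely. -/
lemma traceNorm_detailedBalance_le {C : Op n} (h1 : Cᴴ * C = 1) (h2 : C * Cᴴ = 1)
    {q : ι → Sys n → ℂ} {good : ι → Sys n → Prop} {π : Sys n → ℝ} {f f' : ι × ι → ℝ}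
    {e : ι × ι → Sys n → Sys n → ℝ} {δ η : ℝ}
    (hq : ∀ p, ∑ E, ‖q E p‖ ^ 2 = 1)
    (hgood : ∀ p, ∑ E, (if good E p then 0 else ‖q E p‖ ^ 2) ≤ δ) (hδ : 0 < δ) (hη : 0 < η)
    (hπ : ∀ p, 0 ≤ π p) (hπ1 : ∑ p, π p = 1)
    (hf : ∀ k, 0 ≤ f k) (hf1 : ∀ k, f k ≤ 1) (hf' : ∀ k, 0 ≤ f' k) (hf'1 : ∀ k, f' k ≤ 1)
    (he : ∀ k j p, f k * e k j p * π p = f' k * π j)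
    (heg : ∀ k j p, good k.2 j → good k.1 p → |1 - e k j p| ≤ η) :
    traceNorm (∑ k : ι × ι, (f k • ((2 : ℂ) •
        ((Matrix.diagonal (q k.2) * C * Matrix.diagonal (q k.1)) *
        Matrix.diagonal (fun i => (π i : ℂ)) *
        (Matrix.diagonal (q k.2) * C * Matrix.diagonal (q k.1))ᴴ)) -
      f' k • ((Matrix.diagonal (q k.2) * C * Matrix.diagonal (q k.1)) *
          (Matrix.diagonal (q k.2) * C * Matrix.diagonal (q k.1))ᴴ *
          Matrix.diagonal (fun i => (π i : ℂ)) +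
        Matrix.diagonal (fun i => (π i : ℂ)) *
          ((Matrix.diagonal (q k.2) * C * Matrix.diagonal (q k.1)) *
          (Matrix.diagonal (q k.2) * C * Matrix.diagonal (q k.1))ᴴ)))) ≤
      2 * η + 2 * Real.sqrt (2 * δ) * (1 + Real.sqrt (2 ^ n)) := by
  set B : ι × ι → Op n := fun k => Matrix.diagonal (q k.2) * C * Matrix.diagonal (q k.1) with hB
  have hBa : ∀ k j p, B k j p = q k.2 j * C j p * q k.1 p := fun k j p =>
    diagonal_mul_mul_diagonal_apply _ _ _ _ _
  set s : Sys n → ℝ := fun p => Real.sqrt (π p) with hs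
  have hs2 : ∀ p, s p ^ 2 = π p := fun p => Real.sq_sqrt (hπ p)
  set χ : ι × ι → Sys n → Sys n → ℝ := fun k j p => if good k.2 j ∧ good k.1 p then 1 else 0
    with hχ
  set ν : ι → Sys n → ℝ := fun E p => if good E p then 0 else 1 with hν
  have hχν : ∀ k j p, (1 - χ k j p) ^ 2 ≤ ν k.2 j + ν k.1 p := fun k j p => by
    simp only [hχ, hν]
    split_ifs <;> norm_num
    tauto
  have hνδ : ∀ p, ∑ E, ν E p * ‖q E p‖ ^ 2 ≤ δ := fun p => by
    refine le_trans (le_of_eq (Finset.sum_congr rfl fun E _ => ?_)) (hgood p)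
    simp only [hν]
    split_ifs <;> ring
  set G : ι × ι → Op n := fun k => Matrix.of fun j p => B k j p * s p with hG
  set Dg : ι × ι → Op n := fun k => Matrix.of fun j p =>
    ((χ k j p * (1 - e k j p) : ℝ) : ℂ) * (B k j p * s p) with hDg
  set Gb : ι × ι → Op n := fun k => Matrix.of fun j p =>
    ((1 - χ k j p : ℝ) : ℂ) * (B k j p * s p) with hGb
  set Bb : ι × ι → Op n := fun k => Matrix.of fun j p =>
    ((1 - χ k j p : ℝ) : ℂ) * (B k j p * π j) with hBb
  have hGa : ∀ k j p, G k j p = B k j p * s p := fun _ _ _ => rfl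
  have hDga : ∀ k j p, Dg k j p = ((χ k j p * (1 - e k j p) : ℝ) : ℂ) * (B k j p * s p) :=
    fun _ _ _ => rfl
  have hGba : ∀ k j p, Gb k j p = ((1 - χ k j p : ℝ) : ℂ) * (B k j p * s p) := fun _ _ _ => rfl
  have hBba : ∀ k j p, Bb k j p = ((1 - χ k j p : ℝ) : ℂ) * (B k j p * π j) := fun _ _ _ => rfl
  -- the operator splits into the error of the rates on good estimates (`Dg`) and two contributions
  -- of bad estimates (`Gb`, `Bb`)
  have key : ∑ k : ι × ι, (f k • ((2 : ℂ) • (B k * Matrix.diagonal (fun i => (π i : ℂ)) * (B k)ᴴ)) -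
      f' k • (B k * (B k)ᴴ * Matrix.diagonal (fun i => (π i : ℂ)) +
        Matrix.diagonal (fun i => (π i : ℂ)) * (B k * (B k)ᴴ))) =
      (∑ k, f k • (G k * (Dg k)ᴴ + Dg k * (G k)ᴴ) + ∑ k, f k • (G k * (Gb k)ᴴ + Gb k * (G k)ᴴ)) +
      (-1 : ℝ) • ∑ k, f' k • (B k * (Bb k)ᴴ + Bb k * (B k)ᴴ) := by
    rw [Finset.smul_sum, ← Finset.sum_add_distrib, ← Finset.sum_add_distrib]
    refine Finset.sum_congr rfl fun k _ => ?_
    ext j l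
    have e0 : (B k * (B k)ᴴ) j l = ∑ p, B k j p * star (B k l p) := Matrix.mul_apply
    have e1 : (B k * Matrix.diagonal (fun i => (π i : ℂ)) * (B k)ᴴ) j l =
        ∑ p, B k j p * π p * star (B k l p) := by
      rw [Matrix.mul_apply]
      simp only [Matrix.mul_diagonal, Matrix.conjTranspose_apply]
    simp only [Matrix.add_apply, Matrix.sub_apply, Matrix.smul_apply, e0, e1,
      Matrix.mul_diagonal, Matrix.diagonal_mul]
    simp only [Matrix.mul_apply, Matrix.conjTranspose_apply, smul_eq_mul,
      Complex.real_smul, hGa, hDga, hGba, hBba, Finset.mul_sum, Finset.sum_mul,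
      ← Finset.sum_add_distrib, ← Finset.sum_sub_distrib]
    refine Finset.sum_congr rfl fun p _ => ?_
    have a1 : ((s p : ℝ) : ℂ) ^ 2 = π p := by rw [← hs2]; push_cast; rfl
    have a2 : (f k : ℂ) * e k j p * π p = f' k * π j := by
      have := he k j p
      exact_mod_cast this
    have a3 : (f k : ℂ) * e k l p * π p = f' k * π l := by
      have := he k l p
      exact_mod_cast this
    simp only [star_mul', Complex.star_def, Complex.conj_ofReal]
    push_cast
    linear_combination (-(B k j p * (starRingEnd ℂ) (B k l p))) * (
      f k * ((1 - χ k l p * e k l p) + (1 - χ k j p * e k j p)) * a1 - χ k l p * a3 - χ k j p * a2)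
  have hherm : ∀ (u : ι × ι → ℝ) (X Y : ι × ι → Op n),
      (∑ k, u k • (X k * (Y k)ᴴ + Y k * (X k)ᴴ)).IsHermitian := fun u X Y => by
    rw [Matrix.IsHermitian, Matrix.conjTranspose_sum]
    refine Finset.sum_congr rfl fun k _ => ?_
    rw [Matrix.conjTranspose_smul, star_trivial, Matrix.conjTranspose_add,
      Matrix.conjTranspose_mul, Matrix.conjTranspose_mul, Matrix.conjTranspose_conjTranspose,
      Matrix.conjTranspose_conjTranspose, add_comm]
  have hcol : ∀ p, ∑ j, ‖C j p‖ ^ 2 = 1 := sum_norm_sq_column h1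
  have hrow : ∀ j, ∑ p, ‖C j p‖ ^ 2 = 1 := sum_norm_sq_row h2
  have hWπ : ∑ j, ∑ p, π p * ‖C j p‖ ^ 2 ≤ 1 := by
    rw [Finset.sum_comm]
    simp only [← Finset.mul_sum, hcol, mul_one, hπ1, le_refl]
  have hW1 : ∑ j, ∑ p, (1 : ℝ) * ‖C j p‖ ^ 2 ≤ 2 ^ n := by
    simp only [one_mul, hrow]
    simp
  have hπle : ∀ j, π j ≤ 1 := fun j => by
    rw [← hπ1]
    exact Finset.single_le_sum (fun p _ => hπ p) (Finset.mem_univ j)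
  have hWπ2 : ∑ j, ∑ p, π j ^ 2 * ‖C j p‖ ^ 2 ≤ 1 := by
    simp only [← Finset.mul_sum, hrow, mul_one]
    rw [← hπ1]
    exact Finset.sum_le_sum fun j _ => pow_le_of_le_one (hπ j) (hπle j) two_ne_zero
  have hnB : ∀ k j p, ‖B k j p‖ ^ 2 = ‖q k.2 j‖ ^ 2 * ‖C j p‖ ^ 2 * ‖q k.1 p‖ ^ 2 :=
    fun k j p => by rw [hBa, norm_mul, norm_mul, mul_pow, mul_pow]
  have hnG : ∀ k j p, ‖B k j p * s p‖ ^ 2 =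
      π p * (‖q k.2 j‖ ^ 2 * ‖C j p‖ ^ 2 * ‖q k.1 p‖ ^ 2) := fun k j p => by
    rw [norm_mul, mul_pow, hnB, Complex.norm_real, Real.norm_eq_abs, sq_abs, hs2]
    ring
  have hbase : ∀ (k : ι × ι) (j p : Sys n),
      0 ≤ π p * (‖q k.2 j‖ ^ 2 * ‖C j p‖ ^ 2 * ‖q k.1 p‖ ^ 2) :=
    fun k j p => mul_nonneg (hπ p) (by positivity)
  have b1 : ∑ k, f k * hsNormSq (G k) ≤ 1 ^ 2 := by
    refine (sum_mul_hsNormSq_le (c := 1) (c' := 0) f hf1 G hq hνδ (by norm_num) le_rfl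
      (fun j p => hπ p) hWπ fun k j p => ?_).trans (by norm_num)
    rw [zero_mul, add_zero, one_mul, ← hnG, hGa]
  have b2 : ∑ k, f k * hsNormSq (Dg k) ≤ η ^ 2 := by
    refine (sum_mul_hsNormSq_le (c := η ^ 2) (c' := 0) f hf1 Dg hq hνδ
        (by rw [zero_mul, add_zero]; positivity) le_rfl
      (fun j p => hπ p) hWπ fun k j p => ?_).trans (by norm_num)
    rw [zero_mul, add_zero, hDga, norm_mul, mul_pow, hnG, Complex.norm_real,
      Real.norm_eq_abs, sq_abs]
    refine mul_le_mul_of_nonneg_right ?_ (hbase k j p)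
    simp only [hχ]
    split_ifs with h
    · rw [one_mul]
      exact sq_le_sq' (abs_le.1 (heg k j p h.1 h.2)).1 (abs_le.1 (heg k j p h.1 h.2)).2
    · rw [zero_mul, zero_pow two_ne_zero]
      positivity
  have b3 : ∑ k, f k * hsNormSq (Gb k) ≤ Real.sqrt (2 * δ) ^ 2 := by
    rw [Real.sq_sqrt (by positivity)]
    refine (sum_mul_hsNormSq_le (c := 0) (c' := 1) f hf1 Gb hq hνδ (by positivity) zero_le_one
      (fun j p => hπ p) hWπ fun k j p => ?_).trans (by linarith)
    rw [zero_add, one_mul, hGba, norm_mul, mul_pow, hnG, Complex.norm_real,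
      Real.norm_eq_abs, sq_abs]
    exact mul_le_mul_of_nonneg_right (hχν k j p) (hbase k j p)
  have b4 : ∑ k, f' k * hsNormSq (B k) ≤ Real.sqrt (2 ^ n) ^ 2 := by
    rw [Real.sq_sqrt (by positivity)]
    refine (sum_mul_hsNormSq_le (c := 1) (c' := 0) f' hf'1 B hq hνδ (by norm_num) le_rfl
      (fun j p => zero_le_one) hW1 fun k j p => ?_).trans (by norm_num)
    rw [zero_mul, add_zero, one_mul, one_mul, hnB]
  have b5 : ∑ k, f' k * hsNormSq (Bb k) ≤ Real.sqrt (2 * δ) ^ 2 := by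
    rw [Real.sq_sqrt (by positivity)]
    refine (sum_mul_hsNormSq_le (c := 0) (c' := 1) f' hf'1 Bb hq hνδ (by positivity) zero_le_one
      (fun j p => sq_nonneg (π j)) hWπ2 fun k j p => ?_).trans (by linarith)
    rw [zero_add, one_mul, hBba, norm_mul, mul_pow, norm_mul, mul_pow, hnB,
      Complex.norm_real, Complex.norm_real, Real.norm_eq_abs, Real.norm_eq_abs, sq_abs, sq_abs,
      mul_comm _ (π j ^ 2)]
    exact mul_le_mul_of_nonneg_right (hχν k j p) (by positivity)
  have hsδ : 0 < Real.sqrt (2 * δ) := Real.sqrt_pos.2 (by positivity)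
  have hsn : 0 < Real.sqrt ((2 : ℝ) ^ n) := Real.sqrt_pos.2 (by positivity)
  have t1 := traceNorm_sum_mul_conjTranspose_le f G Dg hf one_pos hη b1 b2
  have t2 := traceNorm_sum_mul_conjTranspose_le f G Gb hf one_pos hsδ b1 b3
  have t3 := traceNorm_sum_mul_conjTranspose_le f' B Bb hf' hsn hsδ b4 b5
  refine (le_of_eq (congrArg traceNorm key)).trans ?_
  refine (traceNorm_add_le ((hherm f G Dg).add (hherm f G Gb)) ?_).trans ?_
  · rw [Matrix.IsHermitian, Matrix.conjTranspose_smul, star_trivial, (hherm f' B Bb).eq]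
  have t4 := traceNorm_add_le (hherm f G Dg) (hherm f G Gb)
  rw [traceNorm_smul _ (hherm f' B Bb), abs_neg, abs_one, one_mul]
  linarith

end DetailedBalance

section GibbsResidual

variable {n g r : ℕ}

/-- The operator `⟨EE'|U|0⟩`: estimate `E`, jump, estimate `E'`. -/
def transitionOp (κ : ℝ) (H : Op n) (g r : ℕ) (flip : Bool) (C : Op n) (k : Est g r × Est g r) :
    Op n :=
  estCol (boostedQPE κ H g r flip) k.2 * C * estCol (boostedQPE κ H g r flip) k.1

lemma acceptKraus_unitaryU (κ β : ℝ) (H : Op n) (flip : Bool) (C : Op n) (E E' : Est g r)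
    (b : Bool) : acceptKraus κ β (unitaryU κ H g r flip C) (E, E', b) =
      if b = true then ((Real.sqrt (acceptRate κ β E E') : ℝ) : ℂ) •
        transitionOp κ H g r flip C (E, E') else 0 := by
  rw [acceptKraus, col_flagOp_mul, col_unitaryU, if_pos rfl]
  rfl

lemma cpMap_acceptKraus (κ β : ℝ) (H : Op n) (flip : Bool) (C ρ : Op n) :
    cpMap (acceptKraus κ β (unitaryU κ H g r flip C)) ρ =
      ∑ k : Est g r × Est g r, acceptRate κ β k.1 k.2 •
        (transitionOp κ H g r flip C k * ρ * (transitionOp κ H g r flip C k)ᴴ) := by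
  rw [cpMap_apply, Fintype.sum_prod_type, Fintype.sum_prod_type]
  refine Finset.sum_congr rfl fun E _ => ?_
  rw [Fintype.sum_prod_type]
  refine Finset.sum_congr rfl fun E' _ => ?_
  rw [Fintype.sum_bool, acceptKraus_unitaryU, acceptKraus_unitaryU, if_pos rfl,
    if_neg Bool.false_ne_true]
  simp only [Matrix.zero_mul, add_zero, Matrix.conjTranspose_smul, Complex.star_def,
    Complex.conj_ofReal, Matrix.smul_mul, Matrix.mul_smul, smul_smul]
  rw [← Complex.ofReal_mul, Real.mul_self_sqrt (acceptRate_pos κ β E E').le]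
  rfl

lemma krausGram_acceptKraus_unitaryU (κ β : ℝ) (H : Op n) (flip : Bool) (C : Op n) :
    krausGram (acceptKraus κ β (unitaryU κ H g r flip C)) =
      ∑ k : Est g r × Est g r, acceptRate κ β k.1 k.2 •
        ((transitionOp κ H g r flip C k)ᴴ * transitionOp κ H g r flip C k) := by
  rw [krausGram, Fintype.sum_prod_type, Fintype.sum_prod_type]
  refine Finset.sum_congr rfl fun E _ => ?_
  rw [Fintype.sum_prod_type]
  refine Finset.sum_congr rfl fun E' _ => ?_
  rw [Fintype.sum_bool, acceptKraus_unitaryU, acceptKraus_unitaryU, if_pos rfl,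
    if_neg Bool.false_ne_true]
  simp only [Matrix.mul_zero, add_zero, Matrix.conjTranspose_smul, Complex.star_def,
    Complex.conj_ofReal, Matrix.smul_mul, Matrix.mul_smul, smul_smul]
  rw [← Complex.ofReal_mul, Real.mul_self_sqrt (acceptRate_pos κ β E E').le]
  rfl

lemma estAmp_not (flip : Bool) (x : ℝ) (E : Est g r) :
    estAmp (!flip) x E = (starRingEnd ℂ) (estAmp flip x E) := by
  rw [estAmp, estAmp, map_prod]
  refine Finset.prod_congr rfl fun i _ => ?_
  cases flip <;> simp [ampFlip]

section Eigenbasis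

variable {V H : Op n} {d : Sys n → ℝ} {κ : ℝ}

/-- The flipped phase estimation turns the reverse transition into the adjoint. -/
lemma transitionOp_adjoint (h1 : Vᴴ * V = 1) (h2 : V * Vᴴ = 1)
    (hH : H = V * Matrix.diagonal (fun i => (d i : ℂ)) * Vᴴ) (flip : Bool) (C : Op n)
    (k : Est g r × Est g r) : transitionOp κ H g r (!flip) Cᴴ k.swap =
      (transitionOp κ H g r flip C k)ᴴ := by
  have h : ∀ E : Est g r, estCol (boostedQPE κ H g r (!flip)) E =
      (estCol (boostedQPE κ H g r flip) E)ᴴ := fun E => by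
    rw [estCol_eq h1 h2 hH, estCol_eq h1 h2 hH, conj_diag_conjTranspose]
    simp only [estAmp_not]
  rw [transitionOp, transitionOp, h, h, Matrix.conjTranspose_mul, Matrix.conjTranspose_mul,
    Matrix.mul_assoc]
  rfl

lemma transitionOp_eq (h1 : Vᴴ * V = 1) (h2 : V * Vᴴ = 1)
    (hH : H = V * Matrix.diagonal (fun i => (d i : ℂ)) * Vᴴ) (flip : Bool) (C : Op n)
    (k : Est g r × Est g r) : transitionOp κ H g r flip C k =
      V * (Matrix.diagonal (fun i => estAmp flip (d i * 2 ^ r / κ) k.2) * (Vᴴ * C * V) *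
        Matrix.diagonal (fun i => estAmp flip (d i * 2 ^ r / κ) k.1)) * Vᴴ := by
  rw [transitionOp, estCol_eq h1 h2 hH, estCol_eq h1 h2 hH]
  simp only [Matrix.mul_assoc]

lemma gibbs_eq (h1 : Vᴴ * V = 1) (h2 : V * Vᴴ = 1)
    (hH : H = V * Matrix.diagonal (fun i => (d i : ℂ)) * Vᴴ) (β : ℝ) :
    gibbs β H = V * Matrix.diagonal (fun i =>
      ((Real.exp (-β * d i) / ∑ j, Real.exp (-β * d j) : ℝ) : ℂ)) * Vᴴ := by
  have ht : (NormedSpace.exp ((-β : ℂ) • H)).trace = ((∑ j, Real.exp (-β * d j) : ℝ) : ℂ) := by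
    rw [exp_smul_diagonalization h2 hH, Matrix.trace_mul_cycle, h1, Matrix.one_mul,
      Matrix.trace_diagonal]
    push_cast
    rfl
  rw [gibbs, ht, exp_smul_diagonalization h2 hH, ← Matrix.smul_mul, ← Matrix.mul_smul]
  congr 2
  rw [← Matrix.diagonal_smul]
  congr 1
  funext i
  simp only [Pi.smul_apply, smul_eq_mul]
  push_cast
  rw [div_eq_inv_mul]

lemma spectrumLE_eigenvalues (h1 : Vᴴ * V = 1)
    (hH : H = V * Matrix.diagonal (fun i => (d i : ℂ)) * Vᴴ) {c : ℝ} (h : SpectrumLE H c)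
    (i : Sys n) : 0 ≤ d i ∧ d i ≤ c := by
  have e : ∀ D : Op n, Vᴴ * (V * D * Vᴴ) * V = D := fun D => by
    calc Vᴴ * (V * D * Vᴴ) * V = (Vᴴ * V) * D * (Vᴴ * V) := by simp only [Matrix.mul_assoc]
      _ = D := by rw [h1, Matrix.one_mul, Matrix.mul_one]
  have p1 := h.1.conjTranspose_mul_mul_same V
  have p2 := h.2.conjTranspose_mul_mul_same V
  rw [hH, e] at p1
  rw [Matrix.mul_sub, Matrix.sub_mul, hH, e, Matrix.mul_smul, Matrix.smul_mul, Matrix.mul_one,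
    h1] at p2
  have q1 := p1.diag_nonneg (i := i)
  have q2 := p2.diag_nonneg (i := i)
  rw [Matrix.diagonal_apply_eq] at q1
  rw [Matrix.sub_apply, Matrix.smul_apply, Matrix.one_apply_eq, Matrix.diagonal_apply_eq,
    smul_eq_mul, mul_one, ← Complex.ofReal_sub] at q2
  refine ⟨by exact_mod_cast q1, ?_⟩
  have : 0 ≤ c - d i := by exact_mod_cast q2
  linarith

end Eigenbasis

lemma PrecisionOK.two_mul_le {a r : ℕ} {β : ℝ} (hβ : 0 ≤ β) (h : PrecisionOK r ((2 : ℝ) ^ a) β) :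
    2 * (β * 2 ^ a) ≤ 2 ^ r := by
  rcases hβ.eq_or_lt with rfl | hβ
  · rw [zero_mul, mul_zero]
    positivity
  have h := h.resolve_left hβ.ne'
  have h2 : Real.logb 2 (2 * (2 ^ a * β)) = 1 + Real.logb 2 ((2 : ℝ) ^ a) + Real.logb 2 β := by
    rw [Real.logb_mul two_ne_zero (by positivity), Real.logb_mul (by positivity) hβ.ne',
      Real.logb_self_eq_one one_lt_two]
    ring
  rw [← h2, Real.logb_le_iff_le_rpow one_lt_two (by positivity), Real.rpow_natCast] at h
  linarith

/-- Detailed balance of the Metropolis rule. -/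
lemma acceptRate_swap (κ β : ℝ) (E E' : Est g r) :
    acceptRate κ β E' E =
      acceptRate κ β E E' * Real.exp (β * energy κ E' - β * energy κ E) := by
  rw [acceptRate, acceptRate, min_mul_of_nonneg _ _ (Real.exp_pos _).le, one_mul,
    ← Real.exp_add, min_comm]
  congr 1
  rw [← Real.exp_zero]
  congr 1
  ring

lemma traceNorm_sum_le {ι : Type*} (s : Finset ι) (Z : ι → Op n) (hZ : ∀ k ∈ s, (Z k).IsHermitian) :
    traceNorm (∑ k ∈ s, Z k) ≤ ∑ k ∈ s, traceNorm (Z k) := by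
  have h : ‖∑ k ∈ s.attach, HermOp.ofHerm (Z k) (hZ k k.2)‖ ≤
      ∑ k ∈ s.attach, ‖HermOp.ofHerm (Z k) (hZ k k.2)‖ := norm_sum_le _ _
  simp only [HermOp.norm_def, map_sum, HermOp.incl_ofHerm] at h
  rwa [Finset.sum_attach s Z, Finset.sum_attach s fun k => traceNorm (Z k)] at h

/-- The generator, with each jump forward paired with the loss term of the reverse jump. -/
lemma generator_eq_paired (κ β : ℝ) (H : Op n) (J : JumpEnsemble n) (ρ : Op n) :
    generator κ β H J g r ρ = ∑ C ∈ J.ops, ∑ flip : Bool, (1 / 2 * J.prob C) •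
      ((2 : ℂ) • cpMap (acceptKraus κ β (unitaryU κ H g r flip C)) ρ -
        (krausGram (acceptKraus κ β (unitaryU κ H g r (!flip) Cᴴ)) * ρ +
          ρ * krausGram (acceptKraus κ β (unitaryU κ H g r (!flip) Cᴴ)))) := by
  set F : Op n → Bool → Op n := fun C flip =>
    krausGram (acceptKraus κ β (unitaryU κ H g r flip C)) * ρ +
      ρ * krausGram (acceptKraus κ β (unitaryU κ H g r flip C)) with hF
  have hswap : ∑ C ∈ J.ops, ∑ flip : Bool, (1 / 2 * J.prob C) • F C flip =
      ∑ C ∈ J.ops, ∑ flip : Bool, (1 / 2 * J.prob C) • F Cᴴ (!flip) := by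
    refine Finset.sum_nbij' (fun C => Cᴴ) (fun C => Cᴴ) (fun C hC => J.adjoint_mem C hC)
      (fun C hC => J.adjoint_mem C hC) (fun C _ => Matrix.conjTranspose_conjTranspose C)
      (fun C _ => Matrix.conjTranspose_conjTranspose C) fun C hC => ?_
    rw [Matrix.conjTranspose_conjTranspose, J.prob_adjoint C hC, Fintype.sum_bool,
      Fintype.sum_bool, add_comm]
    rfl
  have e1 : generator κ β H J g r ρ = ∑ C ∈ J.ops, ∑ flip : Bool, (1 / 2 * J.prob C) •
      ((2 : ℂ) • cpMap (acceptKraus κ β (unitaryU κ H g r flip C)) ρ) -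
      ∑ C ∈ J.ops, ∑ flip : Bool, (1 / 2 * J.prob C) • F C flip := by
    simp only [generator, generatorFixed_eq_lindblad, lindblad_apply, ← Finset.sum_sub_distrib,
      ← smul_sub, hF]
    rfl
  rw [e1, hswap]
  simp only [← Finset.sum_sub_distrib, ← smul_sub, hF]

/-- The Gibbs state is almost stationary: detailed balance holds up to the grid spacing and the
failures of the median. -/
lemma traceNorm_generator_gibbs_le {a : ℕ} {β : ℝ} {H : Op n} (J : JumpEnsemble n) (hβ : 0 ≤ β)
    (hH : SpectrumLE H ((2 : ℝ) ^ a * (1 - 1 / 2 ^ r))) (hr : PrecisionOK r ((2 : ℝ) ^ a) β) :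
    traceNorm (generator ((2 : ℝ) ^ a) β H J g r (gibbs β H)) ≤
      fixedPointError n g r ((2 : ℝ) ^ a) β := by
  obtain ⟨V, d, h1, h2, hd⟩ := exists_diagonalization hH.1.1
  have hκ : (0 : ℝ) < 2 ^ a := by positivity
  have hr2 := hr.two_mul_le hβ
  set κ : ℝ := 2 ^ a with hκd
  have hN : (0 : ℝ) < 2 ^ r := by positivity
  have hdi := spectrumLE_eigenvalues h1 hd hH
  have hx0 : ∀ i, 0 ≤ d i * 2 ^ r / κ := fun i => by
    have := (hdi i).1
    positivity
  have hx1 : ∀ i, d i * 2 ^ r / κ ≤ 2 ^ r - 1 := fun i => by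
    rw [div_le_iff₀ hκ]
    calc d i * 2 ^ r ≤ κ * (1 - 1 / 2 ^ r) * 2 ^ r := by gcongr; exact (hdi i).2
      _ = _ := by field_simp
  set Z : ℝ := ∑ j, Real.exp (-β * d j) with hZ
  have hZ0 : 0 < Z := Finset.sum_pos (fun j _ => Real.exp_pos _) Finset.univ_nonempty
  set π : Sys n → ℝ := fun i => Real.exp (-β * d i) / Z with hπ
  have hπ0 : ∀ i, 0 ≤ π i := fun i => by positivity
  have hπ1 : ∑ i, π i = 1 := by
    rw [hπ, ← Finset.sum_div, div_self hZ0.ne']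
  have hgibbs : gibbs β H = V * Matrix.diagonal (fun i => (π i : ℂ)) * Vᴴ := gibbs_eq h1 h2 hd β
  set δ : ℝ := (4 / 5) ^ g with hδ
  have hδ0 : 0 < δ := by positivity
  -- the summand `√δ` only serves to make `η` positive when `β = 0`
  set η : ℝ := 4 * (β * (κ / 2 ^ r)) + Real.sqrt δ with hη
  have hη0 : 0 < η := by positivity
  -- the bound for each jump operator and each kind of phase estimation
  have hbound : ∀ C ∈ J.ops, ∀ flip : Bool, ∃ M : Op n, M.IsHermitian ∧
      (2 : ℂ) • cpMap (acceptKraus κ β (unitaryU κ H g r flip C)) (gibbs β H) -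
        (krausGram (acceptKraus κ β (unitaryU κ H g r (!flip) Cᴴ)) * gibbs β H +
          gibbs β H * krausGram (acceptKraus κ β (unitaryU κ H g r (!flip) Cᴴ))) = V * M * Vᴴ ∧
      traceNorm M ≤ 2 * η + 2 * Real.sqrt (2 * δ) * (1 + Real.sqrt (2 ^ n)) := by
    intro C hC flip
    have hC1 : Cᴴ * C = 1 := Matrix.mem_unitaryGroup_iff'.1 (J.unitary C hC)
    have hC2 : C * Cᴴ = 1 := Matrix.mem_unitaryGroup_iff.1 (J.unitary C hC)
    set C' : Op n := Vᴴ * C * V with hC'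
    have hC'1 : C'ᴴ * C' = 1 := by
      calc C'ᴴ * C' = Vᴴ * (Cᴴ * (V * Vᴴ) * C) * V := by
            simp only [hC', Matrix.conjTranspose_mul, Matrix.conjTranspose_conjTranspose,
              Matrix.mul_assoc]
        _ = 1 := by rw [h2, Matrix.mul_one, hC1, Matrix.mul_one, h1]
    have hC'2 : C' * C'ᴴ = 1 := mul_eq_one_comm.1 hC'1
    set q : Est g r → Sys n → ℂ := fun E i => estAmp flip (d i * 2 ^ r / κ) E with hq
    have hmain := traceNorm_detailedBalance_le hC'1 hC'2 (q := q)
      (good := fun E i => Near (d i * 2 ^ r / κ) (median E)) (π := π)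
      (f := fun k => acceptRate κ β k.1 k.2) (f' := fun k => acceptRate κ β k.2 k.1)
      (e := fun k j p => Real.exp (β * (energy κ k.2 - d j) - β * (energy κ k.1 - d p)))
      (δ := δ) (η := η) (fun p => sum_norm_estAmp_sq flip _)
      (fun p => median_tail flip (hx0 p) (hx1 p)) hδ0 hη0 hπ0 hπ1
      (fun k => (acceptRate_pos _ _ _ _).le) (fun k => acceptRate_le_one _ _ _ _)
      (fun k => (acceptRate_pos _ _ _ _).le) (fun k => acceptRate_le_one _ _ _ _)
      (fun k j p => ?_) (fun k j p hj hp => ?_)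
    · refine ⟨_, ?_, ?_, hmain⟩
      · rw [Matrix.IsHermitian, Matrix.conjTranspose_sum]
        refine Finset.sum_congr rfl fun k _ => ?_
        have hπd : (Matrix.diagonal (fun i => (π i : ℂ)))ᴴ =
            Matrix.diagonal (fun i => (π i : ℂ)) := by
          rw [Matrix.diagonal_conjTranspose]
          congr 1
          funext i
          exact Complex.conj_ofReal _
        generalize Matrix.diagonal (q k.2) * C' * Matrix.diagonal (q k.1) = B
        simp only [Matrix.conjTranspose_sub, Matrix.conjTranspose_smul, Matrix.conjTranspose_add,
          Matrix.conjTranspose_mul, Matrix.conjTranspose_conjTranspose, hπd, star_trivial,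
          Matrix.mul_assoc, Complex.star_def, Complex.conj_ofNat]
        rw [add_comm (B * _)]
      · have hX : krausGram (acceptKraus κ β (unitaryU κ H g r (!flip) Cᴴ)) =
            ∑ k : Est g r × Est g r, acceptRate κ β k.2 k.1 •
              (transitionOp κ H g r flip C k * (transitionOp κ H g r flip C k)ᴴ) := by
          rw [krausGram_acceptKraus_unitaryU]
          refine Fintype.sum_equiv (Equiv.prodComm _ _) _ _ fun k => ?_
          have := transitionOp_adjoint (g := g) (r := r) (κ := κ) h1 h2 hd flip C k.swap
          rw [Prod.swap_swap] at this
          rw [this, Matrix.conjTranspose_conjTranspose]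
          rfl
        rw [hX, cpMap_acceptKraus, hgibbs, Finset.smul_sum]
        simp only [Matrix.mul_sum, Matrix.sum_mul]
        rw [← Finset.sum_add_distrib, ← Finset.sum_sub_distrib]
        refine Finset.sum_congr rfl fun k _ => ?_
        rw [transitionOp_eq h1 h2 hd]
        have hcancel : ∀ X Y : Op n, V * X * Vᴴ * (V * Y * Vᴴ) = V * (X * Y) * Vᴴ := fun X Y => by
          calc V * X * Vᴴ * (V * Y * Vᴴ) = V * X * (Vᴴ * V) * Y * Vᴴ := by
                simp only [Matrix.mul_assoc]
            _ = _ := by rw [h1, Matrix.mul_one, Matrix.mul_assoc V]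
        have hadj : ∀ X : Op n, (V * X * Vᴴ)ᴴ = V * Xᴴ * Vᴴ := fun X => by
          rw [Matrix.conjTranspose_mul, Matrix.conjTranspose_mul,
            Matrix.conjTranspose_conjTranspose, Matrix.mul_assoc]
        rw [hadj]
        simp only [Matrix.smul_mul, Matrix.mul_smul, hcancel, Matrix.mul_sub, Matrix.sub_mul,
          Matrix.mul_add, Matrix.add_mul, smul_add]
        rw [smul_comm (2 : ℂ)]
    · rw [acceptRate_swap κ β k.1 k.2, hπ]
      simp only
      have e : Real.exp (β * (energy κ k.2 - d j) - β * (energy κ k.1 - d p)) *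
          Real.exp (-β * d p) =
          Real.exp (β * energy κ k.2 - β * energy κ k.1) * Real.exp (-β * d j) := by
        rw [← Real.exp_add, ← Real.exp_add]
        congr 1
        ring
      linear_combination acceptRate κ β k.1 k.2 / Z * e
    · have hn : ∀ {E : Est g r} {i}, Near (d i * 2 ^ r / κ) (median E) →
          |energy κ E - d i| ≤ κ / 2 ^ r := fun {E i} h => by
        have e : energy κ E - d i = κ / 2 ^ r * ((median E : ℝ) - d i * 2 ^ r / κ) := by
          rw [energy]
          field_simp
        rw [e, abs_mul, abs_of_pos (by positivity)]
        exact mul_le_of_le_one_right (by positivity) h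
      set y := β * (energy κ k.2 - d j) - β * (energy κ k.1 - d p) with hy
      have hyb : |y| ≤ 2 * (β * (κ / 2 ^ r)) := by
        rw [hy]
        refine (abs_sub _ _).trans ?_
        rw [abs_mul, abs_mul, abs_of_nonneg hβ, two_mul]
        exact add_le_add (mul_le_mul_of_nonneg_left (hn hj) hβ)
          (mul_le_mul_of_nonneg_left (hn hp) hβ)
      have hy1 : 2 * (β * (κ / 2 ^ r)) ≤ 1 := by
        rw [mul_div_assoc', mul_div_assoc', div_le_one hN]
        exact hr2
      have := Real.abs_exp_sub_one_le (hyb.trans hy1)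
      rw [abs_sub_comm]
      have hs := Real.sqrt_nonneg δ
      linarith
  rw [generator_eq_paired]
  have hprob : ∀ C ∈ J.ops, 0 ≤ 1 / 2 * J.prob C := fun C hC => by
    have := J.prob_pos C hC
    positivity
  set c : ℝ := 2 * η + 2 * Real.sqrt (2 * δ) * (1 + Real.sqrt (2 ^ n)) with hc
  have hVM : ∀ M : Op n, M.IsHermitian → (V * M * Vᴴ).IsHermitian := fun M hM =>
    Matrix.isHermitian_mul_mul_conjTranspose V hM
  have hone : ∀ C ∈ J.ops, ∀ flip : Bool, ∀ Y : Op n, (∃ M : Op n, M.IsHermitian ∧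
      Y = V * M * Vᴴ ∧ traceNorm M ≤ c) → ((1 / 2 * J.prob C) • Y).IsHermitian ∧
      traceNorm ((1 / 2 * J.prob C) • Y) ≤ 1 / 2 * J.prob C * c := by
    rintro C hC flip _ ⟨M, hM, rfl, hMc⟩
    refine ⟨?_, ?_⟩
    · rw [Matrix.IsHermitian, Matrix.conjTranspose_smul, star_trivial, (hVM M hM).eq]
    · rw [traceNorm_smul _ (hVM M hM), abs_of_nonneg (hprob C hC)]
      exact mul_le_mul_of_nonneg_left ((traceNorm_conj_le h1 hM).trans hMc) (hprob C hC)
  have hle : traceNorm (∑ C ∈ J.ops, ∑ flip : Bool, (1 / 2 * J.prob C) •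
      ((2 : ℂ) • cpMap (acceptKraus κ β (unitaryU κ H g r flip C)) (gibbs β H) -
        (krausGram (acceptKraus κ β (unitaryU κ H g r (!flip) Cᴴ)) * gibbs β H +
          gibbs β H * krausGram (acceptKraus κ β (unitaryU κ H g r (!flip) Cᴴ))))) ≤ c := by
    rw [← Finset.sum_product']
    refine (traceNorm_sum_le _ _ fun x hx => ?_).trans ?_
    · have hxC := (Finset.mem_product.1 hx).1
      exact (hone x.1 hxC x.2 _ (hbound x.1 hxC x.2)).1
    · calc _ ≤ ∑ x ∈ J.ops ×ˢ (Finset.univ : Finset Bool), 1 / 2 * J.prob x.1 * c :=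
            Finset.sum_le_sum fun x hx => by
              have hxC := (Finset.mem_product.1 hx).1
              exact (hone x.1 hxC x.2 _ (hbound x.1 hxC x.2)).2
        _ = c := by
          rw [Finset.sum_product]
          simp only [Finset.sum_const, Finset.card_univ, Fintype.card_bool, nsmul_eq_mul]
          rw [← Finset.mul_sum, ← Finset.sum_mul, ← Finset.mul_sum, J.prob_sum]
          push_cast
          ring
  refine hle.trans ?_
  have hs : Real.sqrt (2 * δ) ≤ 2 * Real.sqrt δ := by
    rw [Real.sqrt_mul zero_le_two]
    gcongr
    rw [Real.sqrt_le_left zero_le_two]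
    norm_num
  have h2n : (1 : ℝ) ≤ 2 ^ n := one_le_pow₀ one_le_two
  have hsn : Real.sqrt (2 ^ n) ≤ 2 ^ n := by
    rw [Real.sqrt_le_left (by positivity)]
    nlinarith
  have h4n : (2 : ℝ) ^ n ≤ 2 ^ (2 * n) := pow_le_pow_right₀ one_le_two (by omega)
  rw [hc, hη, fixedPointError]
  have hsd := Real.sqrt_nonneg δ
  have hb : 0 ≤ β * (κ / 2 ^ r) := by positivity
  have e1 : 40 * β * κ / 2 ^ r = 40 * (β * (κ / 2 ^ r)) := by ring
  have e2 : Real.sqrt (2 * δ) * (1 + Real.sqrt (2 ^ n)) ≤ 2 * Real.sqrt δ * (1 + 2 ^ (2 * n)) := by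
    gcongr
    linarith
  have e3 : Real.sqrt δ ≤ Real.sqrt δ * 2 ^ (2 * n) :=
    le_mul_of_one_le_right hsd (h2n.trans h4n)
  rw [e1]
  nlinarith

end GibbsResidual

/-! ### The averaged channel -/

section Average

variable {n g r : ℕ}

/-- Index set of the Kraus operators of the averaged maps. -/
abbrev AvgIndex (J : JumpEnsemble n) (g r : ℕ) := {C : Op n // C ∈ J.ops} × Bool × Anc g r

/-- The Kraus operators for fixed random choices, weighted by the square roots of the
probabilities of these choices. -/
def avgKraus (J : JumpEnsemble n) (K : Op n → Bool → Anc g r → Op n) : AvgIndex J g r → Op n :=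
  fun k => ((Real.sqrt (1 / 2 * J.prob k.1) : ℝ) : ℂ) • K k.1 k.2.1 k.2.2

lemma JumpEnsemble.weight_pos (J : JumpEnsemble n) {C : Op n} (hC : C ∈ J.ops) :
    0 < 1 / 2 * J.prob C := by
  have := J.prob_pos C hC
  positivity

lemma JumpEnsemble.sum_weight (J : JumpEnsemble n) :
    ∑ C ∈ J.ops, ∑ _flip : Bool, ((1 / 2 * J.prob C : ℝ) : ℂ) = 1 := by
  have h : ∑ C ∈ J.ops, ∑ _flip : Bool, (1 / 2 * J.prob C) = 1 := by
    simp only [Finset.sum_const, Finset.card_univ, Fintype.card_bool, nsmul_eq_mul]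
    rw [← Finset.mul_sum, ← Finset.mul_sum, J.prob_sum]
    norm_num
  exact_mod_cast h

lemma cpMap_avgKraus (J : JumpEnsemble n) (K : Op n → Bool → Anc g r → Op n) (ρ : Op n) :
    cpMap (avgKraus J K) ρ =
      ∑ C ∈ J.ops, ∑ flip : Bool, ((1 / 2 * J.prob C : ℝ) : ℂ) • cpMap (K C flip) ρ := by
  rw [← Finset.sum_attach J.ops, cpMap_apply, Fintype.sum_prod_type]
  refine Finset.sum_congr rfl fun C _ => ?_
  rw [Fintype.sum_prod_type]
  refine Finset.sum_congr rfl fun flip _ => ?_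
  rw [cpMap_apply, Finset.smul_sum]
  refine Finset.sum_congr rfl fun a _ => ?_
  simp only [avgKraus, Matrix.conjTranspose_smul, Complex.star_def, Complex.conj_ofReal,
    Matrix.smul_mul, Matrix.mul_smul, smul_smul]
  rw [← Complex.ofReal_mul, Real.mul_self_sqrt (J.weight_pos C.2).le]

lemma krausGram_avgKraus (J : JumpEnsemble n) (K : Op n → Bool → Anc g r → Op n) :
    krausGram (avgKraus J K) =
      ∑ C ∈ J.ops, ∑ flip : Bool, ((1 / 2 * J.prob C : ℝ) : ℂ) • krausGram (K C flip) := by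
  rw [← Finset.sum_attach J.ops, krausGram, Fintype.sum_prod_type]
  refine Finset.sum_congr rfl fun C _ => ?_
  rw [Fintype.sum_prod_type]
  refine Finset.sum_congr rfl fun flip _ => ?_
  rw [krausGram, Finset.smul_sum]
  refine Finset.sum_congr rfl fun a _ => ?_
  simp only [avgKraus, Matrix.conjTranspose_smul, Complex.star_def, Complex.conj_ofReal,
    Matrix.smul_mul, Matrix.mul_smul, smul_smul]
  rw [← Complex.ofReal_mul, Real.mul_self_sqrt (J.weight_pos C.2).le]

lemma lindblad_avgKraus (J : JumpEnsemble n) (K : Op n → Bool → Anc g r → Op n) (ρ : Op n) :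
    lindblad (avgKraus J K) ρ =
      ∑ C ∈ J.ops, ∑ flip : Bool, ((1 / 2 * J.prob C : ℝ) : ℂ) • lindblad (K C flip) ρ := by
  rw [lindblad_apply, cpMap_avgKraus, krausGram_avgKraus]
  simp only [lindblad_apply, Matrix.sum_mul, Matrix.mul_sum, Finset.smul_sum, smul_sub, smul_add,
    Finset.sum_sub_distrib, Finset.sum_add_distrib, Matrix.smul_mul, Matrix.mul_smul]
  simp only [smul_comm (2 : ℂ)]

lemma one_sub_krausGram_avgKraus (J : JumpEnsemble n) {K : Op n → Bool → Anc g r → Op n}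
    (h : ∀ C ∈ J.ops, ∀ flip, (1 - krausGram (K C flip)).PosSemidef) :
    (1 - krausGram (avgKraus J K)).PosSemidef := by
  have e : 1 - krausGram (avgKraus J K) = ∑ C ∈ J.ops, ∑ flip : Bool,
      ((1 / 2 * J.prob C : ℝ) : ℂ) • (1 - krausGram (K C flip)) := by
    simp only [smul_sub, Finset.sum_sub_distrib, ← Finset.sum_smul]
    rw [J.sum_weight, one_smul, krausGram_avgKraus]
  rw [e]
  refine Matrix.posSemidef_sum _ fun C hC => Matrix.posSemidef_sum _ fun flip _ => ?_
  have h0 : (0 : ℂ) ≤ ((1 / 2 * J.prob C : ℝ) : ℂ) := by exact_mod_cast (J.weight_pos hC).le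
  exact (h C hC flip).smul h0

variable (κ β : ℝ) (H : Op n) (J : JumpEnsemble n) (g r : ℕ)

/-- The Kraus operators of the effective generator. -/
def genKraus : AvgIndex J g r → Op n :=
  avgKraus J fun C flip => acceptKraus κ β (unitaryU κ H g r flip C)

/-- The Kraus operators of the correction of order `τ⁴` from the rejected moves. -/
def rejectCorrection : AvgIndex J g r → Op n :=
  avgKraus J fun C flip => rejectKraus₂ κ β (unitaryU κ H g r flip C)

/-- The Kraus operators of the correction of order `τ⁴` from the accepted moves. -/
def acceptCorrection : AvgIndex J g r → Op n :=
  avgKraus J fun C flip => acceptKraus₂ κ β (unitaryU κ H g r flip C)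

lemma generator_eq_lindblad : generator κ β H J g r = lindblad (genKraus κ β H J g r) := by
  funext ρ
  rw [genKraus, lindblad_avgKraus]
  simp only [generator, generatorFixed_eq_lindblad]

/-- The averaged channel as a superoperator on the Hermitian operators. -/
def stepH (τ : ℝ) : HermOp n →L[ℝ] HermOp n :=
  1 + τ ^ 2 • genH (genKraus κ β H J g r) +
    τ ^ 4 • (HermOp.lift (cpMap (rejectCorrection κ β H J g r)) (fun _ => cpMap_isHermitian _) -
      HermOp.lift (cpMap (acceptCorrection κ β H J g r)) (fun _ => cpMap_isHermitian _))

variable {κ β H J g r}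

lemma unitaryU_unitary (hH : H.IsHermitian) (flip : Bool) {C : Op n} (hC : C ∈ J.ops) :
    (unitaryU κ H g r flip C)ᴴ * unitaryU κ H g r flip C = 1 :=
  unitaryU_conjTranspose_mul_self (evolution_conjTranspose_mul_self hH) flip
    (Matrix.mem_unitaryGroup_iff'.1 (J.unitary C hC))

lemma step_eq (hH : H.IsHermitian) {τ : ℝ} (h0 : 0 ≤ τ) (h1 : τ ≤ 1) (ρ : Op n) :
    step κ β H J g r τ ρ = ρ + ((τ ^ 2 : ℝ) : ℂ) • lindblad (genKraus κ β H J g r) ρ +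
      ((τ ^ 4 : ℝ) : ℂ) • (cpMap (rejectCorrection κ β H J g r) ρ -
        cpMap (acceptCorrection κ β H J g r) ρ) := by
  have e : ∀ C ∈ J.ops, ∀ flip : Bool, stepFixed κ β τ g r (unitaryU κ H g r flip C) ρ = _ :=
    fun C hC flip => stepFixed_eq h0 h1 (unitaryU_unitary hH flip hC)
        (flagFree_unitaryU κ H flip C) ρ
  rw [step, Finset.sum_congr rfl fun C hC => Finset.sum_congr rfl fun flip _ => by
    rw [e C hC flip]]
  rw [genKraus, rejectCorrection, acceptCorrection, lindblad_avgKraus, cpMap_avgKraus,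
    cpMap_avgKraus]
  simp only [smul_add, smul_sub, Finset.sum_add_distrib, Finset.sum_sub_distrib, ← Finset.sum_smul,
    Finset.smul_sum]
  rw [J.sum_weight, one_smul]
  simp only [smul_comm (((τ ^ 2 : ℝ) : ℂ)), smul_comm (((τ ^ 4 : ℝ) : ℂ))]

lemma incl_stepH (hH : H.IsHermitian) {τ : ℝ} (h0 : 0 ≤ τ) (h1 : τ ≤ 1) (M : HermOp n) :
    HermOp.incl n (stepH κ β H J g r τ M) = step κ β H J g r τ (HermOp.incl n M) := by
  rw [step_eq hH h0 h1]
  rfl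

lemma step_posSemidef {τ : ℝ} {ρ : Op n} (hρ : ρ.PosSemidef) :
    (step κ β H J g r τ ρ).PosSemidef := by
  refine Matrix.posSemidef_sum _ fun C hC => Matrix.posSemidef_sum _ fun flip _ => ?_
  have h0 : (0 : ℂ) ≤ ((1 / 2 * J.prob C : ℝ) : ℂ) := by exact_mod_cast (J.weight_pos hC).le
  refine Matrix.PosSemidef.smul ?_ h0
  rw [stepFixed, conjChannel_eq_cpMap, conjChannel_eq_cpMap, conjChannel_eq_cpMap]
  exact ((cpMap_posSemidef _ hρ).add (cpMap_posSemidef _ hρ)).add (cpMap_posSemidef _ hρ)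

lemma isWeakStep_stepH (hH : H.IsHermitian) :
    IsWeakStep (genKraus κ β H J g r) (stepH κ β H J g r) where
  gram_le := one_sub_krausGram_avgKraus J fun C hC flip =>
    one_sub_krausGram_acceptKraus κ β (unitaryU_unitary hH flip hC) (flagFree_unitaryU κ H flip C)
  pos τ h0 h1 P hP := by
    rw [incl_stepH hH h0.le h1]
    exact step_posSemidef hP
  trace τ h0 h1 P := by
    have hgram : krausGram (rejectCorrection κ β H J g r) =
        krausGram (acceptCorrection κ β H J g r) := by
      rw [rejectCorrection, acceptCorrection, krausGram_avgKraus, krausGram_avgKraus]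
      refine Finset.sum_congr rfl fun C hC => Finset.sum_congr rfl fun flip _ => ?_
      rw [krausGram_rejectKraus₂ κ β (mul_eq_one_comm.1 (unitaryU_unitary hH flip hC))]
    rw [incl_stepH hH h0.le h1, step_eq hH h0.le h1, Matrix.trace_add, Matrix.trace_add,
      Matrix.trace_smul, Matrix.trace_smul, trace_lindblad, Matrix.trace_sub, trace_cpMap,
      trace_cpMap, hgram, sub_self, smul_zero, smul_zero, add_zero, add_zero]
  approx τ h0 h1 := by
    have hacc : (1 - krausGram (acceptCorrection κ β H J g r)).PosSemidef :=
      one_sub_krausGram_avgKraus J fun C hC flip =>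
        one_sub_krausGram_acceptKraus₂ κ β (unitaryU_unitary hH flip hC)
            (flagFree_unitaryU κ H flip C)
    have hrej : (1 - krausGram (rejectCorrection κ β H J g r)).PosSemidef :=
      one_sub_krausGram_avgKraus J fun C hC flip => by
        rw [krausGram_rejectKraus₂ κ β (mul_eq_one_comm.1 (unitaryU_unitary hH flip hC))]
        exact one_sub_krausGram_acceptKraus₂ κ β (unitaryU_unitary hH flip hC)
          (flagFree_unitaryU κ H flip C)
    rw [stepH, add_sub_right_comm, add_sub_right_comm, add_sub_cancel_left, sub_self, zero_add,
      norm_smul, Real.norm_of_nonneg (by positivity), mul_comm]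
    refine mul_le_mul_of_nonneg_right ?_ (by positivity)
    refine (norm_sub_le _ _).trans ?_
    have := norm_lift_cpMap_le hacc
    have := norm_lift_cpMap_le hrej
    linarith

lemma sum_estCol (hH : H.IsHermitian) (flip : Bool) :
    ∑ E : Est g r, estCol (boostedQPE κ H g r flip) E = 1 := by
  obtain ⟨V, d, h1, h2, hd⟩ := exists_diagonalization hH
  simp only [estCol_eq h1 h2 hd]
  rw [← Finset.sum_mul, ← Finset.mul_sum]
  have : ∑ E : Est g r, Matrix.diagonal (fun i => estAmp flip (d i * 2 ^ r / κ) E) =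
      (1 : Op n) := by
    ext i j
    rw [Matrix.sum_apply]
    by_cases hij : i = j
    · subst hij
      simp only [Matrix.diagonal_apply_eq, Matrix.one_apply_eq]
      exact sum_estAmp flip _
    · simp only [Matrix.diagonal_apply_ne _ hij, Matrix.one_apply_ne hij, Finset.sum_const_zero]
  rw [this, Matrix.mul_one, h2]

/-- The Kraus operators of the generator generate all operators, because each jump operator is the
sum of its transition operators. -/
lemma adjoin_genKraus (hH : H.IsHermitian) :
    Algebra.adjoin ℂ (Set.range (genKraus κ β H J g r)) = ⊤ := by
  rw [eq_top_iff, ← J.generates]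
  refine Algebra.adjoin_le fun C hC => ?_
  have hC' : C ∈ J.ops := hC
  have e : C = ∑ E : Est g r, ∑ E' : Est g r, transitionOp κ H g r false C (E, E') := by
    simp only [transitionOp, ← Finset.mul_sum, ← Finset.sum_mul]
    rw [sum_estCol hH, Matrix.one_mul, Matrix.mul_one]
  rw [e]
  refine Subalgebra.sum_mem _ fun E _ => Subalgebra.sum_mem _ fun E' _ => ?_
  set c : ℂ := ((Real.sqrt (1 / 2 * J.prob C) : ℝ) : ℂ) *
    ((Real.sqrt (acceptRate κ β E E') : ℝ) : ℂ) with hc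
  have hc0 : c ≠ 0 := mul_ne_zero
    (Complex.ofReal_ne_zero.2 (Real.sqrt_pos.2 (J.weight_pos hC')).ne')
    (Complex.ofReal_ne_zero.2 (Real.sqrt_pos.2 (acceptRate_pos κ β E E')).ne')
  have hA : genKraus κ β H J g r (⟨C, hC'⟩, false, (E, E', true)) =
      c • transitionOp κ H g r false C (E, E') := by
    rw [genKraus, avgKraus, acceptKraus_unitaryU, if_pos rfl, smul_smul]
  have : transitionOp κ H g r false C (E, E') =
      c⁻¹ • genKraus κ β H J g r (⟨C, hC'⟩, false, (E, E', true)) := by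
    rw [hA, smul_smul, inv_mul_cancel₀ hc0, one_smul]
  rw [this]
  exact Subalgebra.smul_mem _ (Algebra.subset_adjoin (Set.mem_range_self _)) _

end Average

/-! ### Error bounds in terms of the mixing time -/

section ErrorBounds

open HermOp

variable {n g r : ℕ} {κ β : ℝ} {H : Op n} {J : JumpEnsemble n}

lemma isState_gibbs (hH : H.IsHermitian) (β : ℝ) : IsState (gibbs β H) := by
  obtain ⟨V, d, h1, h2, hd⟩ := exists_diagonalization hH
  have hZ0 : 0 < ∑ j, Real.exp (-β * d j) :=
    Finset.sum_pos (fun j _ => Real.exp_pos _) Finset.univ_nonempty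
  rw [gibbs_eq h1 h2 hd]
  refine ⟨(Matrix.posSemidef_diagonal_iff.2 fun i => ?_).mul_mul_conjTranspose_same V, ?_⟩
  · have : 0 ≤ Real.exp (-β * d i) / ∑ j, Real.exp (-β * d j) := by positivity
    exact_mod_cast this
  · rw [Matrix.trace_mul_cycle, h1, Matrix.one_mul, Matrix.trace_diagonal, ← Complex.ofReal_sum,
      ← Finset.sum_div, div_self hZ0.ne', Complex.ofReal_one]

lemma expFlow_generator (t : ℝ) (M : HermOp n) :
    expFlow (generator κ β H J g r) t (incl n M) =
      incl n (flow (genKraus κ β H J g r) t M) := by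
  rw [generator_eq_lindblad, expFlow_eq_flow]

lemma incl_stepH_pow (hH : H.IsHermitian) {τ : ℝ} (h0 : 0 ≤ τ) (h1 : τ ≤ 1) (K : ℕ)
    (M : HermOp n) :
    incl n ((stepH κ β H J g r τ ^ K) M) = (step κ β H J g r τ)^[K] (incl n M) := by
  induction K generalizing M with
  | zero => rfl
  | succ K ih =>
    rw [pow_succ, Function.iterate_succ_apply, ← incl_stepH hH h0 h1]
    exact ih _

lemma isState_incl {ρ : HermOp n} (h : (incl n ρ).PosSemidef) (ht : (incl n ρ).trace.re = 1) :
    IsState (incl n ρ) :=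
  ⟨h, Complex.ext (by rw [ht, Complex.one_re]) (by rw [trace_im, Complex.one_im])⟩

lemma genH_eq_zero {σ : Op n} (hσ : IsFixedState (generator κ β H J g r) σ) :
    genH (genKraus κ β H J g r) (ofHerm σ hσ.1.1.1) = 0 := by
  apply incl_injective
  have := hσ.2
  rw [generator_eq_lindblad] at this
  rw [map_zero]
  exact this

lemma existsUnique_isFixedState (hH : H.IsHermitian) :
    ∃! σ, IsFixedState (generator κ β H J g r) σ := by
  obtain ⟨σ, h0, hp, ht, -⟩ := (isWeakStep_stepH (κ := κ) (β := β) (J := J) (g := g) (r := r)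
    hH).exists_stationary (adjoin_genKraus hH)
  have hσ : IsFixedState (generator κ β H J g r) (incl n σ) := by
    refine ⟨isState_incl hp ht, ?_⟩
    rw [generator_eq_lindblad]
    exact (congrArg (incl n) h0).trans (map_zero _)
  refine ⟨incl n σ, hσ, fun σ' hσ' => ?_⟩
  have h := (isWeakStep_stepH (κ := κ) (β := β) (J := J) (g := g) (r := r)
    hH).stationary_unique (adjoin_genKraus hH) (genH_eq_zero hσ') h0
    (by rw [ht, IsWeakStep.trace_ofHerm_of_isState hσ'.1])
  exact congrArg (incl n) h

lemma mem_mixingTimes_iff {σ : Op n} (hσ : σ.IsHermitian) {ε t : ℝ} :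
    t ∈ mixingTimes (generator κ β H J g r) σ ε ↔ 0 ≤ t ∧ ∀ ρ : HermOp n,
      (incl n ρ).PosSemidef → (incl n ρ).trace.re = 1 →
        ‖flow (genKraus κ β H J g r) t ρ - ofHerm σ hσ‖ ≤ ε := by
  rw [mixingTimes, Set.mem_ofPred_eq]
  refine and_congr_right fun _ => ⟨fun h ρ hp ht => ?_, fun h ρ hρ => ?_⟩
  · have := h (incl n ρ) (isState_incl hp ht)
    rwa [expFlow_generator] at this
  · have := h (ofHerm ρ hρ.1.1) hρ.1 (IsWeakStep.trace_ofHerm_of_isState hρ)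
    rw [← incl_ofHerm ρ hρ.1.1, expFlow_generator]
    exact this

lemma mixingTimes_nonempty (hH : H.IsHermitian) {σ : Op n}
    (hσ : IsFixedState (generator κ β H J g r) σ) {ε : ℝ} (hε : 0 < ε) :
    (mixingTimes (generator κ β H J g r) σ ε).Nonempty := by
  obtain ⟨σ', h0, hp, ht, hmix⟩ := (isWeakStep_stepH (κ := κ) (β := β) (J := J) (g := g) (r := r)
    hH).exists_stationary (adjoin_genKraus hH)
  have h := (isWeakStep_stepH (κ := κ) (β := β) (J := J) (g := g) (r := r)
    hH).stationary_unique (adjoin_genKraus hH) (genH_eq_zero hσ) h0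
    (by rw [ht, IsWeakStep.trace_ofHerm_of_isState hσ.1])
  obtain ⟨t, ht0, htm⟩ := hmix ε hε
  exact ⟨t, (mem_mixingTimes_iff hσ.1.1.1).2 ⟨ht0, by rwa [h]⟩⟩

lemma mixingTime_mem (hH : H.IsHermitian) {σ : Op n}
    (hσ : IsFixedState (generator κ β H J g r) σ) {ε : ℝ} (hε : 0 < ε) :
    mixingTime (generator κ β H J g r) σ ε ∈ mixingTimes (generator κ β H J g r) σ ε := by
  refine IsClosed.csInf_mem ?_ (mixingTimes_nonempty hH hσ hε) ⟨0, fun t ht => ht.1⟩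
  have e : mixingTimes (generator κ β H J g r) σ ε = {t | 0 ≤ t} ∩ ⋂ ρ : HermOp n,
      {t | (incl n ρ).PosSemidef → (incl n ρ).trace.re = 1 →
        ‖flow (genKraus κ β H J g r) t ρ - ofHerm σ hσ.1.1.1‖ ≤ ε} := by
    ext t
    rw [mem_mixingTimes_iff hσ.1.1.1, Set.mem_inter_iff, Set.mem_iInter]
    rfl
  rw [e]
  refine (isClosed_le continuous_const continuous_id).inter (isClosed_iInter fun ρ => ?_)
  by_cases hρ : (incl n ρ).PosSemidef ∧ (incl n ρ).trace.re = 1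
  · have hc : Continuous fun t => flow (genKraus κ β H J g r) t ρ :=
      continuous_iff_continuousAt.2 fun t => (hasDerivAt_flow _ t ρ).continuousAt
    have : IsClosed {t : ℝ | ‖flow (genKraus κ β H J g r) t ρ - ofHerm σ hσ.1.1.1‖ ≤ ε} :=
      isClosed_le (hc.sub continuous_const).norm continuous_const
    simpa only [hρ.1, hρ.2, forall_const] using this
  · have : {t : ℝ | (incl n ρ).PosSemidef → (incl n ρ).trace.re = 1 →
        ‖flow (genKraus κ β H J g r) t ρ - ofHerm σ hσ.1.1.1‖ ≤ ε} = Set.univ :=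
      Set.eq_univ_of_forall fun t hp ht => absurd ⟨hp, ht⟩ hρ
    rw [this]
    exact isClosed_univ

/-- Perturbation of the stationary state: a state that moves slowly is close to it. -/
lemma traceNorm_stationary_sub_gibbs_le (hH : H.IsHermitian) {σ : Op n}
    (hσ : IsFixedState (generator κ β H J g r) σ) {ε : ℝ} (hε : 0 < ε) :
    traceNorm (σ - gibbs β H) ≤ ε + traceNorm (generator κ β H J g r (gibbs β H)) *
      mixingTime (generator κ β H J g r) σ ε := by
  obtain ⟨h0, hm⟩ := (mem_mixingTimes_iff hσ.1.1.1).1 (mixingTime_mem hH hσ hε)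
  set t := mixingTime (generator κ β H J g r) σ ε
  have hG := isState_gibbs hH β
  set G : HermOp n := ofHerm (gibbs β H) hG.1.1 with hGd
  have a1 := hm G hG.1 (IsWeakStep.trace_ofHerm_of_isState hG)
  have a2 := (isWeakStep_stepH (κ := κ) (β := β) (J := J) (g := g) (r := r)
    hH).norm_flow_sub_self_le h0 G
  have a3 : ‖genH (genKraus κ β H J g r) G‖ =
      traceNorm (generator κ β H J g r (gibbs β H)) := by
    rw [generator_eq_lindblad, norm_def, genH, incl_lift, hGd, incl_ofHerm]
  have a4 : traceNorm (σ - gibbs β H) = ‖ofHerm σ hσ.1.1.1 - G‖ := by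
    rw [norm_def, map_sub, hGd, incl_ofHerm, incl_ofHerm]
  rw [a4, ← a3]
  refine (norm_sub_le_norm_sub_add_norm_sub (ofHerm σ hσ.1.1.1)
    (flow (genKraus κ β H J g r) t G) G).trans (add_le_add ?_ a2)
  exact (norm_sub_rev _ _).trans_le a1

lemma inducedNormLE_step_sub_flow (hH : H.IsHermitian) {τ : ℝ} (h0 : 0 < τ) (h1 : τ ≤ 1) (K : ℕ) :
    InducedNormLE (fun M => (step κ β H J g r τ)^[K] M -
      expFlow (generator κ β H J g r) (K * τ ^ 2) M) (2 * Real.exp 4 * K * τ ^ 4) := by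
  intro M hM hM1
  have h := (isWeakStep_stepH (κ := κ) (β := β) (J := J) (g := g) (r := r)
    hH).norm_pow_sub_flow_le h0 h1 K
  have h2 := (stepH κ β H J g r τ ^ K - flow (genKraus κ β H J g r) (K * τ ^ 2)).le_of_opNorm_le h
    (ofHerm M hM)
  have e : ‖ofHerm M hM‖ = 1 := hM1
  rw [e, mul_one] at h2
  have e2 : (step κ β H J g r τ)^[K] M - expFlow (generator κ β H J g r) (K * τ ^ 2) M =
      incl n ((stepH κ β H J g r τ ^ K - flow (genKraus κ β H J g r) (K * τ ^ 2))
        (ofHerm M hM)) := by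
    rw [sub_apply, map_sub, incl_stepH_pow hH h0.le h1, ← expFlow_generator]
    rfl
  simp only [e2]
  exact h2

/-- The error of the algorithm run for any evolution time `T` beyond the mixing time. -/
lemma traceNorm_iterate_step_sub_gibbs_le (hH : H.IsHermitian) {σ : Op n}
    (hσ : IsFixedState (generator κ β H J g r) σ) {ε : ℝ} (hε : 0 < ε) {b : ℝ}
    (hb : traceNorm (generator κ β H J g r (gibbs β H)) ≤ b) {T τ : ℝ} {K : ℕ} (h0 : 0 < τ)
    (h1 : τ ≤ 1) (hT : mixingTime (generator κ β H J g r) σ ε ≤ T) (hK : K * τ ^ 2 = T)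
    {ρ : Op n} (hρ : IsState ρ) :
    traceNorm ((step κ β H J g r τ)^[K] ρ - gibbs β H) ≤
      2 * ε + (b + 2 * Real.exp 4 * τ ^ 2) * T := by
  have hw := isWeakStep_stepH (κ := κ) (β := β) (J := J) (g := g) (r := r) hH
  obtain ⟨ht0, hm⟩ := (mem_mixingTimes_iff hσ.1.1.1).1 (mixingTime_mem hH hσ hε)
  have a1 := traceNorm_stationary_sub_gibbs_le hH hσ hε
  set t := mixingTime (generator κ β H J g r) σ ε
  have hG := isState_gibbs hH β
  set R : HermOp n := ofHerm ρ hρ.1.1 with hR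
  set S : HermOp n := ofHerm σ hσ.1.1.1 with hS
  set G : HermOp n := ofHerm (gibbs β H) hG.1.1 with hGd
  have hR1 : ‖R‖ = 1 := by
    rw [norm_of_posSemidef (P := R) hρ.1]
    exact IsWeakStep.trace_ofHerm_of_isState hρ
  have a2 : ‖flow (genKraus κ β H J g r) T R - S‖ ≤ ε := by
    have e : flow (genKraus κ β H J g r) T R - S =
        flow (genKraus κ β H J g r) (T - t) (flow (genKraus κ β H J g r) t R - S) := by
      rw [map_sub, hw.flow_fixed (genH_eq_zero hσ) (sub_nonneg.2 hT), ← mul_apply_eq_comp,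
        ← flow_add, sub_add_cancel]
    rw [e]
    exact (hw.norm_flow_apply_le (sub_nonneg.2 hT) _).trans
      (hm R hρ.1 (IsWeakStep.trace_ofHerm_of_isState hρ))
  have a3 : ‖(stepH κ β H J g r τ ^ K) R - flow (genKraus κ β H J g r) T R‖ ≤
      2 * Real.exp 4 * τ ^ 2 * T := by
    have h := (stepH κ β H J g r τ ^ K -
      flow (genKraus κ β H J g r) (K * τ ^ 2)).le_of_opNorm_le (hw.norm_pow_sub_flow_le h0 h1 K) R
    rw [hR1, mul_one, sub_apply, hK] at h
    refine h.trans (le_of_eq ?_)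
    rw [← hK]
    ring
  have a4 : ‖S - G‖ ≤ ε + b * T := by
    refine a1.trans ?_
    have hb0 := (traceNorm_nonneg (generator κ β H J g r (gibbs β H))).trans hb
    gcongr
  have e : traceNorm ((step κ β H J g r τ)^[K] ρ - gibbs β H) =
      ‖(stepH κ β H J g r τ ^ K) R - G‖ := by
    rw [norm_def, map_sub, incl_stepH_pow hH h0.le h1]
    rfl
  have e2 : (stepH κ β H J g r τ ^ K) R - G =
      ((stepH κ β H J g r τ ^ K) R - flow (genKraus κ β H J g r) T R) +
      (flow (genKraus κ β H J g r) T R - S) + (S - G) := by abel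
  rw [e, e2]
  have := norm_add₃_le (a := (stepH κ β H J g r τ ^ K) R - flow (genKraus κ β H J g r) T R)
    (b := flow (genKraus κ β H J g r) T R - S) (c := S - G)
  linarith

end ErrorBounds

/-! ### Circuits for operators on one block -/

section Circuits

variable {n g r : ℕ} {J : JumpEnsemble n} {κ : ℝ} {H : Op n}

/-- `M` and `M†` are implemented exactly by circuits of cost at most `N (1 + h + c)`. -/
def Implementable (J : JumpEnsemble n) (κ : ℝ) (H : Op n) (M : FullOp n g r) (N : ℕ) : Prop :=
  ∃ l l' : List (Gate J g r), circuitEval κ H l = M ∧ circuitEval κ H l' = Mᴴ ∧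
    ∀ h c : ℕ, circuitCost h c l ≤ N * (1 + h + c) ∧ circuitCost h c l' ≤ N * (1 + h + c)

lemma circuitEval_append (l l' : List (Gate J g r)) :
    circuitEval κ H (l ++ l') = circuitEval κ H l' * circuitEval κ H l := by
  rw [circuitEval, circuitEval, circuitEval, List.map_append, List.reverse_append, List.prod_append]

lemma circuitCost_append (h c : ℕ) (l l' : List (Gate J g r)) :
    circuitCost h c (l ++ l') = circuitCost h c l + circuitCost h c l' := by
  rw [circuitCost, circuitCost, circuitCost, List.map_append, List.sum_append]

open Classical in
lemma Gate.eval_two_apply {p q : Qubit n g r} (hpq : p ≠ q)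
    (u : Matrix.unitaryGroup (Bool × Bool) ℂ) (x y : Sys n × Anc g r) :
    (Gate.two p q hpq u : Gate J g r).eval κ H x y =
      if ∀ c, c ≠ p → c ≠ q → readBit x c = readBit y c then
        (u : Matrix (Bool × Bool) (Bool × Bool) ℂ)
          (readBit x p, readBit x q) (readBit y p, readBit y q)
      else 0 := rfl

lemma Gate.eval_evolve_apply (reg : Bool) (i : Fin g) (k : Fin r) (inverse : Bool)
    (x y : Sys n × Anc g r) : (Gate.evolve reg i k inverse : Gate J g r).eval κ H x y =
      if x.2 = y.2 then
        (if readBit x (.est reg i k) then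
          (if inverse then (evolution κ H)ᴴ else evolution κ H) else 1) x.1 y.1
      else 0 := rfl

namespace Implementable

lemma one : Implementable J κ H (1 : FullOp n g r) 0 :=
  ⟨[], [], rfl, by rw [Matrix.conjTranspose_one]; rfl, fun h c => ⟨Nat.zero_le _, Nat.zero_le _⟩⟩

lemma mul {M M' : FullOp n g r} {N N' : ℕ} (hM : Implementable J κ H M N)
    (hM' : Implementable J κ H M' N') : Implementable J κ H (M * M') (N + N') := by
  obtain ⟨l, k, h1, h2, h3⟩ := hM
  obtain ⟨l', k', h1', h2', h3'⟩ := hM'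
  refine ⟨l' ++ l, k ++ k', ?_, ?_, fun h c => ?_⟩
  · rw [circuitEval_append, h1, h1']
  · rw [circuitEval_append, h2, h2', Matrix.conjTranspose_mul]
  · rw [circuitCost_append, circuitCost_append, add_mul]
    have a := h3 h c
    have b := h3' h c
    exact ⟨by linarith [a.1, b.1], by linarith [a.2, b.2]⟩

lemma conjTranspose {M : FullOp n g r} {N : ℕ} (hM : Implementable J κ H M N) :
    Implementable J κ H Mᴴ N := by
  obtain ⟨l, k, h1, h2, h3⟩ := hM
  exact ⟨k, l, h2, by rw [h1, Matrix.conjTranspose_conjTranspose], fun h c => (h3 h c).symm⟩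

lemma mono {M : FullOp n g r} {N N' : ℕ} (hM : Implementable J κ H M N) (h : N ≤ N') :
    Implementable J κ H M N' := by
  obtain ⟨l, k, h1, h2, h3⟩ := hM
  exact ⟨l, k, h1, h2, fun h' c =>
    ⟨(h3 h' c).1.trans (Nat.mul_le_mul_right _ h), (h3 h' c).2.trans (Nat.mul_le_mul_right _ h)⟩⟩

lemma list_prod {N : ℕ} (l : List (FullOp n g r)) (h : ∀ M ∈ l, Implementable J κ H M N) :
    Implementable J κ H l.prod (l.length * N) := by
  induction l with
  | nil => simpa using one
  | cons M l ih =>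
    rw [List.prod_cons, List.length_cons, add_mul, one_mul, add_comm]
    exact (h M (by simp)).mul (ih fun M' hM' => h M' (by simp [hM']))

lemma gate (G G' : Gate J g r) (hG : G'.eval κ H = (G.eval κ H)ᴴ)
    (hc : ∀ h c, G.cost h c ≤ 1 + h + c) (hc' : ∀ h c, G'.cost h c ≤ 1 + h + c) :
    Implementable J κ H (G.eval κ H) 1 := by
  refine ⟨[G], [G'], ?_, ?_, fun h c => ?_⟩
  · simp [circuitEval]
  · simp [circuitEval, hG]
  · rw [one_mul]
    simpa [circuitCost] using ⟨hc h c, hc' h c⟩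

lemma two (p q : Qubit n g r) (hpq : p ≠ q) (u : Matrix.unitaryGroup (Bool × Bool) ℂ) :
    Implementable J κ H ((Gate.two p q hpq u : Gate J g r).eval κ H) 1 := by
  refine gate _ (Gate.two p q hpq (star u)) ?_ (fun h c => ?_) fun h c => ?_
  · ext x y
    rw [Matrix.conjTranspose_apply, Gate.eval_two_apply, Gate.eval_two_apply]
    by_cases h : ∀ c, c ≠ p → c ≠ q → readBit x c = readBit y c
    · rw [if_pos h, if_pos fun c h1 h2 => (h c h1 h2).symm]
      rfl
    · rw [if_neg h, if_neg fun h' => h fun c h1 h2 => (h' c h1 h2).symm, star_zero]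
  · exact (by omega : 1 ≤ 1 + h + c)
  · exact (by omega : 1 ≤ 1 + h + c)

lemma evolve (reg : Bool) (i : Fin g) (k : Fin r) :
    Implementable J κ H ((Gate.evolve reg i k false : Gate J g r).eval κ H) 1 := by
  refine gate _ (Gate.evolve reg i k true) ?_ (fun h c => ?_) fun h c => ?_
  · ext x y
    rw [Matrix.conjTranspose_apply, Gate.eval_evolve_apply, Gate.eval_evolve_apply]
    by_cases h : x.2 = y.2
    · have hb : readBit x (.est reg i k) = readBit y (.est reg i k) := by
        simp only [readBit, h]
      rw [if_pos h, if_pos h.symm, hb]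
      cases readBit y (.est reg i k)
      · change (1 : Op n) x.1 y.1 = star ((1 : Op n) y.1 x.1)
        rw [← Matrix.conjTranspose_apply, Matrix.conjTranspose_one]
      · rfl
    · rw [if_neg h, if_neg fun h' => h h'.symm, star_zero]
  · exact (by omega : h ≤ 1 + h + c)
  · exact (by omega : h ≤ 1 + h + c)

lemma jump {C : Op n} (hC : C ∈ J.ops) :
    Implementable J κ H (C ⊗ₖ (1 : Matrix (Anc g r) (Anc g r) ℂ)) 1 := by
  refine gate (Gate.jump C hC) (Gate.jump Cᴴ (J.adjoint_mem C hC)) ?_ (fun h c => ?_) fun h c => ?_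
  · rw [Gate.eval, Gate.eval, Matrix.conjTranspose_kronecker, Matrix.conjTranspose_one]
  · exact (by omega : c ≤ 1 + h + c)
  · exact (by omega : c ≤ 1 + h + c)

end Implementable

/-- An operator on the system and block `i` of register 2 (`reg = false`) or 3 (`reg = true`). -/
def blockOp (reg : Bool) (i : Fin g) (Q : Matrix (Sys n × Bits r) (Sys n × Bits r) ℂ) :
    FullOp n g r :=
  if reg then onReg3 (onBlock i Q) else onReg2 (onBlock i Q)

/-- The bit string in block `i` of an estimate register. -/
def readBlock (reg : Bool) (i : Fin g) (x : Sys n × Anc g r) : Bits r :=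
  fun k => readBit x (.est reg i k)

/-- Two basis states agree outside the system and one block. -/
def AgreeOff (reg : Bool) (i : Fin g) (x y : Sys n × Anc g r) : Prop :=
  (∀ j, j ≠ i → ∀ k, readBit x (.est reg j k) = readBit y (.est reg j k)) ∧
    (∀ j k, readBit x (.est (!reg) j k) = readBit y (.est (!reg) j k)) ∧
      readBit x .flag = readBit y .flag

open Classical in
lemma blockOp_apply (reg : Bool) (i : Fin g) (Q : Matrix (Sys n × Bits r) (Sys n × Bits r) ℂ)
    (x y : Sys n × Anc g r) : blockOp reg i Q x y =
      if AgreeOff reg i x y then Q (x.1, readBlock reg i x) (y.1, readBlock reg i y) else 0 := by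
  obtain ⟨x, E, E', f⟩ := x
  obtain ⟨y, F, F', f'⟩ := y
  cases reg
  · have hQ : blockOp false i Q (x, E, E', f) (y, F, F', f') =
        if (E', f) = (F', f') then
          if ∀ j, j ≠ i → E j = F j then Q (x, E i) (y, F i) else 0 else 0 := rfl
    rw [hQ]
    by_cases h : AgreeOff false i (x, E, E', f) (y, F, F', f')
    · have h1 : E' = F' := funext fun j => funext fun k => h.2.1 j k
      have h2 : f = f' := h.2.2
      have h3 : ∀ j, j ≠ i → E j = F j := fun j hj => funext fun k => h.1 j hj k
      rw [if_pos h, if_pos (by rw [h1, h2]), if_pos h3]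
      rfl
    · rw [if_neg h]
      split_ifs with h1 h2
      · refine absurd ⟨fun j hj k => congrFun (h2 j hj) k, fun j k => ?_, ?_⟩ h
        · exact congrFun (congrFun (congrArg Prod.fst h1) j) k
        · exact congrArg Prod.snd h1
      · rfl
      · rfl
  · have hQ : blockOp true i Q (x, E, E', f) (y, F, F', f') =
        if E = F ∧ f = f' then
          if ∀ j, j ≠ i → E' j = F' j then Q (x, E' i) (y, F' i) else 0 else 0 := rfl
    rw [hQ]
    by_cases h : AgreeOff true i (x, E, E', f) (y, F, F', f')
    · have h1 : E = F := funext fun j => funext fun k => h.2.1 j k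
      have h3 : ∀ j, j ≠ i → E' j = F' j := fun j hj => funext fun k => h.1 j hj k
      rw [if_pos h, if_pos ⟨h1, h.2.2⟩, if_pos h3]
      rfl
    · rw [if_neg h]
      split_ifs with h1 h2
      · exact absurd ⟨fun j hj k => congrFun (h2 j hj) k, fun j k => congrFun (congrFun h1.1 j) k,
          h1.2⟩ h
      · rfl
      · rfl

lemma blockOp_mul (reg : Bool) (i : Fin g) (Q R : Matrix (Sys n × Bits r) (Sys n × Bits r) ℂ) :
    (blockOp reg i (Q * R) : FullOp n g r) = blockOp reg i Q * blockOp reg i R := by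
  cases reg
  · exact (congrArg onReg2 (onBlock_mul i Q R)).trans (onReg2_mul _ _)
  · exact (congrArg onReg3 (onBlock_mul i Q R)).trans (onReg3_mul _ _)

lemma blockOp_one (reg : Bool) (i : Fin g) :
    (blockOp reg i (1 : Matrix (Sys n × Bits r) (Sys n × Bits r) ℂ) : FullOp n g r) = 1 := by
  cases reg
  · exact (congrArg onReg2 (onBlock_one i)).trans onReg2_one
  · exact (congrArg onReg3 (onBlock_one i)).trans onReg3_one

lemma blockOp_conjTranspose (reg : Bool) (i : Fin g)
    (Q : Matrix (Sys n × Bits r) (Sys n × Bits r) ℂ) :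
    (blockOp reg i Q : FullOp n g r)ᴴ = blockOp reg i Qᴴ := by
  cases reg
  · exact (onReg2_conjTranspose _).trans (congrArg onReg2 (onBlock_conjTranspose i Q))
  · exact (onReg3_conjTranspose _).trans (congrArg onReg3 (onBlock_conjTranspose i Q))

/-- A one-qubit gate on bit `k` of a block. -/
def oneGate (k : Fin r) (v : Matrix Bool Bool ℂ) : Matrix (Bits r) (Bits r) ℂ :=
  fun x y => if ∀ j, j ≠ k → x j = y j then v (x k) (y k) else 0

/-- A two-qubit gate on bits `k`, `l` of a block. -/
def twoGate (k l : Fin r) (u : Matrix (Bool × Bool) (Bool × Bool) ℂ) :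
    Matrix (Bits r) (Bits r) ℂ :=
  fun x y => if ∀ j, j ≠ k → j ≠ l → x j = y j then u (x k, x l) (y k, y l) else 0

lemma blockOp_one_kronecker_apply_of_not {reg : Bool} {i : Fin g} {G : Matrix (Bits r) (Bits r) ℂ}
    {x y : Sys n × Anc g r} (h : ¬ (x.1 = y.1 ∧ AgreeOff reg i x y)) :
    blockOp reg i ((1 : Op n) ⊗ₖ G) x y = 0 := by
  rw [blockOp_apply]
  split_ifs with h1
  · rw [Matrix.kroneckerMap_apply, Matrix.one_apply_ne fun h2 => h ⟨h2, h1⟩, zero_mul]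
  · rfl

lemma blockOp_one_kronecker_apply {reg : Bool} {i : Fin g} {G : Matrix (Bits r) (Bits r) ℂ}
    {x y : Sys n × Anc g r} (h : x.1 = y.1) (h' : AgreeOff reg i x y) :
    blockOp reg i ((1 : Op n) ⊗ₖ G) x y = G (readBlock reg i x) (readBlock reg i y) := by
  rw [blockOp_apply, if_pos h', Matrix.kroneckerMap_apply, h, Matrix.one_apply_eq, one_mul]

lemma implementable_twoGate (reg : Bool) (i : Fin g) {k l : Fin r} (hkl : k ≠ l)
    {u : Matrix (Bool × Bool) (Bool × Bool) ℂ} (hu : u ∈ Matrix.unitaryGroup (Bool × Bool) ℂ) :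
    Implementable J κ H (blockOp reg i ((1 : Op n) ⊗ₖ twoGate k l u) : FullOp n g r) 1 := by
  have hpq : (Qubit.est reg i k : Qubit n g r) ≠ Qubit.est reg i l := fun h => by
    injection h with _ _ h
    exact hkl h
  have e : (blockOp reg i ((1 : Op n) ⊗ₖ twoGate k l u) : FullOp n g r) =
      (Gate.two (.est reg i k) (.est reg i l) hpq ⟨u, hu⟩ : Gate J g r).eval κ H := by
    ext x y
    rw [Gate.eval_two_apply]
    by_cases h : ∀ c, c ≠ Qubit.est reg i k → c ≠ Qubit.est reg i l → readBit x c = readBit y c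
    · have h1 : x.1 = y.1 := funext fun j => h (.sys j) nofun nofun
      have h2 : AgreeOff reg i x y := by
        refine ⟨fun j hj m => h _ ?_ ?_, fun j m => h _ ?_ ?_, h .flag nofun nofun⟩
        · exact fun he => hj (by injection he)
        · exact fun he => hj (by injection he)
        · intro he
          injection he with he
          cases reg <;> cases he
        · intro he
          injection he with he
          cases reg <;> cases he
      rw [if_pos h, blockOp_one_kronecker_apply h1 h2, twoGate, if_pos]
      · rfl
      · intro j hj hj'
        exact h _ (fun he => hj (by injection he)) fun he => hj' (by injection he)
    · rw [if_neg h]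
      by_cases h3 : x.1 = y.1 ∧ AgreeOff reg i x y
      · rw [blockOp_one_kronecker_apply h3.1 h3.2, twoGate, if_neg]
        intro h4
        refine h fun c hc hc' => ?_
        cases c with
        | sys j => exact congrFun h3.1 j
        | flag => exact h3.2.2.2
        | est reg' j m =>
          by_cases hreg : reg' = reg
          · subst hreg
            by_cases hj : j = i
            · subst hj
              exact h4 m (fun hm => hc (by rw [hm])) fun hm => hc' (by rw [hm])
            · exact h3.2.1 j hj m
          · have : reg' = !reg := by cases reg <;> cases reg' <;> simp_all
            subst this
            exact h3.2.2.1 j m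
      · exact blockOp_one_kronecker_apply_of_not h3
  rw [e]
  exact Implementable.two _ _ _ _

lemma implementable_oneGate (reg : Bool) (i : Fin g) (k : Fin r)
    {v : Matrix Bool Bool ℂ} (hv : v ∈ Matrix.unitaryGroup Bool ℂ) :
    Implementable J κ H (blockOp reg i ((1 : Op n) ⊗ₖ oneGate k v) : FullOp n g r) 1 := by
  have hpq : (Qubit.est reg i k : Qubit n g r) ≠ Qubit.flag := nofun
  have hu : v ⊗ₖ (1 : Matrix Bool Bool ℂ) ∈ Matrix.unitaryGroup (Bool × Bool) ℂ :=
    Matrix.kronecker_mem_unitary hv (one_mem _)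
  -- register 4 serves as the second, untouched qubit of the gate
  have e : (blockOp reg i ((1 : Op n) ⊗ₖ oneGate k v) : FullOp n g r) =
      (Gate.two (.est reg i k) .flag hpq ⟨_, hu⟩ : Gate J g r).eval κ H := by
    ext x y
    rw [Gate.eval_two_apply]
    by_cases h : ∀ c, c ≠ Qubit.est reg i k → c ≠ Qubit.flag → readBit x c = readBit y c
    · rw [if_pos h]
      have h1 : x.1 = y.1 := funext fun j => h (.sys j) nofun nofun
      change _ = v (readBit x (.est reg i k)) (readBit y (.est reg i k)) *
        (1 : Matrix Bool Bool ℂ) (readBit x .flag) (readBit y .flag)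
      by_cases hfl : readBit x .flag = readBit y .flag
      · have h2 : AgreeOff reg i x y := by
          refine ⟨fun j hj m => h _ ?_ nofun, fun j m => h _ ?_ nofun, hfl⟩
          · exact fun he => hj (by injection he)
          · intro he
            injection he with he
            cases reg <;> cases he
        rw [blockOp_one_kronecker_apply h1 h2, oneGate, if_pos, hfl, Matrix.one_apply_eq, mul_one]
        · rfl
        · exact fun j hj => h _ (fun he => hj (by injection he)) nofun
      · rw [blockOp_one_kronecker_apply_of_not fun h3 => hfl h3.2.2.2, Matrix.one_apply_ne hfl,
          mul_zero]
    · rw [if_neg h]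
      by_cases h3 : x.1 = y.1 ∧ AgreeOff reg i x y
      · rw [blockOp_one_kronecker_apply h3.1 h3.2, oneGate, if_neg]
        intro h4
        refine h fun c hc hc' => ?_
        cases c with
        | sys j => exact congrFun h3.1 j
        | flag => exact h3.2.2.2
        | est reg' j m =>
          by_cases hreg : reg' = reg
          · subst hreg
            by_cases hj : j = i
            · subst hj
              exact h4 m fun hm => hc (by rw [hm])
            · exact h3.2.1 j hj m
          · have : reg' = !reg := by cases reg <;> cases reg' <;> simp_all
            subst this
            exact h3.2.2.1 j m
      · exact blockOp_one_kronecker_apply_of_not h3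
  rw [e]
  exact Implementable.two _ _ _ _

/-- The controlled powers `∑ₖ U^{m(k)} ⊗ |k⟩⟨k|`. -/
def ctrlPow (U : Op n) (m : Bits r → ℕ) : Matrix (Sys n × Bits r) (Sys n × Bits r) ℂ :=
  fun x y => if x.2 = y.2 then (U ^ m x.2) x.1 y.1 else 0

lemma ctrlPow_add (U : Op n) (m m' : Bits r → ℕ) :
    ctrlPow U (m + m') = ctrlPow U m * ctrlPow U m' := by
  ext ⟨x, b⟩ ⟨y, c⟩
  rw [Matrix.mul_apply, Fintype.sum_prod_type]
  simp only [ctrlPow, ite_mul, zero_mul, Finset.sum_ite_eq, Finset.mem_univ, if_true]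
  split_ifs with h
  · subst h
    rw [Pi.add_apply, pow_add, Matrix.mul_apply]
  · simp

lemma ctrlPow_zero (U : Op n) : ctrlPow U (0 : Bits r → ℕ) = 1 := by
  ext ⟨x, b⟩ ⟨y, c⟩
  rw [ctrlPow]
  simp only [Pi.zero_apply, pow_zero, Matrix.one_apply, Prod.mk.injEq]
  split_ifs <;> simp_all

lemma implementable_ctrl (reg : Bool) (i : Fin g) (k : Fin r) :
    Implementable J κ H (blockOp reg i
      (ctrlPow (evolution κ H) fun b => if b k then 1 else 0) : FullOp n g r) 1 := by
  have e : (blockOp reg i (ctrlPow (evolution κ H) fun b => if b k then 1 else 0) : FullOp n g r) =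
      (Gate.evolve reg i k false : Gate J g r).eval κ H := by
    ext x y
    rw [Gate.eval_evolve_apply, blockOp_apply]
    by_cases h : x.2 = y.2
    · have h1 : AgreeOff reg i x y := by
        refine ⟨fun j _ m => ?_, fun j m => ?_, ?_⟩ <;> simp only [readBit, h]
      have h2 : readBlock reg i x = readBlock reg i y := by
        funext m
        simp only [readBlock, readBit, h]
      rw [if_pos h1, if_pos h, ctrlPow, if_pos h2]
      change (evolution κ H ^ (if readBit x (.est reg i k) = true then 1 else 0)) x.1 y.1 =
        (if readBit x (.est reg i k) = true then evolution κ H else 1) x.1 y.1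
      cases readBit x (.est reg i k)
      · exact congrFun (congrFun (pow_zero (evolution κ H)) x.1) y.1
      · exact congrFun (congrFun (pow_one (evolution κ H)) x.1) y.1
    · rw [if_neg h]
      split_ifs with h1
      · rw [ctrlPow, if_neg]
        intro h2
        refine h ?_
        have h3 : ∀ reg' j m, readBit x (.est reg' j m) = readBit y (.est reg' j m) := by
          intro reg' j m
          by_cases hreg : reg' = reg
          · subst hreg
            by_cases hj : j = i
            · subst hj
              exact congrFun h2 m
            · exact h1.1 j hj m
          · have : reg' = !reg := by cases reg <;> cases reg' <;> simp_all
            subst this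
            exact h1.2.1 j m
        refine Prod.ext (funext fun j => funext fun m => h3 false j m) (Prod.ext ?_ h1.2.2)
        exact funext fun j => funext fun m => h3 true j m
      · rfl
  rw [e]
  exact Implementable.evolve reg i k

lemma implementable_ctrl_nsmul (reg : Bool) (i : Fin g) (k : Fin r) (N : ℕ) :
    Implementable J κ H (blockOp reg i
      (ctrlPow (evolution κ H) fun b => if b k then N else 0) : FullOp n g r) N := by
  induction N with
  | zero =>
    have : (fun b : Bits r => if b k then 0 else 0) = 0 := by
      funext b
      simp
    rw [this, ctrlPow_zero, blockOp_one]
    exact Implementable.one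
  | succ N ih =>
    have : (fun b : Bits r => if b k then N + 1 else 0) =
        (fun b : Bits r => if b k then N else 0) + fun b => if b k then 1 else 0 := by
      funext b
      simp only [Pi.add_apply]
      split_ifs <;> rfl
    rw [this, ctrlPow_add, blockOp_mul]
    exact ih.mul (implementable_ctrl reg i k)

lemma implementable_ctrl_sum (reg : Bool) (i : Fin g) (s : Finset (Fin r)) (m : Fin r → ℕ) :
    Implementable J κ H (blockOp reg i (ctrlPow (evolution κ H) fun b =>
      ∑ j ∈ s, if b j then m j else 0) : FullOp n g r) (∑ j ∈ s, m j) := by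
  induction s using Finset.induction_on with
  | empty =>
    have : (fun b : Bits r => ∑ j ∈ (∅ : Finset (Fin r)), if b j then m j else 0) = 0 := by
      funext b
      simp
    rw [this, ctrlPow_zero, blockOp_one]
    exact Implementable.one
  | insert k s hk ih =>
    have : (fun b : Bits r => ∑ j ∈ insert k s, if b j then m j else 0) =
        (fun b => if b k then m k else 0) + fun b => ∑ j ∈ s, if b j then m j else 0 := by
      funext b
      rw [Finset.sum_insert hk]
      rfl
    rw [this, ctrlPow_add, blockOp_mul, Finset.sum_insert hk]
    exact (implementable_ctrl_nsmul reg i k (m k)).mul ih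

lemma implementable_ctrlPowers (reg : Bool) (i : Fin g) :
    Implementable J κ H (blockOp reg i (ctrlPowers r (evolution κ H)) : FullOp n g r) (2 ^ r) := by
  refine (implementable_ctrl_sum reg i Finset.univ fun j => 2 ^ (j : ℕ)).mono ?_
  rw [Fin.sum_univ_eq_sum_range fun j => 2 ^ j]
  have := Nat.geomSum_lt (m := 2) (n := r) (s := Finset.range r) le_rfl fun k hk =>
    Finset.mem_range.1 hk
  exact this.le

end Circuits

/-! ### Circuits for the quantum Fourier transform -/

section Fourier

variable {n g r : ℕ} {J : JumpEnsemble n} {κ : ℝ} {H : Op n} {reg : Bool} {i : Fin g}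

lemma Implementable.kronecker_mul {G G' : Matrix (Bits r) (Bits r) ℂ} {N N' : ℕ}
    (h : Implementable J κ H (blockOp reg i ((1 : Op n) ⊗ₖ G) : FullOp n g r) N)
    (h' : Implementable J κ H (blockOp reg i ((1 : Op n) ⊗ₖ G') : FullOp n g r) N') :
    Implementable J κ H (blockOp reg i ((1 : Op n) ⊗ₖ (G * G')) : FullOp n g r) (N + N') := by
  have e : (1 : Op n) ⊗ₖ (G * G') = ((1 : Op n) ⊗ₖ G) * ((1 : Op n) ⊗ₖ G') := by
    rw [← Matrix.mul_kronecker_mul, Matrix.one_mul]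
  rw [e, blockOp_mul]
  exact h.mul h'

lemma Implementable.kronecker_one :
    Implementable J κ H (blockOp reg i ((1 : Op n) ⊗ₖ (1 : Matrix (Bits r) (Bits r) ℂ)) :
      FullOp n g r) 0 := by
  rw [Matrix.one_kronecker_one, blockOp_one]
  exact Implementable.one

/-- The tensor product of one-qubit operators. -/
def prodMat (v : Fin r → Matrix Bool Bool ℂ) : Matrix (Bits r) (Bits r) ℂ :=
  fun b k => ∏ j, v j (b j) (k j)

lemma prodMat_mul (v w : Fin r → Matrix Bool Bool ℂ) :
    prodMat v * prodMat w = prodMat fun j => v j * w j := by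
  ext b k
  rw [Matrix.mul_apply]
  simp only [prodMat, ← Finset.prod_mul_distrib, Matrix.mul_apply]
  rw [Fintype.prod_sum fun (j : Fin r) (c : Bool) => v j (b j) c * w j c (k j)]

lemma oneGate_eq_prodMat (k : Fin r) (v : Matrix Bool Bool ℂ) :
    oneGate k v = prodMat fun j => if j = k then v else 1 := by
  ext b c
  rw [oneGate, prodMat]
  split_ifs with h
  · rw [Finset.prod_eq_single k (fun j _ hj => ?_) fun h' => absurd (Finset.mem_univ k) h']
    · rw [if_pos rfl]
    · rw [if_neg hj, h j hj, Matrix.one_apply_eq]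
  · push Not at h
    obtain ⟨j, hj, hne⟩ := h
    symm
    refine Finset.prod_eq_zero (Finset.mem_univ j) ?_
    rw [if_neg hj, Matrix.one_apply_ne hne]

lemma prodMat_one : prodMat (fun _ : Fin r => (1 : Matrix Bool Bool ℂ)) = 1 := by
  ext b c
  rw [prodMat]
  by_cases h : b = c
  · subst h
    simp
  · obtain ⟨j, hj⟩ := Function.ne_iff.1 h
    rw [Matrix.one_apply_ne h]
    exact Finset.prod_eq_zero (Finset.mem_univ j) (Matrix.one_apply_ne hj)

lemma implementable_prodMat (v : Fin r → Matrix Bool Bool ℂ)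
    (hv : ∀ j, v j ∈ Matrix.unitaryGroup Bool ℂ) (s : Finset (Fin r)) :
    Implementable J κ H (blockOp reg i ((1 : Op n) ⊗ₖ
      prodMat fun j => if j ∈ s then v j else 1) : FullOp n g r) s.card := by
  induction s using Finset.induction_on with
  | empty =>
    simp only [Finset.notMem_empty, if_false, prodMat_one, Finset.card_empty]
    exact Implementable.kronecker_one
  | insert k s hk ih =>
    have e : (prodMat fun j => if j ∈ insert k s then v j else 1) =
        oneGate k (v k) * prodMat fun j => if j ∈ s then v j else 1 := by
      rw [oneGate_eq_prodMat, prodMat_mul]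
      congr 1
      funext j
      by_cases hj : j = k
      · subst hj
        simp [hk]
      · simp [hj]
    rw [e, Finset.card_insert_of_notMem hk, add_comm]
    exact (implementable_oneGate reg i k (hv k)).kronecker_mul ih

/-- The Hadamard matrix. -/
def hadamard : Matrix Bool Bool ℂ := fun b k => (if b && k then (-1 : ℂ) else 1) / (Real.sqrt 2 : ℂ)

lemma hadamard_apply (b k : Bool) :
    hadamard b k = (if b && k then (-1 : ℂ) else 1) / (Real.sqrt 2 : ℂ) := rfl

lemma hadamard_unitary : hadamard ∈ Matrix.unitaryGroup Bool ℂ := by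
  have hs : ((Real.sqrt 2 : ℝ) : ℂ) * (Real.sqrt 2 : ℝ) = 2 := by
    rw [← Complex.ofReal_mul, Real.mul_self_sqrt zero_le_two, Complex.ofReal_ofNat]
  rw [Matrix.mem_unitaryGroup_iff]
  ext b k
  rw [Matrix.mul_apply, Fintype.sum_bool, Matrix.star_apply, Matrix.star_apply]
  simp only [hadamard_apply, star_div₀, Complex.star_def, Complex.conj_ofReal, div_mul_div_comm, hs]
  cases b <;> cases k <;> norm_num

lemma implementable_hadamardLayer : Implementable J κ H
    (blockOp reg i ((1 : Op n) ⊗ₖ hadamardLayer r) : FullOp n g r) r := by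
  have h := implementable_prodMat (J := J) (κ := κ) (H := H) (reg := reg) (i := i)
    (fun _ : Fin r => hadamard) (fun _ => hadamard_unitary) Finset.univ
  simp only [Finset.mem_univ, if_true, Finset.card_univ, Fintype.card_fin] at h
  exact h

/-- The permutation of the qubits of a block. -/
def permMat (σ : Equiv.Perm (Fin r)) : Matrix (Bits r) (Bits r) ℂ :=
  fun b c => if c = b ∘ σ then 1 else 0

lemma permMat_mul_apply (σ : Equiv.Perm (Fin r)) (M : Matrix (Bits r) (Bits r) ℂ) (b c : Bits r) :
    (permMat σ * M) b c = M (b ∘ σ) c := by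
  rw [Matrix.mul_apply]
  simp only [permMat, ite_mul, one_mul, zero_mul, Finset.sum_ite_eq', Finset.mem_univ, if_true]

lemma permMat_mul (σ τ : Equiv.Perm (Fin r)) : permMat σ * permMat τ = permMat (σ * τ) := by
  ext b c
  rw [permMat_mul_apply]
  rfl

lemma permMat_one : permMat (1 : Equiv.Perm (Fin r)) = 1 := by
  ext b c
  rw [permMat, Matrix.one_apply]
  exact if_congr eq_comm rfl rfl

/-- The gate that swaps two qubits. -/
def swapGate : Matrix (Bool × Bool) (Bool × Bool) ℂ :=
  fun x y => if x.1 = y.2 ∧ x.2 = y.1 then 1 else 0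

lemma swapGate_apply (x y : Bool × Bool) :
    swapGate x y = if x.1 = y.2 ∧ x.2 = y.1 then 1 else 0 := rfl

lemma swapGate_unitary : swapGate ∈ Matrix.unitaryGroup (Bool × Bool) ℂ := by
  rw [Matrix.mem_unitaryGroup_iff]
  ext ⟨a, b⟩ ⟨c, d⟩
  rw [Matrix.mul_apply, Fintype.sum_prod_type]
  simp only [Fintype.sum_bool, Matrix.star_apply, swapGate_apply, Matrix.one_apply, Prod.mk.injEq]
  cases a <;> cases b <;> cases c <;> cases d <;> simp

lemma permMat_swap (k l : Fin r) :
    permMat (Equiv.swap k l) = twoGate k l swapGate := by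
  ext b c
  rw [permMat, twoGate]
  by_cases h : c = b ∘ Equiv.swap k l
  · have hk : c k = b l := by rw [h, Function.comp_apply, Equiv.swap_apply_left]
    have hl : c l = b k := by rw [h, Function.comp_apply, Equiv.swap_apply_right]
    rw [if_pos h, if_pos, swapGate_apply, if_pos ⟨hl.symm, hk.symm⟩]
    intro j hj hj'
    rw [h, Function.comp_apply, Equiv.swap_apply_of_ne_of_ne hj hj']
  · rw [if_neg h]
    split_ifs with h1
    · rw [swapGate_apply, if_neg]
      rintro ⟨h2, h3⟩
      refine h (funext fun j => ?_)
      rw [Function.comp_apply]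
      by_cases hj : j = k
      · rw [hj, Equiv.swap_apply_left]
        exact h3.symm
      · by_cases hj' : j = l
        · rw [hj', Equiv.swap_apply_right]
          exact h2.symm
        · rw [Equiv.swap_apply_of_ne_of_ne hj hj']
          exact (h1 j hj hj').symm
    · rfl

lemma implementable_permMat (σ : Equiv.Perm (Fin r)) : Implementable J κ H
    (blockOp reg i ((1 : Op n) ⊗ₖ permMat σ) : FullOp n g r) r := by
  -- a permutation is a product of at most as many swaps as it moves points
  suffices h : ∀ m, ∀ σ : Equiv.Perm (Fin r), σ.support.card ≤ m → Implementable J κ H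
      (blockOp reg i ((1 : Op n) ⊗ₖ permMat σ) : FullOp n g r) m from
    h r σ ((Finset.card_le_univ _).trans_eq (Fintype.card_fin r))
  intro m
  induction m with
  | zero =>
    intro σ hσ
    rw [Equiv.Perm.card_support_eq_zero.1 (Nat.le_zero.1 hσ), permMat_one]
    exact Implementable.kronecker_one
  | succ m ih =>
    intro σ hσ
    by_cases h1 : σ = 1
    · rw [h1, permMat_one]
      exact Implementable.kronecker_one.mono (Nat.zero_le _)
    · obtain ⟨x, hx⟩ : ∃ x, σ x ≠ x := by
        by_contra! h
        exact h1 (Equiv.ext h)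
      have hlt := Equiv.Perm.card_support_swap_mul hx
      have e : permMat σ = twoGate x (σ x) swapGate * permMat (Equiv.swap x (σ x) * σ) := by
        rw [← permMat_swap, permMat_mul, ← mul_assoc, Equiv.swap_mul_self, one_mul]
      rw [e, add_comm]
      exact (implementable_twoGate reg i hx.symm swapGate_unitary).kronecker_mul
        (ih _ (by omega))

/-- The phase `exp(2πi 2^j / 2^{i+1})` of the controlled rotations. -/
def rotPhase (i j : Fin r) : ℂ :=
  Complex.exp (2 * Real.pi * Complex.I * 2 ^ (j : ℕ) / 2 ^ ((i : ℕ) + 1))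

/-- A controlled rotation. -/
def ctrlPhase (i j : Fin r) (b c : Bool) : ℂ := if b && c then rotPhase i j else 1

lemma norm_ctrlPhase (i j : Fin r) (b c : Bool) : ‖ctrlPhase i j b c‖ = 1 := by
  rw [ctrlPhase]
  split_ifs
  · have : 2 * Real.pi * Complex.I * 2 ^ (j : ℕ) / 2 ^ ((i : ℕ) + 1) =
        ((2 * Real.pi * 2 ^ (j : ℕ) / 2 ^ ((i : ℕ) + 1) : ℝ) : ℂ) * Complex.I := by
      push_cast
      ring
    rw [rotPhase, this, Complex.norm_exp_ofReal_mul_I]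
  · exact norm_one

lemma twoGate_diagonal (k l : Fin r) (ψ : Bool × Bool → ℂ) :
    twoGate k l (Matrix.diagonal ψ) = Matrix.diagonal fun b => ψ (b k, b l) := by
  ext b c
  rw [twoGate]
  by_cases h : b = c
  · subst h
    rw [if_pos fun _ _ _ => rfl, Matrix.diagonal_apply_eq, Matrix.diagonal_apply_eq]
  · rw [Matrix.diagonal_apply_ne _ h]
    split_ifs with h1
    · refine Matrix.diagonal_apply_ne _ fun h2 => h (funext fun j => ?_)
      rw [Prod.mk.injEq] at h2
      by_cases hj : j = k
      · rw [hj]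
        exact h2.1
      · by_cases hj' : j = l
        · rw [hj']
          exact h2.2
        · exact h1 j hj hj'
    · rfl

lemma implementable_phases (s : Fin r) (S : Finset (Fin r)) (hS : s ∉ S) : Implementable J κ H
    (blockOp reg i ((1 : Op n) ⊗ₖ Matrix.diagonal fun b : Bits r =>
      ∏ j ∈ S, ctrlPhase s j (b s) (b j)) : FullOp n g r) S.card := by
  induction S using Finset.induction_on with
  | empty =>
    simp only [Finset.prod_empty, Finset.card_empty, Matrix.diagonal_one]
    exact Implementable.kronecker_one
  | insert k S hk ih =>
    rw [Finset.mem_insert, not_or] at hS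
    have e : (Matrix.diagonal fun b : Bits r => ∏ j ∈ insert k S, ctrlPhase s j (b s) (b j)) =
        twoGate s k (Matrix.diagonal fun x => ctrlPhase s k x.1 x.2) *
          Matrix.diagonal fun b : Bits r => ∏ j ∈ S, ctrlPhase s j (b s) (b j) := by
      rw [twoGate_diagonal, Matrix.diagonal_mul_diagonal]
      congr 1
      funext b
      rw [Finset.prod_insert hk]
    have hu : Matrix.diagonal (fun x : Bool × Bool => ctrlPhase s k x.1 x.2) ∈
        Matrix.unitaryGroup (Bool × Bool) ℂ := by
      rw [Matrix.mem_unitaryGroup_iff, Matrix.star_eq_conjTranspose, Matrix.diagonal_conjTranspose,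
        Matrix.diagonal_mul_diagonal, ← Matrix.diagonal_one]
      congr 1
      funext x
      rw [Pi.star_apply, Complex.star_def, Complex.mul_conj', norm_ctrlPhase]
      norm_num
    rw [e, Finset.card_insert_of_notMem hk, add_comm]
    exact (implementable_twoGate reg i hS.1 hu).kronecker_mul (ih hS.2)

lemma oneGate_mul_apply (s : Fin r) (v : Matrix Bool Bool ℂ) (M : Matrix (Bits r) (Bits r) ℂ)
    (b k : Bits r) :
    (oneGate s v * M) b k = ∑ β, v (b s) β * M (Function.update b s β) k := by
  rw [Matrix.mul_apply]
  symm
  refine Fintype.sum_of_injective (fun β => Function.update b s β) ?_ _ _ ?_ ?_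
  · intro β γ h
    have := congrFun h s
    simpa using this
  · intro c hc
    rw [oneGate, if_neg, zero_mul]
    refine fun h => hc ⟨c s, funext fun j => ?_⟩
    change Function.update b s (c s) j = c j
    by_cases hj : j = s
    · subst hj
      simp
    · rw [Function.update_of_ne hj, h j hj]
  · intro β
    rw [oneGate, if_pos fun j hj => (Function.update_of_ne hj _ _).symm, Function.update_self]

/-- The factor contributed by output bit `i` to the Fourier transform with reversed output. -/
def fourierFactor (i : Fin r) (β : Bool) (k : Bits r) : ℂ :=
  hadamard β (k i) * ∏ j ∈ Finset.univ.filter (· < i), ctrlPhase i j β (k j)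

/-- The Fourier transform with reversed output, carried out on the qubits from `s` on. -/
def fourierStage (r s : ℕ) : Matrix (Bits r) (Bits r) ℂ :=
  fun b k => ∏ i : Fin r, if s ≤ i then fourierFactor i (b i) k else if b i = k i then 1 else 0

lemma fourierStage_self : fourierStage r r = 1 := by
  ext b k
  rw [fourierStage]
  have : ∀ i : Fin r, ¬ r ≤ i := fun i => by omega
  simp only [this, if_false]
  by_cases h : b = k
  · subst h
    simp
  · obtain ⟨j, hj⟩ := Function.ne_iff.1 h
    rw [Matrix.one_apply_ne h]
    exact Finset.prod_eq_zero (Finset.mem_univ j) (if_neg hj)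

/-- The stage at qubit `s` is a Hadamard gate followed by rotations controlled by the lower qubits,
which the later stages have left unchanged. -/
lemma fourierStage_succ (s : Fin r) : fourierStage r s =
    Matrix.diagonal (fun b : Bits r =>
      ∏ j ∈ Finset.univ.filter (· < s), ctrlPhase s j (b s) (b j)) *
    (oneGate s hadamard * fourierStage r (s + 1)) := by
  ext b k
  rw [Matrix.diagonal_mul, oneGate_mul_apply]
  set F : Fin r → ℂ := fun i =>
    if (s : ℕ) + 1 ≤ i then fourierFactor i (b i) k else if b i = k i then 1 else 0 with hF
  have h1 : ∀ β, fourierStage r (s + 1) (Function.update b s β) k =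
      (if β = k s then 1 else 0) * ∏ i ∈ Finset.univ.erase s, F i := fun β => by
    rw [fourierStage, ← Finset.mul_prod_erase Finset.univ _ (Finset.mem_univ s)]
    congr 1
    · rw [if_neg (by omega), Function.update_self]
    · refine Finset.prod_congr rfl fun i hi => ?_
      rw [Function.update_of_ne (Finset.ne_of_mem_erase hi)]
  have h2 : fourierStage r s b k = fourierFactor s (b s) k * ∏ i ∈ Finset.univ.erase s, F i := by
    rw [fourierStage, ← Finset.mul_prod_erase Finset.univ _ (Finset.mem_univ s), if_pos le_rfl]
    congr 1
    refine Finset.prod_congr rfl fun i hi => ?_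
    have hne : (i : ℕ) ≠ s := fun h => Finset.ne_of_mem_erase hi (Fin.ext h)
    simp only [hF]
    by_cases h : (s : ℕ) ≤ i
    · rw [if_pos h, if_pos (by omega)]
    · rw [if_neg h, if_neg (show ¬ (s : ℕ) + 1 ≤ i by omega)]
  rw [h2]
  simp only [h1, ite_mul, one_mul, zero_mul, mul_ite, mul_zero, Finset.sum_ite_eq',
    Finset.mem_univ, if_true]
  by_cases h : ∀ j, j < s → b j = k j
  · rw [fourierFactor]
    have : ∏ j ∈ Finset.univ.filter (· < s), ctrlPhase s j (b s) (b j) =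
        ∏ j ∈ Finset.univ.filter (· < s), ctrlPhase s j (b s) (k j) :=
      Finset.prod_congr rfl fun j hj => by rw [h j (Finset.mem_filter.1 hj).2]
    rw [this]
    ring
  · push Not at h
    obtain ⟨j, hj, hne⟩ := h
    have : ∏ i ∈ Finset.univ.erase s, F i = 0 := by
      refine Finset.prod_eq_zero (Finset.mem_erase.2 ⟨hj.ne, Finset.mem_univ j⟩) ?_
      simp only [hF]
      rw [if_neg (by have := Fin.lt_def.1 hj; omega), if_neg hne]
    rw [this]
    ring

lemma implementable_fourierStage (m : ℕ) (hm : m ≤ r) : Implementable J κ H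
    (blockOp reg i ((1 : Op n) ⊗ₖ fourierStage r (r - m)) : FullOp n g r) (m * (r + 1)) := by
  induction m with
  | zero =>
    rw [Nat.sub_zero, fourierStage_self, zero_mul]
    exact Implementable.kronecker_one
  | succ m ih =>
    obtain ⟨s, hs⟩ : ∃ s : Fin r, (s : ℕ) = r - (m + 1) := ⟨⟨r - (m + 1), by omega⟩, rfl⟩
    have hs1 : r - m = s + 1 := by omega
    have ih' := ih (by omega)
    rw [hs1] at ih'
    rw [← hs, fourierStage_succ]
    refine ((implementable_phases s _ (by simp)).kronecker_mul
      ((implementable_oneGate reg i s hadamard_unitary).kronecker_mul ih')).mono ?_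
    have : (Finset.univ.filter (· < s)).card ≤ r :=
      (Finset.card_le_univ _).trans_eq (Fintype.card_fin r)
    rw [add_mul]
    omega

open Complex in
/-- The textbook circuit of the quantum Fourier transform; its output comes in reversed order. -/
lemma qft_eq : qft r = permMat Fin.revPerm * fourierStage r 0 := by
  ext b k
  rw [permMat_mul_apply, fourierStage, qft]
  simp only [Nat.zero_le, if_true]
  have hbit : ∀ c : Bits r, ((c.val : ℕ) : ℂ) = ∑ j, (if c j then 1 else 0) * 2 ^ (j : ℕ) :=
    fun c => by
      rw [Bits.val]
      push_cast
      refine Finset.sum_congr rfl fun j _ => ?_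
      split_ifs <;> simp
  -- the phase is a product over pairs of bits
  have hexp : exp (2 * Real.pi * I * (b.val * k.val : ℕ) / (2 ^ r : ℂ)) =
      ∏ i : Fin r, ∏ j : Fin r, ctrlPhase i j (b (Fin.rev i)) (k j) := by
    have e : 2 * Real.pi * I * (b.val * k.val : ℕ) / (2 ^ r : ℂ) = ∑ i : Fin r, ∑ j : Fin r,
        ((if b (Fin.rev i) then 1 else 0) * (if k j then 1 else 0)) *
          (2 * Real.pi * I * 2 ^ (j : ℕ) / 2 ^ ((i : ℕ) + 1)) := by
      push_cast
      rw [hbit, hbit, ← Equiv.sum_comp Fin.revPerm, Finset.sum_mul_sum, Finset.mul_sum,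
        Finset.sum_div]
      refine Finset.sum_congr rfl fun i _ => ?_
      rw [Finset.mul_sum, Finset.sum_div]
      refine Finset.sum_congr rfl fun j _ => ?_
      have h2 : (2 : ℂ) ^ r = 2 ^ ((Fin.rev i : Fin r) : ℕ) * 2 ^ ((i : ℕ) + 1) := by
        rw [← pow_add, Fin.val_rev]
        congr 1
        omega
      rw [h2, Fin.revPerm_apply]
      field_simp
    rw [e, exp_sum]
    refine Finset.prod_congr rfl fun i _ => ?_
    rw [exp_sum]
    refine Finset.prod_congr rfl fun j _ => ?_
    rw [ctrlPhase, rotPhase]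
    cases b (Fin.rev i) <;> cases k j <;> simp
  have hsq : ((Real.sqrt (2 ^ r) : ℝ) : ℂ) = ∏ _i : Fin r, ((Real.sqrt 2 : ℝ) : ℂ) := by
    rw [Finset.prod_const, Finset.card_univ, Fintype.card_fin, ← Complex.ofReal_pow]
    congr 1
    rw [Real.sqrt_eq_iff_eq_sq (by positivity) (by positivity), ← pow_mul, mul_comm, pow_mul,
      Real.sq_sqrt (by norm_num)]
  rw [hexp, hsq, ← Finset.prod_div_distrib]
  refine Finset.prod_congr rfl fun i _ => ?_
  rw [fourierFactor, hadamard_apply, Function.comp_apply, Fin.revPerm_apply]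
  -- bits above `i` give a trivial phase, bit `i` the sign of the Hadamard gate
  have hterm : ∀ j : Fin r, ctrlPhase i j (b (Fin.rev i)) (k j) =
      (if j < i then ctrlPhase i j (b (Fin.rev i)) (k j) else 1) *
      (if j = i then (if b (Fin.rev i) && k i then (-1 : ℂ) else 1) else 1) := fun j => by
    rcases lt_trichotomy j i with h | h | h
    · rw [if_pos h, if_neg h.ne, mul_one]
    · subst h
      rw [if_neg (lt_irrefl _), if_pos rfl, one_mul, ctrlPhase]
      have : rotPhase j j = -1 := by
        rw [rotPhase, pow_succ, ← exp_pi_mul_I]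
        congr 1
        field_simp
      rw [this]
    · rw [if_neg h.not_gt, if_neg h.ne', one_mul, ctrlPhase]
      have : rotPhase i j = 1 := by
        obtain ⟨d, hd⟩ : ∃ d : ℕ, (j : ℕ) = (i : ℕ) + 1 + d :=
          ⟨j - (i + 1), by have := Fin.lt_def.1 h; omega⟩
        rw [rotPhase, exp_eq_one_iff]
        refine ⟨2 ^ d, ?_⟩
        rw [hd, pow_add]
        push_cast
        field_simp
      rw [this, ite_self]
  rw [Finset.prod_congr rfl fun j _ => hterm j, Finset.prod_mul_distrib, Finset.prod_ite_eq',
    if_pos (Finset.mem_univ i), ← Finset.prod_filter]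
  ring

lemma implementable_qft : Implementable J κ H
    (blockOp reg i ((1 : Op n) ⊗ₖ qft r) : FullOp n g r) (r + r * (r + 1)) := by
  rw [qft_eq]
  have h := implementable_fourierStage (J := J) (κ := κ) (H := H) (reg := reg) (i := i) r le_rfl
  rw [Nat.sub_self] at h
  exact (implementable_permMat _).kronecker_mul h

/-- Cost of one run of phase estimation. -/
def qpeCost (r : ℕ) : ℕ := 2 ^ r + r * (r + 3)

lemma implementable_qpe (flip : Bool) : Implementable J κ H
    (blockOp reg i (qpe κ H r flip) : FullOp n g r) (qpeCost r) := by
  have hh := implementable_hadamardLayer (r := r) (J := J) (κ := κ) (H := H) (reg := reg) (i := i)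
  have hc := implementable_ctrlPowers (r := r) (J := J) (κ := κ) (H := H) reg i
  have hq := implementable_qft (r := r) (J := J) (κ := κ) (H := H) (reg := reg) (i := i)
  have hN : r + r * (r + 1) + 2 ^ r + r ≤ qpeCost r := by
    rw [qpeCost]
    nlinarith
  cases flip
  · have e : qpe κ H r false = ((1 : Op n) ⊗ₖ qft r)ᴴ * ctrlPowers r (evolution κ H) *
        ((1 : Op n) ⊗ₖ hadamardLayer r) := by
      rw [Matrix.conjTranspose_kronecker, Matrix.conjTranspose_one]
      rfl
    rw [e, blockOp_mul, blockOp_mul, ← blockOp_conjTranspose]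
    exact ((hq.conjTranspose.mul hc).mul hh).mono hN
  · have e : qpe κ H r true = ((1 : Op n) ⊗ₖ qft r) * (ctrlPowers r (evolution κ H))ᴴ *
        ((1 : Op n) ⊗ₖ hadamardLayer r) := rfl
    rw [e, blockOp_mul, blockOp_mul, ← blockOp_conjTranspose]
    exact ((hq.mul hc.conjTranspose).mul hh).mono hN

lemma onReg2_list_prod (l : List (Matrix (Sys n × Est g r) (Sys n × Est g r) ℂ)) :
    (onReg2 l.prod : FullOp n g r) = (l.map onReg2).prod := by
  induction l with
  | nil => exact onReg2_one
  | cons Q l ih => rw [List.prod_cons, onReg2_mul, ih, List.map_cons, List.prod_cons]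

lemma onReg3_list_prod (l : List (Matrix (Sys n × Est g r) (Sys n × Est g r) ℂ)) :
    (onReg3 l.prod : FullOp n g r) = (l.map onReg3).prod := by
  induction l with
  | nil => exact onReg3_one
  | cons Q l ih => rw [List.prod_cons, onReg3_mul, ih, List.map_cons, List.prod_cons]

lemma implementable_boostedQPE (flip : Bool) :
    Implementable J κ H (onReg2 (boostedQPE κ H g r flip)) (g * qpeCost r) ∧
    Implementable J κ H (onReg3 (boostedQPE κ H g r flip)) (g * qpeCost r) := by
  rw [boostedQPE, onReg2_list_prod, onReg3_list_prod, List.map_ofFn, List.map_ofFn]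
  constructor
  · have h := Implementable.list_prod (J := J) (κ := κ) (H := H) (N := qpeCost r)
      (List.ofFn fun i : Fin g => (blockOp false i (qpe κ H r flip) : FullOp n g r)) fun M hM => by
        obtain ⟨i, rfl⟩ := (List.mem_ofFn' _ _).1 hM
        exact implementable_qpe flip
    rwa [List.length_ofFn] at h
  · have h := Implementable.list_prod (J := J) (κ := κ) (H := H) (N := qpeCost r)
      (List.ofFn fun i : Fin g => (blockOp true i (qpe κ H r flip) : FullOp n g r)) fun M hM => by
        obtain ⟨i, rfl⟩ := (List.mem_ofFn' _ _).1 hM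
        exact implementable_qpe flip
    rwa [List.length_ofFn] at h

lemma implementable_unitaryU (flip : Bool) {C : Op n} (hC : C ∈ J.ops) :
    Implementable J κ H (unitaryU κ H g r flip C) (2 * (g * qpeCost r) + 1) := by
  obtain ⟨h2, h3⟩ := implementable_boostedQPE (g := g) (r := r) (J := J) (κ := κ) (H := H) flip
  rw [unitaryU]
  exact ((h3.mul (Implementable.jump hC)).mul h2).mono (by omega)

end Fourier

/-! ### Parameters and running time -/

section Parameters

lemma iterationCost_le {n g r : ℕ} {J : JumpEnsemble n} (hg : 0 < g) {h c w : ℕ}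
    {l l' : List (Gate J g r)}
    (hl : circuitCost h c l ≤ (2 * (g * qpeCost r) + 1) * (1 + h + c))
    (hl' : circuitCost h c l' ≤ (2 * (g * qpeCost r) + 1) * (1 + h + c)) :
    iterationCost h c w l l' ≤
      4 * g * ((2 ^ r) ^ 2 + 5 * 2 ^ r + 2) * (1 + h + c + w) := by
  have hr : r ≤ 2 ^ r := Nat.lt_two_pow_self.le
  obtain ⟨X, hX⟩ : ∃ X, X = 2 ^ r := ⟨_, rfl⟩
  obtain ⟨S, hS⟩ : ∃ S, S = 1 + h + c := ⟨_, rfl⟩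
  have hS1 : 1 ≤ S := by omega
  have hq : qpeCost r ≤ X ^ 2 + 4 * X := by
    rw [qpeCost, ← hX]
    rw [← hX] at hr
    nlinarith
  rw [iterationCost, ← hX, ← hS]
  rw [← hX] at hr
  rw [← hS] at hl hl'
  have h1 : g * qpeCost r * S ≤ g * (X ^ 2 + 4 * X) * S := by gcongr
  have h2 : g * r ≤ g * X * S := by nlinarith [Nat.mul_le_mul_left g hr, Nat.zero_le (g * X)]
  have h3 : S ≤ g * S := Nat.le_mul_of_pos_left S hg
  have h4 : w ≤ g * w := Nat.le_mul_of_pos_left w hg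
  have h5 : 0 ≤ g * X ^ 2 * w := Nat.zero_le _
  have h6 : 0 ≤ g * X * w := Nat.zero_le _
  have h7 : 0 ≤ g * X * S := Nat.zero_le _
  have e : 4 * g * (X ^ 2 + 5 * X + 2) * (S + w) = 4 * (g * (X ^ 2 + 4 * X) * S) +
      4 * (g * X * S) + 8 * (g * S) + 4 * (g * X ^ 2 * w) + 20 * (g * X * w) + 8 * (g * w) := by
    ring
  have e2 : (2 * (g * qpeCost r) + 1) * S = 2 * (g * qpeCost r * S) + S := by ring
  have e3 : 2 * g * r = 2 * (g * r) := by ring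
  rw [e, e3]
  rw [e2] at hl hl'
  omega

lemma precisionOK_of_le {r : ℕ} {κ β : ℝ} (hκ : 0 < κ) (hβ : 0 ≤ β) (h : 2 * (κ * β) ≤ 2 ^ r) :
    PrecisionOK r κ β := by
  rcases hβ.eq_or_lt with rfl | hβ
  · exact Or.inl rfl
  right
  have e : 1 + Real.logb 2 κ + Real.logb 2 β = Real.logb 2 (2 * (κ * β)) := by
    rw [Real.logb_mul two_ne_zero (by positivity), Real.logb_mul hκ.ne' hβ.ne',
      Real.logb_self_eq_one one_lt_two]
    ring
  rw [e, Real.logb_le_iff_le_rpow one_lt_two (by positivity), Real.rpow_natCast]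
  exact h

/-- A power of two between `y` and `2 y`, with its exponent. -/
lemma exists_two_pow {y : ℝ} (hy : 1 ≤ y) :
    ∃ m : ℕ, y ≤ 2 ^ m ∧ (2 : ℝ) ^ m ≤ 2 * y ∧ (m : ℝ) ≤ Real.logb 2 y + 1 := by
  have hy0 : 0 < y := by linarith
  have hlog : 0 ≤ Real.logb 2 y := Real.logb_nonneg one_lt_two hy
  have h1 := Nat.le_ceil (Real.logb 2 y)
  have h2 := (Nat.ceil_lt_add_one hlog).le
  refine ⟨⌈Real.logb 2 y⌉₊, ?_, ?_, h2⟩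
  · rw [Real.logb_le_iff_le_rpow one_lt_two hy0, Real.rpow_natCast] at h1
    exact h1
  · have h3 : (⌈Real.logb 2 y⌉₊ : ℝ) ≤ Real.logb 2 (2 * y) := by
      rw [Real.logb_mul two_ne_zero hy0.ne', Real.logb_self_eq_one one_lt_two]
      linarith
    rwa [Real.le_logb_iff_rpow_le one_lt_two (by positivity), Real.rpow_natCast] at h3

lemma logb_two_le_self {y : ℝ} (hy : 1 ≤ y) : Real.logb 2 y ≤ y := by
  rw [Real.logb_le_iff_le_rpow one_lt_two (by linarith)]
  have h := one_add_mul_self_le_rpow_one_add (s := 1) (by norm_num) hy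
  norm_num at h
  linarith

lemma exp_four_lt : Real.exp 4 < 55 := by
  have h := Real.exp_one_lt_d9
  have e : Real.exp 4 = Real.exp 1 ^ 4 := by
    rw [← Real.exp_nat_mul]
    norm_num
  rw [e]
  calc Real.exp 1 ^ 4 < 2.7182818286 ^ 4 := pow_lt_pow_left₀ h (Real.exp_pos 1).le (by norm_num)
    _ < 55 := by norm_num

/-- The number of steps. With `τ² = T / K`, the error `2 e⁴ K τ⁴ = 2 e⁴ T² / K` is at most `ε / 2`
as soon as `K ≥ 4 e⁴ T² / ε`. -/
lemma exists_steps {ε T : ℝ} (hε : 0 < ε) (hε1 : ε ≤ 1) (hT : 1 ≤ T) : ∃ (K : ℕ) (τ : ℝ),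
    0 < τ ∧ τ ≤ 1 ∧ (K : ℝ) * τ ^ 2 = T ∧ 2 * Real.exp 4 * τ ^ 2 * T ≤ ε / 2 ∧
      τ ^ 2 ≤ ε / T ∧ (K : ℝ) ≤ 250 * (T ^ 2 / ε) := by
  have he : 1 ≤ Real.exp 4 := Real.one_le_exp (by norm_num)
  have hT0 : 0 < T := by linarith
  set y : ℝ := 4 * Real.exp 4 * T ^ 2 / ε with hy
  have hTε : 1 ≤ T ^ 2 / ε := by
    rw [one_le_div hε]
    nlinarith
  have hyT : T / ε ≤ y := by
    rw [hy]
    gcongr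
    nlinarith
  have hTy : T ≤ y := le_trans (by rw [le_div_iff₀ hε]; nlinarith) hyT
  have hK := Nat.le_ceil y
  have hK2 := (Nat.ceil_lt_add_one (by linarith : 0 ≤ y)).le
  set K := ⌈y⌉₊
  have hK0 : (0 : ℝ) < K := by linarith
  refine ⟨K, Real.sqrt (T / K), Real.sqrt_pos.2 (by positivity), ?_, ?_, ?_, ?_, ?_⟩
  · rw [Real.sqrt_le_one, div_le_one hK0]
    linarith
  · rw [Real.sq_sqrt (by positivity)]
    field_simp
  · rw [Real.sq_sqrt (by positivity)]
    have : 2 * Real.exp 4 * (T / K) * T = 2 * Real.exp 4 * T ^ 2 / K := by ring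
    rw [this, div_le_iff₀ hK0]
    have h4 : 4 * Real.exp 4 * T ^ 2 ≤ K * ε := by rwa [hy, div_le_iff₀ hε] at hK
    linarith
  · rw [Real.sq_sqrt (by positivity), div_le_div_iff₀ hK0 hT0]
    have h4 : 4 * Real.exp 4 * T ^ 2 ≤ K * ε := by rwa [hy, div_le_iff₀ hε] at hK
    nlinarith
  · have h5 := exp_four_lt
    have e : y = 4 * Real.exp 4 * (T ^ 2 / ε) := by rw [hy]; ring
    nlinarith

/-- The number of repetitions of phase estimation. Since `(4 / 5)^4 < 1 / 2`, eight repetitions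
halve `(4 / 5)^{g / 2}`, so a multiple of eight that is logarithmic in `2^{2n} T / ε` suffices. -/
lemma exists_repetitions (n : ℕ) {ε T : ℝ} (hε : 0 < ε) (hε1 : ε ≤ 1) (hT : 1 ≤ T) : ∃ g : ℕ,
    0 < g ∧ 16 * 2 ^ (2 * n) * Real.sqrt ((4 / 5 : ℝ) ^ g) * T ≤ ε / 4 ∧
      (g : ℝ) ≤ 64 * (1 + n + Real.logb 2 T + Real.logb 2 (1 / ε)) := by
  have hT0 : 0 < T := by linarith
  have hE : 1 ≤ 1 / ε := by rwa [one_le_div hε]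
  have h2n : (1 : ℝ) ≤ 2 ^ (2 * n) := one_le_pow₀ one_le_two
  have hTE : 1 ≤ T * (1 / ε) := one_le_mul_of_one_le_of_one_le hT hE
  have hy : (1 : ℝ) ≤ 64 * (2 ^ (2 * n) * (T * (1 / ε))) := by
    have := one_le_mul_of_one_le_of_one_le h2n hTE
    linarith
  obtain ⟨m, hm, -, hm2⟩ := exists_two_pow hy
  have hlog : Real.logb 2 (64 * (2 ^ (2 * n) * (T * (1 / ε)))) =
      6 + (2 * n + (Real.logb 2 T + Real.logb 2 (1 / ε))) := by
    rw [Real.logb_mul (by norm_num) (by positivity), Real.logb_mul (by positivity) (by positivity),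
      Real.logb_mul (by positivity) (by positivity)]
    have e1 : Real.logb 2 64 = 6 := by
      rw [Real.logb_eq_iff_rpow_eq] <;> norm_num
    have e2 : Real.logb 2 ((2 : ℝ) ^ (2 * n)) = 2 * n := by
      rw [Real.logb_pow, Real.logb_self_eq_one one_lt_two]
      push_cast
      ring
    rw [e1, e2]
  rw [hlog] at hm2
  have hlT : 0 ≤ Real.logb 2 T := Real.logb_nonneg one_lt_two hT
  have hlE : 0 ≤ Real.logb 2 (1 / ε) := Real.logb_nonneg one_lt_two hE
  refine ⟨8 * (m + 1), by omega, ?_, ?_⟩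
  · have e : Real.sqrt ((4 / 5 : ℝ) ^ (8 * (m + 1))) = ((4 / 5) ^ 4) ^ (m + 1) := by
      rw [Real.sqrt_eq_iff_eq_sq (by positivity) (by positivity)]
      rw [← pow_mul, ← pow_mul]
      congr 1
      ring
    have h45 : ((4 / 5 : ℝ) ^ 4) ^ (m + 1) ≤ (1 / 2) ^ m := by
      calc ((4 / 5 : ℝ) ^ 4) ^ (m + 1) ≤ (1 / 2) ^ (m + 1) :=
            pow_le_pow_left₀ (by positivity) (by norm_num) _
        _ ≤ (1 / 2) ^ m := pow_le_pow_of_le_one (by norm_num) (by norm_num) (by omega)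
    rw [e]
    calc 16 * 2 ^ (2 * n) * ((4 / 5 : ℝ) ^ 4) ^ (m + 1) * T
        ≤ 16 * 2 ^ (2 * n) * (1 / 2) ^ m * T := by gcongr
      _ = (64 * (2 ^ (2 * n) * (T * (1 / ε)))) / 2 ^ m * (ε / 4) := by
        rw [one_div_pow]
        field_simp
        norm_num
      _ ≤ 1 * (ε / 4) := by
        gcongr
        rwa [div_le_one (by positivity)]
      _ = ε / 4 := one_mul _
  · push_cast
    have hn : (0 : ℝ) ≤ n := Nat.cast_nonneg n
    linarith

/-- The number of bits of the energy estimates: `2 ^ r` is the power of two just above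
`160 (1 + β) κ T / ε`. -/
lemma exists_precision (a : ℕ) {β ε T : ℝ} (hβ : 0 ≤ β) (hε : 0 < ε) (hε1 : ε ≤ 1) (hT : 1 ≤ T) :
    ∃ r : ℕ, a ≤ r ∧ PrecisionOK r ((2 : ℝ) ^ a) β ∧ 40 * β * 2 ^ a / 2 ^ r * T ≤ ε / 4 ∧
      (2 : ℝ) ^ r ≤ 320 * (1 + β) * 2 ^ a * T * (1 / ε) ∧
      (r : ℝ) ≤ 9 * (1 + Real.logb 2 (1 + β) + Real.logb 2 ((2 : ℝ) ^ a) + Real.logb 2 T +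
          Real.logb 2 (1 / ε)) := by
  have hT0 : 0 < T := by linarith
  have hE : 1 ≤ 1 / ε := by rwa [one_le_div hε]
  have hTE : 1 ≤ T * (1 / ε) := one_le_mul_of_one_le_of_one_le hT hE
  have ha : (1 : ℝ) ≤ 2 ^ a := one_le_pow₀ one_le_two
  have hβ1 : (1 : ℝ) ≤ 1 + β := by linarith
  have h1 : (1 + β) * 2 ^ a ≤ (1 + β) * 2 ^ a * (T * (1 / ε)) :=
    le_mul_of_one_le_right (by positivity) hTE
  have h2 : (2 : ℝ) ^ a ≤ (1 + β) * 2 ^ a := le_mul_of_one_le_left (by positivity) hβ1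
  obtain ⟨r, hr1, hr2, hr3⟩ := exists_two_pow
    (y := 160 * ((1 + β) * 2 ^ a * (T * (1 / ε)))) (by linarith)
  have hlog : Real.logb 2 (160 * ((1 + β) * 2 ^ a * (T * (1 / ε)))) ≤
      8 + (Real.logb 2 (1 + β) + Real.logb 2 ((2 : ℝ) ^ a) +
        (Real.logb 2 T + Real.logb 2 (1 / ε))) := by
    rw [Real.logb_mul (by norm_num) (by positivity), Real.logb_mul (by positivity) (by positivity),
      Real.logb_mul (by positivity) (by positivity), Real.logb_mul (by positivity) (by positivity)]
    have : Real.logb 2 160 ≤ 8 := by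
      rw [Real.logb_le_iff_le_rpow one_lt_two (by norm_num)]
      norm_num
    linarith
  have hl1 : 0 ≤ Real.logb 2 T := Real.logb_nonneg one_lt_two hT
  have hl2 : 0 ≤ Real.logb 2 (1 / ε) := Real.logb_nonneg one_lt_two hE
  have hl3 : 0 ≤ Real.logb 2 (1 + β) := Real.logb_nonneg one_lt_two hβ1
  have hl4 : 0 ≤ Real.logb 2 ((2 : ℝ) ^ a) := Real.logb_nonneg one_lt_two ha
  refine ⟨r, ?_, ?_, ?_, ?_, ?_⟩
  · rw [← pow_le_pow_iff_right₀ (one_lt_two (α := ℝ))]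
    linarith
  · refine precisionOK_of_le (by positivity) hβ ?_
    nlinarith
  · rw [div_mul_eq_mul_div, div_le_iff₀ (by positivity)]
    calc 40 * β * 2 ^ a * T ≤ 40 * (1 + β) * 2 ^ a * T := by gcongr; linarith
      _ = ε / 4 * (160 * ((1 + β) * 2 ^ a * (T * (1 / ε)))) := by
        field_simp
        norm_num
      _ ≤ _ := by gcongr
  · linarith
  · linarith

/-- The polynomial in `2 ^ r` that bounds the cost of phase estimation. -/
def costPoly : MvPolynomial (Fin 2) ℕ := MvPolynomial.X 0 ^ 2 + 5 * MvPolynomial.X 0 + 2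

lemma aeval_costPoly (x y : ℝ) : MvPolynomial.aeval ![x, y] costPoly = x ^ 2 + 5 * x + 2 := by
  simp [costPoly]

/-- The polynomial in `T`, `β`, `κ`, `1 / ε`, `n` that bounds the running time. -/
def timePoly : MvPolynomial (Fin 5) ℕ :=
  250 * (MvPolynomial.X 0 ^ 2 * MvPolynomial.X 3) *
    (4 * (64 * (1 + MvPolynomial.X 4 + MvPolynomial.X 0 + MvPolynomial.X 3))) *
    ((320 * (1 + MvPolynomial.X 1) * MvPolynomial.X 2 * MvPolynomial.X 0 * MvPolynomial.X 3) ^ 2 +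
      5 * (320 * (1 + MvPolynomial.X 1) * MvPolynomial.X 2 * MvPolynomial.X 0 *
        MvPolynomial.X 3) + 2)

lemma aeval_timePoly (T β κ E m : ℝ) : MvPolynomial.aeval ![T, β, κ, E, m] timePoly =
    250 * (T ^ 2 * E) * (4 * (64 * (1 + m + T + E))) *
      ((320 * (1 + β) * κ * T * E) ^ 2 + 5 * (320 * (1 + β) * κ * T * E) + 2) := by
  simp [timePoly]

end Parameters

end QMetropolis

end

theorem theorem4p3 :
    -- error bounds in terms of the mixing time
    (∀ (n g r a : ℕ) (β : ℝ) (H : QMetropolis.Op n) (J : QMetropolis.JumpEnsemble n),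
      0 < g → 0 ≤ β →
      QMetropolis.SpectrumLE H ((2 : ℝ) ^ a * (1 - 1 / 2 ^ r)) →
      QMetropolis.PrecisionOK r ((2 : ℝ) ^ a) β →
      (∃! σ, QMetropolis.IsFixedState (QMetropolis.generator ((2 : ℝ) ^ a) β H J g r) σ) ∧
      ∀ σ, QMetropolis.IsFixedState (QMetropolis.generator ((2 : ℝ) ^ a) β H J g r) σ →
      ∀ ε : ℝ, 0 < ε →
        (QMetropolis.mixingTimes (QMetropolis.generator ((2 : ℝ) ^ a) β H J g r) σ ε).Nonempty ∧
        QMetropolis.traceNorm (σ - QMetropolis.gibbs β H) ≤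
          ε + QMetropolis.traceNorm
              (QMetropolis.generator ((2 : ℝ) ^ a) β H J g r (QMetropolis.gibbs β H)) *
            QMetropolis.mixingTime (QMetropolis.generator ((2 : ℝ) ^ a) β H J g r) σ ε ∧
        ∀ (τ : ℝ) (K : ℕ), 0 < τ → τ ≤ 1 →
          QMetropolis.InducedNormLE
            (fun M => (QMetropolis.step ((2 : ℝ) ^ a) β H J g r τ)^[K] M -
              QMetropolis.expFlow (QMetropolis.generator ((2 : ℝ) ^ a) β H J g r) (K * τ ^ 2) M)
            (2 * Real.exp 4 * K * τ ^ 4) ∧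
          ((K : ℝ) =
              QMetropolis.mixingTime (QMetropolis.generator ((2 : ℝ) ^ a) β H J g r) σ ε / τ ^ 2 →
            ∀ ρ, QMetropolis.IsState ρ →
              QMetropolis.traceNorm ((QMetropolis.step ((2 : ℝ) ^ a) β H J g r τ)^[K] ρ -
                  QMetropolis.gibbs β H) ≤
                2 * ε +
                  (QMetropolis.fixedPointError n g r ((2 : ℝ) ^ a) β + 2 * Real.exp 4 * τ ^ 2) *
                    QMetropolis.mixingTime
                      (QMetropolis.generator ((2 : ℝ) ^ a) β H J g r) σ ε)) ∧
    -- choice of the parameters and polynomial running time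
    (∃ (A : ℝ) (Q : MvPolynomial (Fin 2) ℕ) (P : MvPolynomial (Fin 5) ℕ),
      ∀ (n a : ℕ) (β ε T : ℝ), 0 ≤ β → 0 < ε → ε ≤ 1 → 1 ≤ T →
      ∃ (g r K : ℕ) (τ : ℝ),
        0 < g ∧ 0 < τ ∧ τ ≤ 1 ∧
        a ≤ r ∧ QMetropolis.PrecisionOK r ((2 : ℝ) ^ a) β ∧
        (K : ℝ) = T / τ ^ 2 ∧
        τ ^ 2 ≤ A * (ε / T) ∧
        (g : ℝ) ≤ A * (1 + n + Real.logb 2 T + Real.logb 2 (1 / ε)) ∧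
        (r : ℝ) ≤ A * (1 + Real.logb 2 (1 + β) + Real.logb 2 ((2 : ℝ) ^ a) + Real.logb 2 T +
          Real.logb 2 (1 / ε)) ∧
        (K : ℝ) ≤ A * (T ^ 2 / ε) ∧
        (K : ℝ) * (4 * g) * MvPolynomial.aeval ![(2 : ℝ) ^ r, (n : ℝ)] Q ≤
          MvPolynomial.aeval ![T, β, (2 : ℝ) ^ a, 1 / ε, (n : ℝ)] P ∧
        ∀ (H : QMetropolis.Op n) (J : QMetropolis.JumpEnsemble n),
          QMetropolis.SpectrumLE H ((2 : ℝ) ^ a * (1 - 1 / 2 ^ r)) →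
          (∀ σ, QMetropolis.IsFixedState (QMetropolis.generator ((2 : ℝ) ^ a) β H J g r) σ →
            QMetropolis.mixingTime (QMetropolis.generator ((2 : ℝ) ^ a) β H J g r) σ ε ≤ T →
            ∀ ρ, QMetropolis.IsState ρ →
              QMetropolis.traceNorm ((QMetropolis.step ((2 : ℝ) ^ a) β H J g r τ)^[K] ρ -
                QMetropolis.gibbs β H) ≤ 3 * ε) ∧
          (∀ C ∈ J.ops, ∀ flip : Bool, ∃ l l' : List (QMetropolis.Gate J g r),
            QMetropolis.circuitEval ((2 : ℝ) ^ a) H l =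
              QMetropolis.unitaryU ((2 : ℝ) ^ a) H g r flip C ∧
            QMetropolis.circuitEval ((2 : ℝ) ^ a) H l' =
              (QMetropolis.unitaryU ((2 : ℝ) ^ a) H g r flip C)ᴴ ∧
            ∀ h c w : ℕ,
              (K : ℝ) * QMetropolis.iterationCost h c w l l' ≤
                (K : ℝ) * (4 * g) * MvPolynomial.aeval ![(2 : ℝ) ^ r, (n : ℝ)] Q *
                  (1 + h + c + w))) := by
  open QMetropolis in
  refine ⟨fun n g r a β H J _ hβ hH hr => ?_, 250, costPoly, timePoly, ?_⟩
  · have hherm : H.IsHermitian := hH.1.1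
    refine ⟨existsUnique_isFixedState hherm, fun σ hσ ε hε => ⟨mixingTimes_nonempty hherm hσ hε,
      traceNorm_stationary_sub_gibbs_le hherm hσ hε, fun τ K h0 h1 =>
        ⟨inducedNormLE_step_sub_flow hherm h0 h1 K, fun hK ρ hρ => ?_⟩⟩⟩
    have hK' : K * τ ^ 2 = mixingTime (generator ((2 : ℝ) ^ a) β H J g r) σ ε := by
      rw [hK, div_mul_cancel₀ _ (by positivity)]
    exact traceNorm_iterate_step_sub_gibbs_le hherm hσ hε
      (traceNorm_generator_gibbs_le J hβ hH hr) h0 h1 le_rfl hK' hρ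
  · intro n a β ε T hβ hε hε1 hT
    obtain ⟨K, τ, hτ0, hτ1, hKτ, hτT, hτε, hKT⟩ := exists_steps hε hε1 hT
    obtain ⟨g, hg0, hgT, hg⟩ := exists_repetitions n hε hε1 hT
    obtain ⟨r, har, hpr, hrT, hr2, hr⟩ := exists_precision a hβ hε hε1 hT
    have hT0 : 0 < T := by linarith
    have hE : 1 ≤ 1 / ε := by rwa [one_le_div hε]
    have hn : (0 : ℝ) ≤ n := Nat.cast_nonneg n
    have hl1 : 0 ≤ Real.logb 2 T := Real.logb_nonneg one_lt_two hT
    have hl2 : 0 ≤ Real.logb 2 (1 / ε) := Real.logb_nonneg one_lt_two hE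
    have hl3 : 0 ≤ Real.logb 2 (1 + β) := Real.logb_nonneg one_lt_two (by linarith)
    have hl4 : 0 ≤ Real.logb 2 ((2 : ℝ) ^ a) :=
      Real.logb_nonneg one_lt_two (one_le_pow₀ one_le_two)
    refine ⟨g, r, K, τ, hg0, hτ0, hτ1, har, hpr, ?_, ?_, by linarith, by linarith, hKT, ?_, ?_⟩
    · rw [← hKτ, mul_div_cancel_right₀ _ (by positivity)]
    · have : 0 ≤ ε / T := by positivity
      linarith
    · rw [aeval_costPoly, aeval_timePoly]
      have h1 := logb_two_le_self hT
      have h2 := logb_two_le_self hE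
      have hK' : (K : ℝ) ≤ 250 * (T ^ 2 * (1 / ε)) := by
        rwa [mul_one_div]
      have hg' : (g : ℝ) ≤ 64 * (1 + n + T + 1 / ε) := by linarith
      gcongr
    · intro H J hH
      have hherm : H.IsHermitian := hH.1.1
      refine ⟨fun σ hσ hmix ρ hρ => ?_, fun C hC flip => ?_⟩
      · refine (traceNorm_iterate_step_sub_gibbs_le hherm hσ hε
          (traceNorm_generator_gibbs_le J hβ hH hpr) hτ0 hτ1 hmix hKτ hρ).trans ?_
        rw [fixedPointError, add_mul, add_mul]
        linarith
      · obtain ⟨l, l', hl, hl', hcost⟩ := implementable_unitaryU (g := g) (r := r)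
          (κ := (2 : ℝ) ^ a) (H := H) flip hC
        refine ⟨l, l', hl, hl', fun h c w => ?_⟩
        have hle := iterationCost_le (w := w) hg0 (hcost h c).1 (hcost h c).2
        have hle' : (iterationCost h c w l l' : ℝ) ≤
            4 * g * ((2 ^ r) ^ 2 + 5 * 2 ^ r + 2) * (1 + h + c + w) := by exact_mod_cast hle
        rw [aeval_costPoly]
        calc (K : ℝ) * iterationCost h c w l l' ≤
              K * (4 * g * ((2 ^ r) ^ 2 + 5 * 2 ^ r + 2) * (1 + h + c + w)) := by gcongr
          _ = _ := by ring
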